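/- For $n\ge 1$ let $F_n$ be the free group on $x_1,\dots,x_n$, let $\mathrm{IA}_n\le \mathrm{Aut}(F_n)$ be the group of automorphisms acting trivially on the abelianization of $F_n$, and for elements $x,y$ of a group put $[x,y]=x^{-1}y^{-1}xy$ and $x^y=y^{-1}xy$. Let $K_{ij}\in\mathrm{IA}_n$ (for $i\neq j$) send $x_i\mapsto x_j^{-1}x_ix_j$ and fix $x_k$ for $k\ne i$, and let $K_{ijk}\in\mathrm{IA}_n$ (for $i,j,k$ distinct) send $x_i\mapsto x_i[x_j,x_k]$ and fix $x_l$ for $l\neq i$. The Magnus generating set of $\mathrm{IA}_n$ is $S=\{K_{ij}: i\ne j\}\cup\{K_{ijk}: i,j,k \text{ distinct},\ j<k\}$. Let $n\ge 8$ and $N=n\binom n2$. Then $S$ has exactly $N$ elements, and for every enumeration $S=\{s_1,\dots,s_N\}$ the commutator subgroup $[\mathrm{IA}_n,\mathrm{IA}_n]$ is generated by the elements $$[s_i,s_j]^{\,s_i^{a_i}s_{i+1}^{a_{i+1}}\cdots s_N^{a_N}},\qquad 1\le i<j\le N,\quad a_m\in\mathbb Z,\quad |a_m|<5\cdot 10^{12}\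 \text{ for all } m.$$ In fact, $[\mathrm{IA}_n,\mathrm{IA}_n]$ is generated by those elements of this form for which, in addition, $|\{m : a_m\neq 0\}|\le 8n^2$. Moreover, there is an absolute constant $C$ such that for every $n\ge 8$ the group $[\mathrm{IA}_n,\mathrm{IA}_n]$ can be generated by at most $C^{n^2}$ elements. -/

import Mathlib

/-- The subgroup `IA_n` of `Aut(F_n)`: automorphisms of the free group on `x_1, …, x_n`
acting trivially on its abelianization. The product in `Aut(F_n)` is composition. -/
def IA (n : ℕ) : Subgroup (MulAut (FreeGroup (Fin n))) where
  carrier := {φ | ∀ w, Abelianization.of (φ w) = Abelianization.of w}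
  one_mem' := fun _ => rfl
  mul_mem' := fun {φ ψ} hφ hψ w => (hφ (ψ w)).trans (hψ w)
  inv_mem' := fun {φ} hφ w => by
    have h := hφ (φ⁻¹ w)
    rw [MulAut.apply_inv_self] at h
    exact h.symm

/-- The commutator `[x, y] = x⁻¹ y⁻¹ x y`. -/
def rcomm {G : Type*} [Group G] (x y : G) : G := x⁻¹ * y⁻¹ * x * y

/-- The conjugate `x ^ y = y⁻¹ x y`. -/
def rconj {G : Type*} [Group G] (x y : G) : G := y⁻¹ * x * y

/-- The endomorphism of the free group sending `x_i` to `w` and fixing the other generators. -/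
def substHom {n : ℕ} (i : Fin n) (w : FreeGroup (Fin n)) :
    FreeGroup (Fin n) →* FreeGroup (Fin n) :=
  FreeGroup.lift (Function.update FreeGroup.of i w)

theorem substHom_self {n : ℕ} (i : Fin n) (w : FreeGroup (Fin n)) :
    substHom i w (FreeGroup.of i) = w := by simp [substHom]

theorem substHom_ne {n : ℕ} {i k : Fin n} (h : k ≠ i) (w : FreeGroup (Fin n)) :
    substHom i w (FreeGroup.of k) = FreeGroup.of k := by simp [substHom, h]

/-- Two mutually inverse substitutions of `x_i` that do not change the class of `x_i` in the
abelianization give an element of `IA_n`. -/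
def substIA {n : ℕ} (i : Fin n) (w w' : FreeGroup (Fin n))
    (h₁ : substHom i w' w = FreeGroup.of i) (h₂ : substHom i w w' = FreeGroup.of i)
    (h₃ : Abelianization.of w = Abelianization.of (FreeGroup.of i)) : IA n :=
  ⟨MonoidHom.toMulEquiv (substHom i w) (substHom i w')
      (by
        ext k
        by_cases hk : k = i
        · subst hk; simp [substHom_self, h₁]
        · simp [substHom_ne hk])
      (by
        ext k
        by_cases hk : k = i
        · subst hk; simp [substHom_self, h₂]
        · simp [substHom_ne hk]),
    by
      have h : Abelianization.of.comp (substHom i w) = Abelianization.of := by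
        ext k
        by_cases hk : k = i
        · subst hk; simp [substHom_self, h₃]
        · simp [substHom_ne hk]
      exact fun v => DFunLike.congr_fun h v⟩

/-- The Magnus generator `K_{ij}`, `i ≠ j`: `x_i ↦ x_j⁻¹ x_i x_j`, and `x_k ↦ x_k` for `k ≠ i`. -/
def magnusPair {n : ℕ} (i j : Fin n) (hij : i ≠ j) : IA n :=
  substIA i
    ((FreeGroup.of j)⁻¹ * FreeGroup.of i * FreeGroup.of j)
    (FreeGroup.of j * FreeGroup.of i * (FreeGroup.of j)⁻¹)
    (by simp [substHom_self, substHom_ne hij.symm, mul_assoc])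
    (by simp [substHom_self, substHom_ne hij.symm, mul_assoc])
    (by simp [mul_comm])

/-- The Magnus generator `K_{ijk}`, `i, j, k` distinct: `x_i ↦ x_i [x_j, x_k]`, and
`x_l ↦ x_l` for `l ≠ i`. -/
def magnusTriple {n : ℕ} (i j k : Fin n) (hij : i ≠ j) (hik : i ≠ k) : IA n :=
  substIA i
    (FreeGroup.of i * rcomm (FreeGroup.of j) (FreeGroup.of k))
    (FreeGroup.of i * (rcomm (FreeGroup.of j) (FreeGroup.of k))⁻¹)
    (by simp [rcomm, substHom_self, substHom_ne hij.symm, substHom_ne hik.symm, mul_assoc])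
    (by simp [rcomm, substHom_self, substHom_ne hij.symm, substHom_ne hik.symm, mul_assoc])
    (by simp [rcomm, mul_assoc, mul_comm])

theorem magnusPair_self {n : ℕ} (i j : Fin n) (hij : i ≠ j) :
    (magnusPair i j hij).1 (FreeGroup.of i) =
      (FreeGroup.of j)⁻¹ * FreeGroup.of i * FreeGroup.of j :=
  substHom_self _ _

theorem magnusPair_ne {n : ℕ} (i j : Fin n) (hij : i ≠ j) (k : Fin n) (hk : k ≠ i) :
    (magnusPair i j hij).1 (FreeGroup.of k) = FreeGroup.of k :=
  substHom_ne hk _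

theorem magnusTriple_self {n : ℕ} (i j k : Fin n) (hij : i ≠ j) (hik : i ≠ k) :
    (magnusTriple i j k hij hik).1 (FreeGroup.of i) =
      FreeGroup.of i * rcomm (FreeGroup.of j) (FreeGroup.of k) :=
  substHom_self _ _

theorem magnusTriple_ne {n : ℕ} (i j k : Fin n) (hij : i ≠ j) (hik : i ≠ k) (l : Fin n)
    (hl : l ≠ i) : (magnusTriple i j k hij hik).1 (FreeGroup.of l) = FreeGroup.of l :=
  substHom_ne hl _

/-- The Magnus generating set `{K_{ij} : i ≠ j} ∪ {K_{ijk} : i, j, k distinct, j < k}`. -/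
def magnusSet (n : ℕ) : Set (IA n) :=
  {g | ∃ (i j : Fin n) (hij : i ≠ j), g = magnusPair i j hij} ∪
  {g | ∃ (i j k : Fin n) (hij : i ≠ j) (hik : i ≠ k), j < k ∧ g = magnusTriple i j k hij hik}

/-- The ordered product `s_i ^ a_i * s_{i+1} ^ a_{i+1} * ⋯ * s_N ^ a_N`. -/
def tailProd {G : Type*} [Group G] {N : ℕ} (s : Fin N → G) (i : Fin N) (a : Fin N → ℤ) : G :=
  (((List.finRange N).filter (fun m => i ≤ m)).map (fun m => s m ^ a m)).prod

/-!
The argument is discrete Morse theory on the Cayley graph of `IA_n` for the Magnus generators.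

*Generators and coordinates.* Nielsen reduction shows that transvections and signed permutations
generate `Aut(F_n)` (`nielsenSubgroup_eq_top`). In the quotient of `Aut(F_n)` by the subgroup
generated by the Magnus generators and their conjugates by signed permutations, which is normal,
transvections satisfy the Steinberg relations. By induction on the dimension, these suffice to
compute the stabilizer of a basis vector of `ℤ^n`: two ways of shortening an integral vector by
transvections are confluent (`Reach.shortens`). Hence only the trivial class acts trivially on
`ℤ^n`, which is Magnus' theorem (`closure_letters`, `closure_magnusSet`). On the other hand,
counting exponent sums in `x_i⁻¹ φ(x_i)` modulo triple commutators, that is, after passing to the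
integral Heisenberg group, gives homomorphisms `IA_n → ℤ` dual to the Magnus generators
(`exists_dual`). So there are `N` of these, and they define coordinates `p : IA_n → ℤ^N` that
send the generator `s_m` to the basis vector `e_m`.

*Commutators from paths.* For `u ∈ IA_n` let `P(u)` be the product of the powers `s_m ^ a_m` in
increasing order of `m`, where `a = p u`. If `u` is replaced by `s_j u`, the element `P(u)⁻¹ u`
changes by commutators `[s_i, s_j]` conjugated by tails of ordered products with exponent vectors
bounded by `a` (`listProd_inv_mul_mem`). For an element `u` of the commutator subgroup `p u = 0`
and hence `P(u) = 1`. Following a path from `1` to `u` expresses `u` through such conjugates, with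
exponent vectors bounded by coordinates met on the path. So it is enough to use exponent vectors
in a set over which the Cayley graph is connected (`closure_tailCommutators`).

*The core.* It remains to find a small such part. Take the vertices whose coordinates are less
than `5 * 10 ^ 12` in absolute value and nonzero only for generators that fail to commute with
one of two given generators; there are at most `8 * n ^ 2` such generators
(`card_linkSupport_le`), which also yields the bound on the rank (`card_coreFinset_le`). Let the
height of a vertex `z` be the squared norm of `p z`. By `conn_of_descending` it is enough that
for a vertex `z` outside the core any two descending neighbours `s_i^{±1} z` and `s_j^{±1} z` are
joined by a path below `z`. If some `s_m` with `(p z)_m ≠ 0` commutes with `s_i` and `s_j`, two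
squares give such a path (`conn_lower_of_commute_gen`). Otherwise some coordinate of `z` is huge.

*Anchors.* Let `m` be the index of the largest coordinate of `z`, of absolute value `M`. The
character `χ = ⟨p z, p ·⟩` takes the value `±M` at `s_m`. Call short words `y` with `2 |χ y| ≥ M`
anchors: the height drops steeply along powers of `y` or `y⁻¹`, so that far down in this
direction bounded detours stay below `z`. High powers of commuting anchors are joined below `z`
through their products, and an element commuting with an anchor can be inserted there one letter
at a time. It follows that the two descending neighbours are joined below `z`, provided that each
generator is a bounded product of elements that commute with anchors linked to `s_m` by chains of
commuting anchors (`conn_lower_of_good`, `conn_lower_of_isDeep`). This is where `n ≥ 8` is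
needed: given an anchor and a generator, there are two indices that do not occur in either of
them, and with their help one moves the anchor away from the generator
(`TripleAnchor.good_letters`, `good_letters_of_forall_conjGen`,
`good_letters_of_exists_conjGen`).
-/


/-! ### Flanking substitutions and the letters of `IA_n` -/

section Basics

variable {n : ℕ}

theorem mulAut_ext_of {f g : MulAut (FreeGroup (Fin n))}
    (h : ∀ k, f (FreeGroup.of k) = g (FreeGroup.of k)) : f = g := by
  have : f.toMonoidHom = g.toMonoidHom := FreeGroup.ext_hom _ _ h
  ext x
  exact DFunLike.congr_fun this x

theorem substHom_substHom_one (i : Fin n) (w u : FreeGroup (Fin n)) :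
    substHom i w (substHom i 1 u) = substHom i 1 u := by
  have : (substHom i w).comp (substHom i 1) = substHom i 1 := by
    ext k
    by_cases hk : k = i
    · subst hk; simp [substHom_self]
    · simp [substHom_ne hk]
  exact DFunLike.congr_fun this u

/-- The automorphism `x_i ↦ u x_i v` fixing the other generators. So that it is defined for all
words `u` and `v`, the occurrences of `x_i` are first erased from them. -/
def flank (i : Fin n) (u v : FreeGroup (Fin n)) : MulAut (FreeGroup (Fin n)) :=
  MonoidHom.toMulEquiv
    (substHom i (substHom i 1 u * FreeGroup.of i * substHom i 1 v))
    (substHom i ((substHom i 1 u)⁻¹ * FreeGroup.of i * (substHom i 1 v)⁻¹))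
    (by
      ext k
      by_cases hk : k = i
      · subst hk; simp [substHom_self, substHom_substHom_one, mul_assoc]
      · simp [substHom_ne hk])
    (by
      ext k
      by_cases hk : k = i
      · subst hk; simp [substHom_self, substHom_substHom_one, mul_assoc]
      · simp [substHom_ne hk])

theorem flank_self (i : Fin n) (u v : FreeGroup (Fin n)) :
    flank i u v (FreeGroup.of i) = substHom i 1 u * FreeGroup.of i * substHom i 1 v :=
  substHom_self _ _

theorem flank_ne {i k : Fin n} (h : k ≠ i) (u v : FreeGroup (Fin n)) :
    flank i u v (FreeGroup.of k) = FreeGroup.of k :=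
  substHom_ne h _

theorem flank_erase (i : Fin n) (u v w : FreeGroup (Fin n)) :
    flank i u v (substHom i 1 w) = substHom i 1 w :=
  substHom_substHom_one _ _ _

theorem flank_mul (i : Fin n) (u v u' v' : FreeGroup (Fin n)) :
    flank i u v * flank i u' v' = flank i (u' * u) (v * v') := by
  refine mulAut_ext_of fun k => ?_
  by_cases hk : k = i
  · subst hk; simp [flank_self, flank_erase, mul_assoc]
  · simp [flank_ne hk]

theorem flank_one (i : Fin n) : flank i 1 1 = 1 := by
  refine mulAut_ext_of fun k => ?_
  by_cases hk : k = i
  · subst hk; simp [flank_self]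
  · simp [flank_ne hk]

theorem flank_inv (i : Fin n) (u v : FreeGroup (Fin n)) :
    (flank i u v)⁻¹ = flank i u⁻¹ v⁻¹ := by
  rw [inv_eq_iff_mul_eq_one, flank_mul]; simp [flank_one]

theorem mem_IA_of_gen {φ : MulAut (FreeGroup (Fin n))}
    (h : ∀ k, Abelianization.of (φ (FreeGroup.of k)) = Abelianization.of (FreeGroup.of k)) :
    φ ∈ IA n := by
  have : Abelianization.of.comp φ.toMonoidHom = Abelianization.of := FreeGroup.ext_hom _ _ h
  exact fun w => DFunLike.congr_fun this w

instance IA_normal (n : ℕ) : (IA n).Normal where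
  conj_mem φ hφ θ w := by
    have key : ∀ u v : FreeGroup (Fin n), Abelianization.of u = Abelianization.of v →
        Abelianization.of (θ u) = Abelianization.of (θ v) := by
      intro u v huv
      have := congrArg (Abelianization.map θ.toMonoidHom) huv
      simpa [Abelianization.map_of] using this
    have := key _ _ (hφ (θ⁻¹ w))
    simpa using this

theorem flank_mem_IA (i : Fin n) (u v : FreeGroup (Fin n))
    (h : Abelianization.of (substHom i 1 (u * v)) = 1) : flank i u v ∈ IA n := by
  refine mem_IA_of_gen fun k => ?_
  by_cases hk : k = i
  · subst hk
    rw [map_mul, map_mul] at h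
    rw [flank_self, map_mul, map_mul, mul_right_comm, h, one_mul]
  · rw [flank_ne hk]

/-- The partial conjugation `x_i ↦ w⁻¹ x_i w`, as a homomorphism in `w`. -/
def conjGen (i : Fin n) : FreeGroup (Fin n) →* IA n where
  toFun w := ⟨flank i w⁻¹ w, flank_mem_IA _ _ _ (by simp)⟩
  map_one' := by ext1; simp [flank_one]
  map_mul' x y := by ext1; simp [flank_mul]

/-- The automorphism `x_i ↦ x_i [u, w]`. -/
def commRight (i : Fin n) (u w : FreeGroup (Fin n)) : IA n :=
  ⟨flank i 1 (rcomm u w), flank_mem_IA _ _ _ (by simp [rcomm, mul_comm])⟩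

/-- The automorphism `x_i ↦ [u, w] x_i`. -/
def commLeft (i : Fin n) (u w : FreeGroup (Fin n)) : IA n :=
  ⟨flank i (rcomm u w) 1, flank_mem_IA _ _ _ (by simp [rcomm, mul_comm])⟩

theorem coe_conjGen (i : Fin n) (w : FreeGroup (Fin n)) :
    (conjGen i w : MulAut (FreeGroup (Fin n))) = flank i w⁻¹ w := rfl

theorem coe_commRight (i : Fin n) (u w : FreeGroup (Fin n)) :
    (commRight i u w : MulAut (FreeGroup (Fin n))) = flank i 1 (rcomm u w) := rfl

theorem coe_commLeft (i : Fin n) (u w : FreeGroup (Fin n)) :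
    (commLeft i u w : MulAut (FreeGroup (Fin n))) = flank i (rcomm u w) 1 := rfl

theorem magnusPair_eq (i j : Fin n) (hij : i ≠ j) :
    magnusPair i j hij = conjGen i (FreeGroup.of j) := by
  ext1
  refine mulAut_ext_of fun k => ?_
  by_cases hk : k = i
  · subst hk
    rw [magnusPair_self, coe_conjGen, flank_self]; simp [substHom_ne hij.symm]
  · rw [magnusPair_ne _ _ _ _ hk, coe_conjGen, flank_ne hk]

theorem magnusTriple_eq (i j k : Fin n) (hij : i ≠ j) (hik : i ≠ k) :
    magnusTriple i j k hij hik = commRight i (FreeGroup.of j) (FreeGroup.of k) := by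
  ext1
  refine mulAut_ext_of fun l => ?_
  by_cases hl : l = i
  · subst hl
    rw [magnusTriple_self, coe_commRight, flank_self]
    simp [substHom_ne hij.symm, substHom_ne hik.symm, rcomm]
  · rw [magnusTriple_ne _ _ _ _ _ _ hl, coe_commRight, flank_ne hl]

theorem commRight_swap (i : Fin n) (u w : FreeGroup (Fin n)) :
    commRight i w u = (commRight i u w)⁻¹ := by
  ext1
  simp only [coe_commRight, Subgroup.coe_inv, flank_inv, rcomm]
  congr 1; group

theorem commLeft_swap (i : Fin n) (u w : FreeGroup (Fin n)) :
    commLeft i w u = (commLeft i u w)⁻¹ := by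
  ext1
  simp only [coe_commLeft, Subgroup.coe_inv, flank_inv, rcomm]
  congr 1; group

theorem commRight_self (i : Fin n) (u : FreeGroup (Fin n)) : commRight i u u = 1 := by
  ext1
  simp [coe_commRight, rcomm, flank_one]

theorem commRight_one_left (i : Fin n) (u : FreeGroup (Fin n)) : commRight i 1 u = 1 := by
  ext1
  simp [coe_commRight, rcomm, flank_one]

theorem commRight_one_right (i : Fin n) (u : FreeGroup (Fin n)) : commRight i u 1 = 1 := by
  ext1
  simp [coe_commRight, rcomm, flank_one]

theorem commRight_mul_left (i : Fin n) (u v w : FreeGroup (Fin n)) :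
    commRight i (u * v) w =
      (conjGen i v)⁻¹ * commRight i u w * conjGen i v * commRight i v w := by
  ext1
  simp only [coe_commRight, coe_conjGen, Subgroup.coe_inv, Subgroup.coe_mul, flank_inv, flank_mul,
    rcomm]
  congr 1 <;> group

theorem commRight_inv_left (i : Fin n) (u w : FreeGroup (Fin n)) :
    commRight i u⁻¹ w = conjGen i u * (commRight i u w)⁻¹ * (conjGen i u)⁻¹ := by
  ext1
  simp only [coe_commRight, coe_conjGen, Subgroup.coe_inv, Subgroup.coe_mul, flank_inv, flank_mul,
    rcomm]
  congr 1 <;> group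

theorem commRight_inv_right (i : Fin n) (u w : FreeGroup (Fin n)) :
    commRight i u w⁻¹ = conjGen i w * (commRight i u w)⁻¹ * (conjGen i w)⁻¹ := by
  rw [commRight_swap, commRight_inv_left, commRight_swap i u w]; group

theorem commRight_mul_right (i : Fin n) (u v w : FreeGroup (Fin n)) :
    commRight i u (v * w) =
      commRight i u w * (conjGen i w)⁻¹ * commRight i u v * conjGen i w := by
  rw [commRight_swap, commRight_mul_left, commRight_swap i u v, commRight_swap i u w]; group

theorem commLeft_eq (i : Fin n) (u w : FreeGroup (Fin n)) :
    commLeft i u w = commRight i u w * (conjGen i (rcomm u w))⁻¹ := by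
  ext1
  simp only [coe_commRight, coe_commLeft, coe_conjGen, Subgroup.coe_inv, Subgroup.coe_mul,
    flank_inv, flank_mul, rcomm]
  congr 1 <;> group

/-- The letter `x_j` or `x_j⁻¹`. -/
def sgen (j : Fin n) (b : Bool) : FreeGroup (Fin n) := FreeGroup.mk [(j, b)]

theorem sgen_true (j : Fin n) : sgen j true = FreeGroup.of j := rfl

theorem sgen_false (j : Fin n) : sgen j false = (FreeGroup.of j)⁻¹ := rfl

theorem sgen_inv (j : Fin n) (b : Bool) : (sgen j b)⁻¹ = sgen j (!b) := by
  cases b <;> simp [sgen_true, sgen_false]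

/-- The elements `x_i ↦ t⁻¹ x_i t`, `x_i ↦ x_i [t, t']`, `x_i ↦ [t, t'] x_i` of `IA_n`, where `t`
and `t'` are letters. Up to inverses, these are the conjugates of the Magnus generators by signed
permutations of the basis (and the identity, when a letter `x_i^{±1}` gets erased). -/
def letters (n : ℕ) : Set (IA n) :=
  {g | (∃ i j b, g = conjGen i (sgen j b)) ∨
    (∃ i j b k c, g = commRight i (sgen j b) (sgen k c)) ∨
    (∃ i j b k c, g = commLeft i (sgen j b) (sgen k c))}

theorem conjGen_mem_letters (i j : Fin n) (b : Bool) : conjGen i (sgen j b) ∈ letters n :=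
  Or.inl ⟨i, j, b, rfl⟩

theorem commRight_mem_letters (i j k : Fin n) (b c : Bool) :
    commRight i (sgen j b) (sgen k c) ∈ letters n :=
  Or.inr (Or.inl ⟨i, j, b, k, c, rfl⟩)

theorem commLeft_mem_letters (i j k : Fin n) (b c : Bool) :
    commLeft i (sgen j b) (sgen k c) ∈ letters n :=
  Or.inr (Or.inr ⟨i, j, b, k, c, rfl⟩)

theorem inv_mem_letters {g : IA n} (hg : g ∈ letters n) : g⁻¹ ∈ letters n := by
  rcases hg with ⟨i, j, b, rfl⟩ | ⟨i, j, b, k, c, rfl⟩ | ⟨i, j, b, k, c, rfl⟩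
  · rw [← map_inv, sgen_inv]; exact conjGen_mem_letters _ _ _
  · rw [← commRight_swap]; exact commRight_mem_letters _ _ _ _ _
  · rw [← commLeft_swap]; exact commLeft_mem_letters _ _ _ _ _

/-- `HasLen S l g`: the element `g` is a product of at most `l` elements of `S`. -/
def HasLen {G : Type*} [Group G] (S : Set G) (l : ℕ) (g : G) : Prop :=
  ∃ L : List G, (∀ x ∈ L, x ∈ S) ∧ L.length ≤ l ∧ L.prod = g

section HasLen

variable {G : Type*} [Group G] {S : Set G}

theorem HasLen.of_mem {g : G} (h : g ∈ S) : HasLen S 1 g :=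
  ⟨[g], by simpa using h, by simp, by simp⟩

theorem HasLen.one (l : ℕ) : HasLen S l 1 := ⟨[], by simp, by simp, by simp⟩

theorem HasLen.mul {l m : ℕ} {g h : G} (hg : HasLen S l g) (hh : HasLen S m h) :
    HasLen S (l + m) (g * h) := by
  obtain ⟨L, h1, h2, rfl⟩ := hg
  obtain ⟨M, h3, h4, rfl⟩ := hh
  refine ⟨L ++ M, fun x hx => ?_, by simp; omega, by simp⟩
  rcases List.mem_append.1 hx with hx | hx
  exacts [h1 x hx, h3 x hx]

theorem HasLen.mono {l m : ℕ} {g : G} (hg : HasLen S l g) (h : l ≤ m) : HasLen S m g := by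
  obtain ⟨L, h1, h2, h3⟩ := hg
  exact ⟨L, h1, h2.trans h, h3⟩

theorem HasLen.inv (hS : ∀ x ∈ S, x⁻¹ ∈ S) {l : ℕ} {g : G} (hg : HasLen S l g) :
    HasLen S l g⁻¹ := by
  obtain ⟨L, h1, h2, rfl⟩ := hg
  refine ⟨(L.map (·⁻¹)).reverse, fun x hx => ?_, by simpa using h2, by
    rw [List.prod_inv_reverse]⟩
  simp only [List.mem_reverse, List.mem_map] at hx
  obtain ⟨y, hy, rfl⟩ := hx
  exact hS y (h1 y hy)

theorem HasLen.mem_closure {l : ℕ} {g : G} (hg : HasLen S l g) : g ∈ Subgroup.closure S := by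
  obtain ⟨L, h1, h2, rfl⟩ := hg
  exact Subgroup.list_prod_mem _ fun x hx => Subgroup.subset_closure (h1 x hx)

/-- Lengths grow at most by the factor `c` under a homomorphism that maps each letter to an
element of length at most `c`. -/
theorem HasLen.map {H : Type*} [Group H] {S' : Set H} (f : G →* H) {c : ℕ}
    (hf : ∀ x ∈ S, HasLen S' c (f x)) {l : ℕ} {g : G} (hg : HasLen S l g) :
    HasLen S' (c * l) (f g) := by
  obtain ⟨L, h1, h2, rfl⟩ := hg
  refine HasLen.mono (l := c * L.length) ?_ (Nat.mul_le_mul_left _ h2)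
  clear h2
  induction L with
  | nil => simpa using HasLen.one _
  | cons x L ih =>
    simp only [List.prod_cons, map_mul, List.length_cons]
    have := (hf x (h1 x (by simp))).mul (ih fun y hy => h1 y (by simp [hy]))
    exact this.mono (by ring_nf; omega)

end HasLen

theorem hasLen_conjGen_sgen (i j : Fin n) (b : Bool) :
    HasLen (letters n) 1 (conjGen i (sgen j b)) :=
  .of_mem (conjGen_mem_letters _ _ _)

theorem hasLen_conjGen_of (i j : Fin n) : HasLen (letters n) 1 (conjGen i (FreeGroup.of j)) :=
  hasLen_conjGen_sgen i j true

theorem hasLen_commRight (i j k : Fin n) (b c : Bool) :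
    HasLen (letters n) 1 (commRight i (sgen j b) (sgen k c)) :=
  .of_mem (commRight_mem_letters _ _ _ _ _)

theorem hasLen_commLeft (i j k : Fin n) (b c : Bool) :
    HasLen (letters n) 1 (commLeft i (sgen j b) (sgen k c)) :=
  .of_mem (commLeft_mem_letters _ _ _ _ _)

theorem HasLen.linv {l : ℕ} {g : IA n} (hg : HasLen (letters n) l g) :
    HasLen (letters n) l g⁻¹ :=
  HasLen.inv (fun _ => inv_mem_letters) hg

/-- The action of `Aut(F_n)` on `IA_n` by conjugation. -/
def conjIA (θ : MulAut (FreeGroup (Fin n))) : MulAut (IA n) := MulAut.conjNormal θ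

theorem coe_conjIA (θ : MulAut (FreeGroup (Fin n))) (g : IA n) :
    (conjIA θ g : MulAut (FreeGroup (Fin n))) = θ * g * θ⁻¹ := MulAut.conjNormal_apply θ g

theorem conjIA_mul (θ θ' : MulAut (FreeGroup (Fin n))) (g : IA n) :
    conjIA (θ * θ') g = conjIA θ (conjIA θ' g) := by
  simp [conjIA]

theorem conjIA_apply_inv (θ : MulAut (FreeGroup (Fin n))) (g : IA n) :
    conjIA θ (conjIA θ⁻¹ g) = g := by
  rw [← conjIA_mul]; simp [conjIA]

/-- The signed permutation `x_i ↦ x_{σ i}^{±1}` of the basis, with exponent `-1` when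
`ε i = false`. -/
def signedPerm (σ : Equiv.Perm (Fin n)) (ε : Fin n → Bool) : MulAut (FreeGroup (Fin n)) :=
  MonoidHom.toMulEquiv (FreeGroup.lift fun i => sgen (σ i) (ε i))
    (FreeGroup.lift fun j => sgen (σ.symm j) (ε (σ.symm j)))
    (by ext k; cases h : ε k <;> simp [sgen_true, sgen_false, h])
    (by ext k; cases h : ε (σ.symm k) <;> simp [sgen_true, sgen_false, h])

theorem signedPerm_of (σ : Equiv.Perm (Fin n)) (ε : Fin n → Bool) (i : Fin n) :
    signedPerm σ ε (FreeGroup.of i) = sgen (σ i) (ε i) :=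
  FreeGroup.lift_apply_of (f := fun i => sgen (σ i) (ε i))

theorem signedPerm_sgen (σ : Equiv.Perm (Fin n)) (ε : Fin n → Bool) (i : Fin n) (b : Bool) :
    signedPerm σ ε (sgen i b) = sgen (σ i) (ε i == b) := by
  cases b <;> cases h : ε i <;> simp [sgen_true, sgen_false, signedPerm_of, h]

theorem signedPerm_erase (σ : Equiv.Perm (Fin n)) (ε : Fin n → Bool) (i : Fin n)
    (u : FreeGroup (Fin n)) :
    signedPerm σ ε (substHom i 1 u) = substHom (σ i) 1 (signedPerm σ ε u) := by
  have : (signedPerm σ ε).toMonoidHom.comp (substHom i 1) =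
      (substHom (σ i) 1).comp (signedPerm σ ε).toMonoidHom := by
    ext k
    by_cases hk : k = i
    · subst hk
      cases h : ε k <;> simp [signedPerm_of, substHom_self, sgen_true, sgen_false, h]
    · have : σ k ≠ σ i := fun h => hk (σ.injective h)
      cases h : ε k <;>
        simp [signedPerm_of, substHom_ne hk, sgen_true, sgen_false, h, substHom_ne this]
  exact DFunLike.congr_fun this u

theorem signedPerm_conj_flank (σ : Equiv.Perm (Fin n)) (ε : Fin n → Bool) (i : Fin n)
    (u v : FreeGroup (Fin n)) :
    signedPerm σ ε * flank i u v * (signedPerm σ ε)⁻¹ =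
      if ε i then flank (σ i) (signedPerm σ ε u) (signedPerm σ ε v)
      else flank (σ i) (signedPerm σ ε v)⁻¹ (signedPerm σ ε u)⁻¹ := by
  rw [mul_inv_eq_iff_eq_mul]
  refine mulAut_ext_of fun k => ?_
  by_cases hk : k = i
  · subst hk
    cases h : ε k <;> simp [signedPerm_of, flank_self, signedPerm_erase, h, sgen_true, sgen_false,
      mul_assoc]
  · have : σ k ≠ σ i := fun h => hk (σ.injective h)
    cases h : ε k <;> cases h' : ε i <;> simp [signedPerm_of, flank_ne hk, h, sgen_true, sgen_false,
      flank_ne this]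

theorem conjIA_signedPerm_conjGen (σ : Equiv.Perm (Fin n)) (ε : Fin n → Bool) (i : Fin n)
    (w : FreeGroup (Fin n)) :
    conjIA (signedPerm σ ε) (conjGen i w) = conjGen (σ i) (signedPerm σ ε w) := by
  ext1
  rw [coe_conjIA, coe_conjGen, signedPerm_conj_flank, coe_conjGen]
  cases ε i <;> simp

theorem conjIA_signedPerm_commRight (σ : Equiv.Perm (Fin n)) (ε : Fin n → Bool) (i : Fin n)
    (u w : FreeGroup (Fin n)) :
    conjIA (signedPerm σ ε) (commRight i u w) =
      if ε i then commRight (σ i) (signedPerm σ ε u) (signedPerm σ ε w)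
      else commLeft (σ i) (signedPerm σ ε w) (signedPerm σ ε u) := by
  ext1
  rw [coe_conjIA, coe_commRight, signedPerm_conj_flank]
  cases ε i <;> simp [coe_commRight, coe_commLeft, rcomm, mul_assoc]

theorem conjIA_signedPerm_commLeft (σ : Equiv.Perm (Fin n)) (ε : Fin n → Bool) (i : Fin n)
    (u w : FreeGroup (Fin n)) :
    conjIA (signedPerm σ ε) (commLeft i u w) =
      if ε i then commLeft (σ i) (signedPerm σ ε u) (signedPerm σ ε w)
      else commRight (σ i) (signedPerm σ ε w) (signedPerm σ ε u) := by
  ext1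
  rw [coe_conjIA, coe_commLeft, signedPerm_conj_flank]
  cases ε i <;> simp [coe_commRight, coe_commLeft, rcomm, mul_assoc]

theorem conjIA_signedPerm_mem_letters (σ : Equiv.Perm (Fin n)) (ε : Fin n → Bool) {g : IA n}
    (hg : g ∈ letters n) : conjIA (signedPerm σ ε) g ∈ letters n := by
  rcases hg with ⟨i, j, b, rfl⟩ | ⟨i, j, b, k, c, rfl⟩ | ⟨i, j, b, k, c, rfl⟩
  · rw [conjIA_signedPerm_conjGen, signedPerm_sgen]; exact conjGen_mem_letters _ _ _
  · rw [conjIA_signedPerm_commRight, signedPerm_sgen, signedPerm_sgen]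
    split_ifs
    exacts [commRight_mem_letters _ _ _ _ _, commLeft_mem_letters _ _ _ _ _]
  · rw [conjIA_signedPerm_commLeft, signedPerm_sgen, signedPerm_sgen]
    split_ifs
    exacts [commLeft_mem_letters _ _ _ _ _, commRight_mem_letters _ _ _ _ _]

theorem HasLen.conjIA_signedPerm (σ : Equiv.Perm (Fin n)) (ε : Fin n → Bool) {l : ℕ} {g : IA n}
    (hg : HasLen (letters n) l g) : HasLen (letters n) l (conjIA (signedPerm σ ε) g) := by
  have := hg.map (S' := letters n) (conjIA (signedPerm σ ε)).toMonoidHom (c := 1)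
    fun x hx => .of_mem (conjIA_signedPerm_mem_letters σ ε hx)
  simpa using this

end Basics

/-! ### Conjugation of letters by Nielsen transvections -/

section Transvections

variable {n : ℕ}

/-- The Nielsen transvection `x_b ↦ x_b x_a`. -/
def transv (a b : Fin n) : MulAut (FreeGroup (Fin n)) := flank b 1 (FreeGroup.of a)

theorem transv_self {a b : Fin n} (h : a ≠ b) :
    transv a b (FreeGroup.of b) = FreeGroup.of b * FreeGroup.of a := by
  rw [transv, flank_self, substHom_ne h]; simp

theorem transv_ne {b k : Fin n} (h : k ≠ b) (a : Fin n) :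
    transv a b (FreeGroup.of k) = FreeGroup.of k := flank_ne h _ _

theorem transv_inv (a b : Fin n) : (transv a b)⁻¹ = flank b 1 (FreeGroup.of a)⁻¹ := by
  rw [transv, flank_inv]; simp

theorem transv_inv_self {a b : Fin n} (h : a ≠ b) :
    (transv a b)⁻¹ (FreeGroup.of b) = FreeGroup.of b * (FreeGroup.of a)⁻¹ := by
  rw [transv_inv, flank_self, map_inv, substHom_ne h]; simp

theorem transv_inv_ne {b k : Fin n} (h : k ≠ b) (a : Fin n) :
    (transv a b)⁻¹ (FreeGroup.of k) = FreeGroup.of k := by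
  rw [transv_inv, flank_ne h]

theorem transv_conj_flank_self (a b : Fin n) (u v : FreeGroup (Fin n)) :
    transv a b * flank b u v * (transv a b)⁻¹ =
      flank b u (FreeGroup.of a * v * (FreeGroup.of a)⁻¹) := by
  simp [transv, flank_mul, flank_inv]

theorem transv_erase {a b i : Fin n} (hib : i ≠ b) (hia : i ≠ a) (u : FreeGroup (Fin n)) :
    transv a b (substHom i 1 u) = substHom i 1 (transv a b u) := by
  have : (transv a b).toMonoidHom.comp (substHom i 1) =
      (substHom i 1).comp (transv a b).toMonoidHom := by
    by_cases hab : a = b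
    · subst hab
      have h1 : transv a a = 1 := by
        refine mulAut_ext_of fun k => ?_
        by_cases hk : k = a
        · subst hk; simp [transv, flank_self, substHom_self]
        · simp [transv_ne hk]
      rw [h1]; ext k; simp
    ext k
    by_cases hk : k = i
    · subst hk; simp [substHom_self, transv_ne hib]
    · by_cases hkb : k = b
      · subst hkb
        simp [substHom_ne hk, transv_self hab, substHom_ne hia.symm]
      · simp [substHom_ne hk, transv_ne hkb]
  exact DFunLike.congr_fun this u

theorem transv_conj_flank {a b i : Fin n} (hib : i ≠ b) (hia : i ≠ a) (u v : FreeGroup (Fin n)) :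
    transv a b * flank i u v * (transv a b)⁻¹ = flank i (transv a b u) (transv a b v) := by
  rw [mul_inv_eq_iff_eq_mul]
  refine mulAut_ext_of fun k => ?_
  by_cases hk : k = i
  · subst hk
    simp [flank_self, transv_ne hib, transv_erase hib hia]
  · by_cases hkb : k = b
    · subst hkb
      by_cases hab : a = k
      · subst hab
        have : transv a a (FreeGroup.of a) = FreeGroup.of a := by
          simp [transv, flank_self, substHom_self]
        simp [flank_ne hk, this]
      · simp [flank_ne hk, transv_self hab, flank_ne hia.symm]
    · simp [flank_ne hk, transv_ne hkb]

theorem conjIA_transv_conjGen {a b i : Fin n} (hib : i ≠ b) (hia : i ≠ a)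
    (w : FreeGroup (Fin n)) :
    conjIA (transv a b) (conjGen i w) = conjGen i (transv a b w) := by
  ext1; simp [coe_conjIA, coe_conjGen, transv_conj_flank hib hia]

theorem conjIA_transv_commRight {a b i : Fin n} (hib : i ≠ b) (hia : i ≠ a)
    (u w : FreeGroup (Fin n)) :
    conjIA (transv a b) (commRight i u w) = commRight i (transv a b u) (transv a b w) := by
  ext1; simp [coe_conjIA, coe_commRight, transv_conj_flank hib hia, rcomm]

theorem conjIA_transv_conjGen_target (a b j : Fin n) :
    conjIA (transv a b) (conjGen b (FreeGroup.of j)) =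
      commRight b (FreeGroup.of a)⁻¹ (FreeGroup.of j)⁻¹ * conjGen b (FreeGroup.of j) := by
  ext1
  rw [coe_conjIA, coe_conjGen, transv_conj_flank_self]
  simp only [coe_commRight, coe_conjGen, Subgroup.coe_mul, flank_mul, rcomm]
  congr 1; group

theorem conjIA_transv_commRight_target (a b : Fin n) (u w : FreeGroup (Fin n)) :
    conjIA (transv a b) (commRight b u w) =
      conjGen b (FreeGroup.of a) * commRight b u w * (conjGen b (FreeGroup.of a))⁻¹ := by
  ext1
  rw [coe_conjIA, coe_commRight, transv_conj_flank_self]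
  simp only [coe_commRight, coe_conjGen, Subgroup.coe_mul, Subgroup.coe_inv, flank_mul, flank_inv,
    rcomm]
  congr 1; group

theorem conjIA_transv_conjGen_source {a b j : Fin n} (hab : a ≠ b) (hja : j ≠ a) (hjb : j ≠ b) :
    conjIA (transv a b) (conjGen a (FreeGroup.of j)) =
      commRight b (FreeGroup.of a)⁻¹ (FreeGroup.of j) * conjGen a (FreeGroup.of j) := by
  ext1
  rw [coe_conjIA, mul_inv_eq_iff_eq_mul]
  refine mulAut_ext_of fun k => ?_
  simp only [coe_commRight, coe_conjGen, Subgroup.coe_mul, MulAut.mul_apply]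
  by_cases hkb : k = b
  · subst hkb
    simp [flank_ne hab.symm, transv_self hab, flank_self, flank_ne hab, substHom_ne hab,
      substHom_ne hja, substHom_ne hjb, rcomm, flank_ne hjb, mul_assoc]
  · by_cases hka : k = a
    · subst hka
      simp [flank_self, transv_ne hab, flank_ne hab, substHom_ne hja, transv_ne hjb, flank_ne hjb]
    · simp [transv_ne hkb, flank_ne hkb, flank_ne hka]

theorem conjIA_transv_conjGen_source_target {a b : Fin n} (hab : a ≠ b) :
    conjIA (transv a b) (conjGen a (FreeGroup.of b)) =
      conjGen b (FreeGroup.of a) * conjGen a (FreeGroup.of b) := by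
  ext1
  rw [coe_conjIA, mul_inv_eq_iff_eq_mul]
  refine mulAut_ext_of fun k => ?_
  simp only [coe_conjGen, Subgroup.coe_mul, MulAut.mul_apply]
  by_cases hkb : k = b
  · subst hkb
    simp [flank_ne hab.symm, transv_self hab, flank_self, flank_ne hab, substHom_ne hab,
      substHom_ne hab.symm, mul_assoc]
  · by_cases hka : k = a
    · subst hka
      simp [flank_self, transv_ne hab, flank_ne hab, substHom_ne hab.symm, transv_self hab,
        substHom_ne hab, mul_assoc]
    · simp [transv_ne hkb, flank_ne hkb, flank_ne hka]

/-- Conjugating `x_a ↦ x_a [u, w]` by `x_b ↦ x_b x_a`, where `u` and `w` do not involve `x_b`. -/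
theorem conjIA_transv_commRight_source {a b : Fin n} (hab : a ≠ b) {u w : FreeGroup (Fin n)}
    (hu : substHom b 1 u = u) (hw : substHom b 1 w = w)
    (hu' : substHom a 1 u = u) (hw' : substHom a 1 w = w) :
    conjIA (transv a b) (commRight a u w) =
      conjGen b (FreeGroup.of a) * (commRight b u w)⁻¹ * (conjGen b (FreeGroup.of a))⁻¹ *
        commRight a u w := by
  have fix : ∀ p q v : FreeGroup (Fin n), substHom b 1 v = v → flank b p q v = v := by
    intro p q v hv; rw [← hv, flank_erase]
  have hr : substHom b 1 (rcomm u w) = rcomm u w := by simp [rcomm, hu, hw]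
  have hr' : substHom a 1 (rcomm u w) = rcomm u w := by simp [rcomm, hu', hw']
  have fixT : transv a b (rcomm u w) = rcomm u w := fix _ _ _ hr
  ext1
  rw [coe_conjIA, mul_inv_eq_iff_eq_mul]
  refine mulAut_ext_of fun k => ?_
  simp only [coe_conjGen, coe_commRight, Subgroup.coe_mul, Subgroup.coe_inv, flank_mul, flank_inv,
    MulAut.mul_apply]
  by_cases hkb : k = b
  · subst hkb
    simp [flank_ne hab.symm, transv_self hab, flank_self, flank_ne hab, substHom_ne hab, hr, hr',
      fix _ _ _ hr, mul_assoc]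
  · by_cases hka : k = a
    · subst hka
      simp [flank_self, transv_ne hab, flank_ne hab, hr', fixT, fix _ _ _ hr]
    · simp [transv_ne hkb, flank_ne hkb, flank_ne hka]

/-- Conjugating `x_a ↦ x_a [x_b, t]` by `x_b ↦ x_b x_a`, where `t` does not involve `x_a` and
`x_b`. The word `x_b x_a` is fixed by the result. -/
theorem conjIA_transv_commRight_source_target {a b : Fin n} (hab : a ≠ b) {t : FreeGroup (Fin n)}
    (hb : substHom b 1 t = t) (ha : substHom a 1 t = t) :
    conjIA (transv a b) (commRight a (FreeGroup.of b) t) =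
      conjGen a t * commLeft a (FreeGroup.of b) t * conjGen b t⁻¹ *
        commRight b t⁻¹ (FreeGroup.of a)⁻¹ := by
  have fix : ∀ p q, flank b p q t = t := by
    intro p q; rw [← hb, flank_erase]
  have fix' : ∀ p q, flank a p q t = t := by
    intro p q; rw [← ha, flank_erase]
  have fixT : transv a b t = t := fix _ _
  ext1
  rw [coe_conjIA, mul_inv_eq_iff_eq_mul]
  refine mulAut_ext_of fun k => ?_
  simp only [coe_conjGen, coe_commRight, coe_commLeft, Subgroup.coe_mul, flank_mul,
    MulAut.mul_apply]
  by_cases hkb : k = b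
  · subst hkb
    simp [flank_ne hab.symm, transv_self hab, flank_self, flank_ne hab, substHom_ne hab,
      substHom_ne hab.symm, ha, hb, fix, fix', rcomm, mul_assoc]
  · by_cases hka : k = a
    · subst hka
      simp [flank_self, transv_ne hab, transv_self hab, flank_ne hab,
        substHom_ne hab.symm, ha, fixT, rcomm, mul_assoc]
    · simp [transv_ne hkb, flank_ne hkb, flank_ne hka]

theorem hasLen_conjIA_transv_conjGen_of {a b : Fin n} (hab : a ≠ b) (i j : Fin n) :
    HasLen (letters n) 2 (conjIA (transv a b) (conjGen i (FreeGroup.of j))) := by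
  by_cases hib : i = b
  · subst hib
    rw [conjIA_transv_conjGen_target]
    exact (hasLen_commRight i a j false false).mul (hasLen_conjGen_of _ _)
  by_cases hia : i = a
  · subst hia
    by_cases hji : j = i
    · subst hji
      have : conjGen j (FreeGroup.of j) = 1 := by
        ext1
        refine mulAut_ext_of fun k => ?_
        by_cases hk : k = j
        · subst hk; simp [coe_conjGen, flank_self, substHom_self]
        · simp [coe_conjGen, flank_ne hk]
      rw [this, map_one]; exact .one _
    by_cases hjb : j = b
    · subst hjb
      rw [conjIA_transv_conjGen_source_target hab]
      exact (hasLen_conjGen_of _ _).mul (hasLen_conjGen_of _ _)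
    · rw [conjIA_transv_conjGen_source hab hji hjb]
      exact (hasLen_commRight b i j false true).mul (hasLen_conjGen_of _ _)
  · rw [conjIA_transv_conjGen hib hia]
    by_cases hjb : j = b
    · subst hjb
      rw [transv_self hab, map_mul]
      exact (hasLen_conjGen_of _ _).mul (hasLen_conjGen_of _ _)
    · rw [transv_ne hjb]
      exact (hasLen_conjGen_of _ _).mono (by norm_num)

theorem hasLen_conjIA_transv_conjGen {a b : Fin n} (hab : a ≠ b) (i j : Fin n) (c : Bool) :
    HasLen (letters n) 2 (conjIA (transv a b) (conjGen i (sgen j c))) := by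
  cases c
  · rw [sgen_false, map_inv, map_inv]
    exact (hasLen_conjIA_transv_conjGen_of hab i j).linv
  · exact hasLen_conjIA_transv_conjGen_of hab i j

theorem substHom_sgen_ne {i j : Fin n} (h : j ≠ i) (c : Bool) (w : FreeGroup (Fin n)) :
    substHom i w (sgen j c) = sgen j c := by
  cases c <;> simp [sgen_true, sgen_false, substHom_ne h]

theorem substHom_one_sgen_self (j : Fin n) (c : Bool) : substHom j 1 (sgen j c) = 1 := by
  cases c <;> simp [sgen_true, sgen_false, substHom_self]

theorem commRight_congr {i : Fin n} {u u' w w' : FreeGroup (Fin n)}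
    (hu : substHom i 1 u = substHom i 1 u') (hw : substHom i 1 w = substHom i 1 w') :
    commRight i u w = commRight i u' w' := by
  ext1
  refine mulAut_ext_of fun k => ?_
  by_cases hk : k = i
  · subst hk; simp [coe_commRight, flank_self, rcomm, hu, hw]
  · simp [coe_commRight, flank_ne hk]

theorem transv_sgen_eq {a b : Fin n} (hab : a ≠ b) (j : Fin n) (c : Bool) :
    ∃ p c₁ q c₂, transv a b (sgen j c) = sgen p c₁ ∨
      transv a b (sgen j c) = sgen p c₁ * sgen q c₂ := by
  by_cases hjb : j = b
  · subst hjb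
    cases c
    · exact ⟨a, false, j, false, Or.inr (by simp [sgen_false, transv_self hab])⟩
    · exact ⟨j, true, a, true, Or.inr (by simp [sgen_true, transv_self hab])⟩
  · refine ⟨j, c, j, c, Or.inl ?_⟩
    cases c <;> simp [sgen_true, sgen_false, transv_ne hjb]

theorem hasLen_commRight_mul_sgen (i p q k : Fin n) (b c d : Bool) :
    HasLen (letters n) 4 (commRight i (sgen p b * sgen q c) (sgen k d)) := by
  rw [commRight_mul_left]
  exact ((((hasLen_conjGen_sgen i q c).linv).mul (hasLen_commRight i p k b d)).mul
    (hasLen_conjGen_sgen i q c)).mul (hasLen_commRight i q k c d)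

theorem hasLen_conjIA_transv_commRight {a b : Fin n} (hab : a ≠ b) (i j k : Fin n) (c d : Bool) :
    HasLen (letters n) 10 (conjIA (transv a b) (commRight i (sgen j c) (sgen k d))) := by
  by_cases hib : i = b
  · subst hib
    rw [conjIA_transv_commRight_target]
    exact (((hasLen_conjGen_of _ _).mul (hasLen_commRight _ _ _ _ _)).mul
      (hasLen_conjGen_of _ _).linv).mono (by norm_num)
  by_cases hia : i = a
  · subst hia
    by_cases hji : j = i
    · subst hji
      have : commRight j (sgen j c) (sgen k d) = 1 := by
        rw [← commRight_one_left j (sgen k d)]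
        exact commRight_congr (by simp [substHom_one_sgen_self]) rfl
      rw [this, map_one]; exact .one _
    by_cases hki : k = i
    · subst hki
      have : commRight k (sgen j c) (sgen k d) = 1 := by
        rw [← commRight_one_right k (sgen j c)]
        exact commRight_congr rfl (by simp [substHom_one_sgen_self])
      rw [this, map_one]; exact .one _
    -- the case in which exactly one of the two letters is the one moved by the transvection
    have key : ∀ (l : Fin n) (e e' : Bool), l ≠ i → l ≠ b →
        HasLen (letters n) 8 (conjIA (transv i b) (commRight i (sgen b e) (sgen l e'))) := by
      intro l e e' hli hlb
      have pos : HasLen (letters n) 4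
          (conjIA (transv i b) (commRight i (FreeGroup.of b) (sgen l e'))) := by
        rw [conjIA_transv_commRight_source_target hab (substHom_sgen_ne hlb _ _)
          (substHom_sgen_ne hli _ _), sgen_inv]
        exact (((hasLen_conjGen_sgen _ _ _).mul (hasLen_commLeft i b l true e')).mul
          (hasLen_conjGen_sgen _ _ _)).mul (hasLen_commRight b l i (!e') false)
      cases e
      · rw [sgen_false, commRight_inv_left, map_mul, map_mul, map_inv, map_inv]
        exact ((hasLen_conjIA_transv_conjGen_of hab i b).mul pos.linv).mul
          (hasLen_conjIA_transv_conjGen_of hab i b).linv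
      · exact pos.mono (by norm_num)
    by_cases hjb : j = b
    · subst hjb
      by_cases hkj : k = j
      · subst hkj
        have : ∀ c d, commRight i (sgen k c) (sgen k d) = 1 := by
          intro c d
          ext1
          rw [coe_commRight]
          cases c <;> cases d <;> simp [rcomm, sgen_true, sgen_false, flank_one]
        rw [this, map_one]; exact .one _
      · exact (key k c d hki hkj).mono (by norm_num)
    · by_cases hkb : k = b
      · subst hkb
        rw [commRight_swap, map_inv]
        exact (key j d c hji hjb).linv.mono (by norm_num)
      · rw [conjIA_transv_commRight_source hab (substHom_sgen_ne hjb _ _)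
          (substHom_sgen_ne hkb _ _) (substHom_sgen_ne hji _ _) (substHom_sgen_ne hki _ _)]
        exact ((((hasLen_conjGen_of _ _).mul (hasLen_commRight _ _ _ _ _).linv).mul
          (hasLen_conjGen_of _ _).linv).mul (hasLen_commRight _ _ _ _ _)).mono (by norm_num)
  · rw [conjIA_transv_commRight hib hia]
    obtain ⟨p, c₁, q, c₂, h | h⟩ := transv_sgen_eq hab j c <;>
      obtain ⟨p', d₁, q', d₂, h' | h'⟩ := transv_sgen_eq hab k d <;> rw [h, h']
    · exact (hasLen_commRight _ _ _ _ _).mono (by norm_num)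
    · rw [commRight_swap]; exact (hasLen_commRight_mul_sgen _ _ _ _ _ _ _).linv.mono (by norm_num)
    · exact (hasLen_commRight_mul_sgen _ _ _ _ _ _ _).mono (by norm_num)
    · rw [commRight_mul_right]
      exact ((((hasLen_commRight_mul_sgen _ _ _ _ _ _ _).mul (hasLen_conjGen_sgen _ _ _).linv).mul
        (hasLen_commRight_mul_sgen _ _ _ _ _ _ _)).mul (hasLen_conjGen_sgen _ _ _))

theorem conjGen_rcomm (i : Fin n) (u w : FreeGroup (Fin n)) :
    conjGen i (rcomm u w) = (conjGen i u)⁻¹ * (conjGen i w)⁻¹ * conjGen i u * conjGen i w := by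
  simp [rcomm]

/-- Conjugation by a transvection lengthens an element of `IA_n` by a bounded factor. -/
theorem hasLen_conjIA_transv_of_mem {a b : Fin n} (hab : a ≠ b) {g : IA n} (hg : g ∈ letters n) :
    HasLen (letters n) 18 (conjIA (transv a b) g) := by
  rcases hg with ⟨i, j, c, rfl⟩ | ⟨i, j, c, k, d, rfl⟩ | ⟨i, j, c, k, d, rfl⟩
  · exact (hasLen_conjIA_transv_conjGen hab _ _ _).mono (by norm_num)
  · exact (hasLen_conjIA_transv_commRight hab _ _ _ _ _).mono (by norm_num)
  · rw [commLeft_eq, map_mul, map_inv, conjGen_rcomm, map_mul, map_mul, map_mul, map_inv, map_inv]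
    exact (hasLen_conjIA_transv_commRight hab _ _ _ _ _).mul
      ((((hasLen_conjIA_transv_conjGen hab _ _ _).linv.mul
        (hasLen_conjIA_transv_conjGen hab _ _ _).linv).mul
        (hasLen_conjIA_transv_conjGen hab _ _ _)).mul
        (hasLen_conjIA_transv_conjGen hab _ _ _)).linv

theorem HasLen.conjIA_transv {a b : Fin n} (hab : a ≠ b) {l : ℕ} {g : IA n}
    (hg : HasLen (letters n) l g) : HasLen (letters n) (18 * l) (conjIA (transv a b) g) :=
  hg.map (S' := letters n) (_root_.conjIA (transv a b)).toMonoidHom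
    fun _ hx => hasLen_conjIA_transv_of_mem hab hx

/-- The inversion `x_a ↦ x_a⁻¹`. -/
def inversion (a : Fin n) : MulAut (FreeGroup (Fin n)) :=
  signedPerm 1 fun i => decide (i ≠ a)

theorem inversion_self (a : Fin n) : inversion a (FreeGroup.of a) = (FreeGroup.of a)⁻¹ := by
  simp [inversion, signedPerm_of, sgen_false]

theorem inversion_ne {a k : Fin n} (h : k ≠ a) :
    inversion a (FreeGroup.of k) = FreeGroup.of k := by
  simp [inversion, signedPerm_of, sgen_true, h]

theorem inversion_inv (a : Fin n) : (inversion a)⁻¹ = inversion a := by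
  rw [inv_eq_iff_mul_eq_one]
  refine mulAut_ext_of fun k => ?_
  by_cases hk : k = a
  · subst hk; simp [inversion_self]
  · simp [inversion_ne hk]

theorem transv_inv_eq {a b : Fin n} (hab : a ≠ b) :
    (transv a b)⁻¹ = inversion a * transv a b * inversion a := by
  refine mulAut_ext_of fun k => ?_
  by_cases hka : k = a
  · subst hka
    simp [transv_inv_ne hab, inversion_self, transv_ne hab]
  by_cases hk : k = b
  · subst hk
    simp [transv_inv_self hab, inversion_ne hab.symm, transv_self hab, inversion_self]
  · simp [transv_inv_ne hk, inversion_ne hka, transv_ne hk]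

theorem HasLen.conjIA_inversion (a : Fin n) {l : ℕ} {g : IA n}
    (hg : HasLen (letters n) l g) : HasLen (letters n) l (conjIA (inversion a) g) :=
  hg.conjIA_signedPerm _ _

theorem HasLen.conjIA_transv_inv {a b : Fin n} (hab : a ≠ b) {l : ℕ} {g : IA n}
    (hg : HasLen (letters n) l g) :
    HasLen (letters n) (18 * l) (_root_.conjIA (transv a b)⁻¹ g) := by
  rw [transv_inv_eq hab, conjIA_mul, conjIA_mul]
  exact ((hg.conjIA_inversion a).conjIA_transv hab).conjIA_inversion a

end Transvections

/-! ### Common prefixes of words -/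

section CommonPrefix

variable {β : Type*} [DecidableEq β]

/-- The length of the longest common prefix of two lists. -/
def commonPrefixLen : List β → List β → ℕ
  | a :: l, b :: m => if a = b then commonPrefixLen l m + 1 else 0
  | _, _ => 0

theorem le_commonPrefixLen_iff (k : ℕ) (l m : List β) :
    k ≤ commonPrefixLen l m ↔ k ≤ l.length ∧ k ≤ m.length ∧ l.take k = m.take k := by
  induction l generalizing k m with
  | nil => simp +contextual [commonPrefixLen]
  | cons a l ih =>
    cases m with
    | nil => simp +contextual [commonPrefixLen]
    | cons b m =>
      cases k with
      | zero => simp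
      | succ k =>
        by_cases hab : a = b
        · simp [commonPrefixLen, hab, ih]
        · simp [commonPrefixLen, hab]

theorem commonPrefixLen_comm (l m : List β) : commonPrefixLen l m = commonPrefixLen m l := by
  refine eq_of_forall_le_iff fun k => ?_
  rw [le_commonPrefixLen_iff, le_commonPrefixLen_iff]
  exact ⟨fun h => ⟨h.2.1, h.1, h.2.2.symm⟩, fun h => ⟨h.2.1, h.1, h.2.2.symm⟩⟩

/-- Longest common prefixes are ultrametric. -/
theorem commonPrefixLen_eq_of_lt {l m r : List β}
    (h : commonPrefixLen l m < commonPrefixLen m r) :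
    commonPrefixLen l r = commonPrefixLen l m := by
  refine eq_of_forall_le_iff fun k => ?_
  have h3 := (le_commonPrefixLen_iff _ m r).1 (Nat.succ_le_of_lt h)
  have take_eq : ∀ k, k ≤ commonPrefixLen l m + 1 → m.take k = r.take k := by
    intro k hk
    have := congrArg (List.take k) h3.2.2
    simpa [List.take_take, Nat.min_eq_left hk] using this
  constructor
  · intro hk
    by_contra hlt
    push Not at hlt
    have h1 := (le_commonPrefixLen_iff (commonPrefixLen l m + 1) l r).1 (by omega)
    have := (le_commonPrefixLen_iff (commonPrefixLen l m + 1) l m).2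
      ⟨h1.1, h3.1, by rw [h1.2.2, take_eq _ le_rfl]⟩
    omega
  · intro hk
    have h1 := (le_commonPrefixLen_iff k l m).1 hk
    exact (le_commonPrefixLen_iff _ _ _).2 ⟨h1.1, by omega, by
      rw [h1.2.2, take_eq _ (by omega)]⟩

theorem exists_append_commonPrefix (l m : List β) :
    ∃ p u v, l = p ++ u ∧ m = p ++ v ∧ p.length = commonPrefixLen l m ∧
      ∀ x ∈ u.head?, ∀ y ∈ v.head?, x ≠ y := by
  induction l generalizing m with
  | nil => exact ⟨[], [], m, by simp [commonPrefixLen]⟩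
  | cons a l ih =>
    cases m with
    | nil => exact ⟨[], a :: l, [], by simp [commonPrefixLen]⟩
    | cons b m =>
      by_cases hab : a = b
      · obtain ⟨p, u, v, h1, h2, h3, h4⟩ := ih m
        exact ⟨a :: p, u, v, by simp [h1], by simp [h2, hab],
          by simp [commonPrefixLen, hab, h3], h4⟩
      · exact ⟨[], a :: l, b :: m, by simp [commonPrefixLen, hab]⟩

end CommonPrefix

/-! ### Cancellation in free groups -/

section Cancellation

variable {α : Type*} [DecidableEq α]

open FreeGroup hiding map_one map_mul map_inv

/-- In `x⁻¹ * y` exactly the common prefix of `x` and `y` cancels. -/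
theorem norm_inv_mul_add (x y : FreeGroup α) :
    (x⁻¹ * y).norm + 2 * commonPrefixLen x.toWord y.toWord = x.norm + y.norm := by
  obtain ⟨p, u, v, hu, hv, hp, hne⟩ := exists_append_commonPrefix x.toWord y.toWord
  have hxr : IsReduced x.toWord := isReduced_toWord
  have hyr : IsReduced y.toWord := isReduced_toWord
  rw [hu] at hxr
  rw [hv] at hyr
  have hur : IsReduced u := (List.isChain_append.1 hxr).2.1
  have hvr : IsReduced v := (List.isChain_append.1 hyr).2.1
  have hred : IsReduced (invRev u ++ v) := by
    refine List.isChain_append.2 ⟨?_, hvr, ?_⟩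
    · have := hur.reduce_eq
      have h2 : reduce (invRev u) = invRev u := by rw [reduce_invRev, this]
      exact IsReduced.of_reduce_eq h2
    · intro a ha b hb
      cases u with
      | nil => simp [invRev] at ha
      | cons c u =>
        simp [invRev] at ha
        have := hne c (by simp) b hb
        subst ha
        rintro (h1 : c.1 = b.1)
        change (!c.2) = b.2
        by_contra h2
        apply this
        ext
        · exact h1
        · cases h3 : c.2 <;> cases h4 : b.2 <;> simp_all
  have hx : x = mk p * mk u := by rw [mul_mk, ← hu, mk_toWord]
  have hy : y = mk p * mk v := by rw [mul_mk, ← hv, mk_toWord]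
  have hxy : x⁻¹ * y = mk (invRev u ++ v) := by
    rw [hx, hy, mul_inv_rev, mul_assoc, inv_mul_cancel_left, inv_mk, mul_mk]
  have e1 : x.norm = p.length + u.length := by rw [FreeGroup.norm, hu, List.length_append]
  have e2 : y.norm = p.length + v.length := by rw [FreeGroup.norm, hv, List.length_append]
  rw [hxy, FreeGroup.norm, toWord_mk, hred.reduce_eq, e1, e2, ← hp]
  simp
  omega

/-- The number of letters of `y` that cancel in the product `x * y`. -/
def cancelLen (x y : FreeGroup α) : ℕ := commonPrefixLen (x⁻¹).toWord y.toWord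

theorem norm_mul_add (x y : FreeGroup α) :
    (x * y).norm + 2 * cancelLen x y = x.norm + y.norm := by
  have := norm_inv_mul_add x⁻¹ y
  rwa [inv_inv, norm_inv_eq] at this

/-- Less than half of a nontrivial `x` cancels in `x * x`: otherwise the middle letter of the
reduced word of `x` would be its own inverse, or the two middle letters would be inverse to each
other. -/
theorem cancelLen_self_lt {x : FreeGroup α} (hx : x ≠ 1) : 2 * cancelLen x x < x.norm := by
  by_contra hcon
  push Not at hcon
  set w := x.toWord with hw
  have hlen : x.norm = w.length := rfl
  have hpos : 0 < w.length := by
    rw [List.length_pos_iff, hw, Ne, toWord_eq_nil_iff]; exact hx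
  obtain ⟨L, hL⟩ : ∃ L, L = w.length := ⟨_, rfl⟩
  have h1 := (le_commonPrefixLen_iff ((L + 1) / 2) (x⁻¹).toWord w).1 (by
    change _ ≤ cancelLen x x; omega)
  have h2 : ∀ m (hm : m < (L + 1) / 2) (h3 : L - 1 - m < w.length) (h4 : m < w.length),
      ((w[L - 1 - m]).1, !(w[L - 1 - m]).2) = w[m] := by
    intro m hm h3 h4
    have h5 := h1.2.2
    have h6 : ((x⁻¹).toWord.take ((L + 1) / 2))[m]? = (w.take ((L + 1) / 2))[m]? := by rw [h5]
    rw [toWord_inv, List.getElem?_take_of_lt hm, List.getElem?_take_of_lt hm] at h6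
    simp only [invRev] at h6
    rw [List.getElem?_eq_getElem (by simpa [← hw] using h4), List.getElem?_eq_getElem h4] at h6
    simpa [List.getElem_reverse, ← hw, ← hL] using h6
  rcases Nat.even_or_odd L with ⟨k, hk⟩ | ⟨k, hk⟩
  · have := h2 (k - 1) (by omega) (by omega) (by omega)
    have hr : IsReduced w := isReduced_toWord
    have h8 := List.isChain_iff_getElem.1 hr (k - 1) (by omega)
    have h9 : L - 1 - (k - 1) = k - 1 + 1 := by omega
    simp only [h9] at this
    have h10 : (w[k - 1 + 1]'(by omega)).1 = (w[k-1]'(by omega)).1 := by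
      have h12 := congrArg Prod.fst this
      simpa using h12
    have h11 := congrArg Prod.snd this
    have := h8 h10.symm
    rw [this] at h11
    simp at h11
  · have := h2 k (by omega) (by omega) (by omega)
    have h9 : L - 1 - k = k := by omega
    simp only [h9] at this
    have := congrArg Prod.snd this
    simp at this

/-- If, in a family of elements closed under inversion, less than one half of an element cancels on
either side in products (and the two cancelling parts do not exhaust it), then products of elements
of the family along reduced words are at least as long as the words. -/
theorem length_le_norm_of_nielsenReduced (φ : FreeGroup α →* FreeGroup α)
    (h0 : ∀ t : α × Bool, φ (mk [t]) ≠ 1)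
    (h1 : ∀ s t : α × Bool, (s.1 = t.1 → s.2 = t.2) →
      2 * cancelLen (φ (mk [s])) (φ (mk [t])) ≤ (φ (mk [t])).norm)
    (h2 : ∀ s t r : α × Bool, (s.1 = t.1 → s.2 = t.2) → (t.1 = r.1 → t.2 = r.2) →
      cancelLen (φ (mk [s])) (φ (mk [t])) + cancelLen (φ (mk [t])) (φ (mk [r])) <
        (φ (mk [t])).norm)
    (t : α × Bool) (l : List (α × Bool)) (hl : IsReduced (t :: l)) :
    ∀ s : α × Bool, (s.1 = t.1 → s.2 = t.2) →
      cancelLen (φ (mk [s])) (φ (mk (t :: l))) = cancelLen (φ (mk [s])) (φ (mk [t])) ∧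
      (t :: l).length + cancelLen (φ (mk [s])) (φ (mk [t])) ≤ (φ (mk (t :: l))).norm := by
  induction l generalizing t with
  | nil =>
    intro s hs
    refine ⟨rfl, ?_⟩
    have := h1 s t hs
    have hpos : (φ (mk [t])).norm ≠ 0 := fun h => h0 t (norm_eq_zero.1 h)
    simp only [List.length_singleton]
    omega
  | cons r l ih =>
    intro s hs
    rw [isReduced_cons_cons] at hl
    obtain ⟨ih1, ih2⟩ := ih r hl.2 t hl.1
    have hQ : φ (mk (t :: r :: l)) = φ (mk [t]) * φ (mk (r :: l)) := by
      rw [← map_mul, mul_mk]; rfl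
    have e1 := norm_mul_add (φ (mk [t])) (φ (mk (r :: l)))
    have e2 := norm_inv_mul_add (φ (mk [t])) (φ (mk [t]) * φ (mk (r :: l)))
    rw [inv_mul_cancel_left] at e2
    -- The parts of the middle factor that cancel on the left and on the right do not exhaust it, so
    -- that cancellation does not pass through it.
    have hN2 := h2 s t r hs hl.1
    rw [ih1] at e1
    rw [hQ]
    have hlt : cancelLen (φ (mk [s])) (φ (mk [t])) <
        commonPrefixLen (φ (mk [t])).toWord (φ (mk [t]) * φ (mk (r :: l))).toWord := by
      omega
    refine ⟨commonPrefixLen_eq_of_lt hlt, ?_⟩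
    simp only [List.length_cons] at ih2 ⊢
    omega

end Cancellation

/-! ### Nielsen's generators of `Aut(F_n)` -/

section Nielsen

open FreeGroup hiding map_one map_mul map_inv

variable {n : ℕ}

/-- A word read as the digits of a number; comparing the values of words of equal length amounts
to comparing them lexicographically. -/
def wordValue (l : List (Fin n × Bool)) : ℕ :=
  l.foldl (fun acc a => acc * (2 * n) + (2 * a.1 + if a.2 then 1 else 0)) 0

theorem foldl_wordValue (l : List (Fin n × Bool)) (c : ℕ) :
    l.foldl (fun acc a => acc * (2 * n) + (2 * a.1 + if a.2 then 1 else 0)) c =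
      c * (2 * n) ^ l.length + wordValue l := by
  induction l generalizing c with
  | nil => simp [wordValue]
  | cons a l ih =>
    rw [wordValue, List.foldl_cons, List.foldl_cons, ih, ih]
    simp only [List.length_cons, pow_succ]
    ring

theorem wordValue_append (l m : List (Fin n × Bool)) :
    wordValue (l ++ m) = wordValue l * (2 * n) ^ m.length + wordValue m := by
  rw [wordValue, List.foldl_append, foldl_wordValue]; rfl

theorem wordValue_lt (l : List (Fin n × Bool)) : wordValue l < (2 * n) ^ l.length := by
  induction l with
  | nil => simp [wordValue]
  | cons a l ih =>
    have h := wordValue_append [a] l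
    rw [List.singleton_append] at h
    have ha : wordValue [a] + 1 ≤ 2 * n := by
      have := a.1.2
      simp only [wordValue, List.foldl_cons, List.foldl_nil]
      split_ifs <;> omega
    rw [h, List.length_cons, pow_succ]
    calc _ < wordValue [a] * (2 * n) ^ l.length + (2 * n) ^ l.length := by omega
      _ = (wordValue [a] + 1) * (2 * n) ^ l.length := by ring
      _ ≤ (2 * n) * (2 * n) ^ l.length := Nat.mul_le_mul_right _ ha
      _ = _ := by ring

theorem wordValue_injective {l m : List (Fin n × Bool)} (hlen : l.length = m.length)
    (h : wordValue l = wordValue m) : l = m := by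
  induction l generalizing m with
  | nil => exact (List.length_eq_zero_iff.1 hlen.symm).symm
  | cons a l ih =>
    cases m with
    | nil => simp at hlen
    | cons b m =>
      have hlen' : l.length = m.length := by simpa using hlen
      have h1 := wordValue_append [a] l
      have h2 := wordValue_append [b] m
      rw [List.singleton_append] at h1 h2
      rw [h1, h2, hlen'] at h
      have l1 := wordValue_lt l
      have l2 := wordValue_lt m
      rw [hlen'] at l1
      have hpos : 0 < (2 * n) ^ m.length := by omega
      have q1 : wordValue [a] = wordValue [b] := by
        have := congrArg (· / (2 * n) ^ m.length) h
        simpa [Nat.mul_comm _ ((2 * n) ^ m.length), Nat.mul_add_div hpos,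
          Nat.div_eq_of_lt l1, Nat.div_eq_of_lt l2] using this
      have q2 : wordValue l = wordValue m := by rw [q1] at h; omega
      rw [ih hlen' q2]
      congr 1
      have := a.1.2
      have := b.1.2
      simp only [wordValue, List.foldl_cons, List.foldl_nil] at q1
      ext
      · split_ifs at q1 <;> omega
      · cases h3 : a.2 <;> cases h4 : b.2 <;> simp [h3, h4] at q1 ⊢ <;> omega

/-- The secondary complexity in Nielsen's reduction: the values of the initial halves of a reduced
word and of its inverse. -/
def halvesValue (x : FreeGroup (Fin n)) : ℕ :=
  wordValue (x.toWord.take (x.norm / 2)) + wordValue ((x⁻¹).toWord.take (x.norm / 2))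

theorem halvesValue_inv (x : FreeGroup (Fin n)) : halvesValue x⁻¹ = halvesValue x := by
  simp only [halvesValue, norm_inv_eq, inv_inv]
  omega

/-- If the right half of `x`, and no more, cancels in `x * y`, then the product arises from `y` by
putting the left half of `x` in place of the inverse of the right half. This lowers the secondary
complexity if the former has the smaller value. -/
theorem halvesValue_mul_lt {x y : FreeGroup (Fin n)} {h : ℕ} (hx : x.norm = 2 * h)
    (hxy : cancelLen x y = h) (hy : 2 * h ≤ y.norm)
    (hlt : wordValue (x.toWord.take h) < wordValue ((x⁻¹).toWord.take h)) :
    (x * y).norm = y.norm ∧ halvesValue (x * y) < halvesValue y := by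
  have hnorm : (x * y).norm = y.norm := by have := norm_mul_add x y; omega
  refine ⟨hnorm, ?_⟩
  have hc := (le_commonPrefixLen_iff h (x⁻¹).toWord y.toWord).1 hxy.ge
  set p := x.toWord.take h with hp
  set q := y.toWord.take h with hq
  set r := y.toWord.drop h with hr
  have hyw : y.toWord = q ++ r := (List.take_append_drop h _).symm
  have hylen : y.norm = y.toWord.length := rfl
  have hplen : p.length = h := by
    rw [hp, List.length_take]; change min h x.norm = h; omega
  have hqlen : q.length = h := by rw [hq, List.length_take]; omega
  have hrlen : r.length = y.norm - h := by rw [hr, List.length_drop]; omega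
  have hxq : x.toWord = p ++ invRev q := by
    have e1 : x.toWord = invRev (x⁻¹).toWord := by rw [toWord_inv, invRev_invRev]
    have e2 : (x⁻¹).toWord = q ++ (x⁻¹).toWord.drop h := by
      rw [← hc.2.2, List.take_append_drop]
    have e3 : x.toWord = invRev ((x⁻¹).toWord.drop h) ++ invRev q := by
      conv_lhs => rw [e1, e2, invRev_append]
    have e4 : (invRev ((x⁻¹).toWord.drop h)).length = h := by
      rw [invRev_length, List.length_drop]
      change (x⁻¹).norm - h = h
      rw [norm_inv_eq]; omega
    have e5 : p = invRev ((x⁻¹).toWord.drop h) := by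
      rw [hp, e3, List.take_append_of_le_length (by omega), List.take_of_length_le (by omega)]
    rw [e5]; exact e3
  have hxyw : x * y = mk (p ++ r) := by
    have e1 : x = mk p * (mk q)⁻¹ := by rw [inv_mk, mul_mk, ← hxq, mk_toWord]
    have e2 : y = mk q * mk r := by rw [mul_mk, ← hyw, mk_toWord]
    rw [← mul_mk]
    conv_lhs => rw [e1, e2]
    group
  have hword : (x * y).toWord = p ++ r := by
    have e : (x * y).toWord = reduce (p ++ r) := by rw [hxyw, toWord_mk]
    have hsub : List.Sublist (reduce (p ++ r)) (p ++ r) := reduce.red.sublist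
    have hlen' : (reduce (p ++ r)).length = y.norm := by rw [← e]; exact hnorm
    rw [e]
    exact hsub.eq_of_length (by rw [hlen', List.length_append]; omega)
  have t1 : (p ++ r).take (y.norm / 2) = p ++ r.take (y.norm / 2 - h) := by
    rw [List.take_append, hplen, List.take_of_length_le (by omega)]
  have t2 : (q ++ r).take (y.norm / 2) = q ++ r.take (y.norm / 2 - h) := by
    rw [List.take_append, hqlen, List.take_of_length_le (by omega)]
  have t3 : ∀ m : List (Fin n × Bool),
      (invRev (m ++ r)).take (y.norm / 2) = (invRev r).take (y.norm / 2) := by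
    intro m
    rw [invRev_append, List.take_append_of_le_length (by rw [invRev_length]; omega)]
  have hr0 : 0 < (2 * n) ^ (r.take (y.norm / 2 - h)).length := by
    rcases Nat.eq_zero_or_pos n with h0 | h0
    · subst h0
      have : p = [] := by
        rcases p with _ | ⟨a, _⟩
        · rfl
        · exact a.1.elim0
      rw [this] at hlt
      have : (x⁻¹).toWord.take h = [] := by
        rcases (x⁻¹).toWord.take h with _ | ⟨a, _⟩
        · rfl
        · exact a.1.elim0
      rw [this] at hlt
      exact absurd hlt (lt_irrefl _)
    · positivity
  rw [halvesValue, halvesValue, hnorm, toWord_inv, toWord_inv, hword, hyw, t1, t2, t3, t3,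
    wordValue_append, wordValue_append]
  rw [hc.2.2] at hlt
  have := Nat.mul_lt_mul_of_pos_right hlt hr0
  omega

/-- The subgroup of `Aut(F_n)` generated by transvections and signed permutations. -/
def nielsenSubgroup (n : ℕ) : Subgroup (MulAut (FreeGroup (Fin n))) :=
  Subgroup.closure ({g | ∃ a b, a ≠ b ∧ g = transv a b} ∪ {g | ∃ σ ε, g = signedPerm σ ε})

theorem transv_mem_nielsenSubgroup {a b : Fin n} (h : a ≠ b) : transv a b ∈ nielsenSubgroup n :=
  Subgroup.subset_closure (Or.inl ⟨a, b, h, rfl⟩)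

theorem signedPerm_mem_nielsenSubgroup (σ : Equiv.Perm (Fin n)) (ε : Fin n → Bool) :
    signedPerm σ ε ∈ nielsenSubgroup n :=
  Subgroup.subset_closure (Or.inr ⟨σ, ε, rfl⟩)

/-- For letters `s`, `r` belonging to different basis elements, the substitution `r ↦ s r` is a
product of the generators of `nielsenSubgroup`. -/
theorem exists_nielsen_mul (s r : Fin n × Bool) (h : s.1 ≠ r.1) :
    ∃ θ ∈ nielsenSubgroup n, θ (mk [r]) = mk [s] * mk [r] ∧
      ∀ k, k ≠ r.1 → θ (of k) = of k := by
  obtain ⟨a, e⟩ := s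
  obtain ⟨b, c⟩ := r
  have hab : a ≠ b := h
  have hT := transv_mem_nielsenSubgroup hab
  have hD : inversion b ∈ nielsenSubgroup n := signedPerm_mem_nielsenSubgroup _ _
  have e1 : ∀ j, (mk [(j, true)] : FreeGroup (Fin n)) = of j := fun _ => rfl
  have e2 : ∀ j, (mk [(j, false)] : FreeGroup (Fin n)) = (of j)⁻¹ := fun _ => rfl
  cases c <;> cases e
  · exact ⟨transv a b, hT, by simp [e2, transv_self hab], fun k hk => transv_ne hk _⟩
  · exact ⟨(transv a b)⁻¹, inv_mem hT, by rw [e1, e2, map_inv, transv_inv_self hab]; simp,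
      fun k hk => transv_inv_ne hk _⟩
  · exact ⟨inversion b * transv a b * inversion b, mul_mem (mul_mem hD hT) hD,
      by simp [e1, e2, transv_self hab, inversion_self, inversion_ne hab],
      fun k hk => by
        change k ≠ b at hk
        simp [transv_ne hk, inversion_ne hk]⟩
  · exact ⟨inversion b * (transv a b)⁻¹ * inversion b, mul_mem (mul_mem hD (inv_mem hT)) hD,
      by
        rw [e1, e1, MulAut.mul_apply, MulAut.mul_apply, inversion_self, map_inv,
          transv_inv_self hab]
        simp [inversion_self, inversion_ne hab],
      fun k hk => by
        change k ≠ b at hk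
        simp [transv_inv_ne hk, inversion_ne hk]⟩

/-- The complexity minimised in Nielsen's reduction: total length of the images of the basis, then
the values of their halves. -/
def nielsenComplexity (φ : MulAut (FreeGroup (Fin n))) : ℕ ×ₗ ℕ :=
  toLex (∑ i, (φ (of i)).norm, ∑ i, halvesValue (φ (of i)))

theorem sum_lt_sum_of_single {f g : Fin n → ℕ} (b : Fin n) (h : ∀ k, k ≠ b → f k = g k)
    (hb : f b < g b) : ∑ i, f i < ∑ i, g i :=
  Finset.sum_lt_sum (fun i _ => by
    by_cases hi : i = b
    · subst hi; exact hb.le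
    · exact (h i hi).le) ⟨b, Finset.mem_univ _, hb⟩

theorem sum_eq_sum_of_single {f g : Fin n → ℕ} (b : Fin n) (h : ∀ k, k ≠ b → f k = g k)
    (hb : f b = g b) : ∑ i, f i = ∑ i, g i :=
  Finset.sum_congr rfl fun i _ => by
    by_cases hi : i = b
    · subst hi; exact hb
    · exact h i hi

theorem norm_apply_mk (φ : MulAut (FreeGroup (Fin n))) (r : Fin n × Bool) :
    (φ (mk [r])).norm = (φ (of r.1)).norm := by
  obtain ⟨b, c⟩ := r
  cases c
  · have : (mk [(b, false)] : FreeGroup (Fin n)) = (of b)⁻¹ := rfl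
    rw [this, map_inv, norm_inv_eq]
  · rfl

theorem halvesValue_apply_mk (φ : MulAut (FreeGroup (Fin n))) (r : Fin n × Bool) :
    halvesValue (φ (mk [r])) = halvesValue (φ (of r.1)) := by
  obtain ⟨b, c⟩ := r
  cases c
  · have : (mk [(b, false)] : FreeGroup (Fin n)) = (of b)⁻¹ := rfl
    rw [this, map_inv, halvesValue_inv]
  · rfl

theorem eq_signedPerm_of_letters {ψ : MulAut (FreeGroup (Fin n))}
    (h : ∀ j, ∃ a b, ψ (of j) = sgen a b) : ∃ σ ε, ψ = signedPerm σ ε := by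
  choose f e hf using h
  have hinj : Function.Injective f := by
    intro j k hjk
    have : ψ (of j) = ψ (of k) ∨ ψ (of j) = ψ (of k)⁻¹ := by
      rw [map_inv, hf, hf, hjk]
      cases e j <;> cases e k <;> simp [sgen_true, sgen_false]
    rcases this with h | h
    · exact of_injective (ψ.injective h)
    · have := congrArg toWord (ψ.injective h)
      simp [toWord_inv, invRev] at this
  refine ⟨Equiv.ofBijective f (Finite.injective_iff_bijective.1 hinj), e, ?_⟩
  refine mulAut_ext_of fun k => ?_
  rw [signedPerm_of, hf]; rfl

/-- **Nielsen's theorem**: transvections and signed permutations generate `Aut(F_n)`. -/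
theorem nielsenSubgroup_eq_top (n : ℕ) : nielsenSubgroup n = ⊤ := by
  rw [eq_top_iff]
  intro φ₀ _
  obtain ⟨φ, ⟨θ₀, hθ₀, hφ⟩, hmin⟩ := WellFounded.has_min
    (InvImage.wf (nielsenComplexity (n := n)) (wellFounded_lt (α := ℕ ×ₗ ℕ)))
    {φ | ∃ θ ∈ nielsenSubgroup n, φ = φ₀ * θ} ⟨φ₀, 1, one_mem _, by simp⟩
  -- no transvection lowers the complexity of the minimal representative
  have hmove : ∀ s r : Fin n × Bool, s.1 ≠ r.1 →
      (φ (mk [r])).norm ≤ (φ (mk [s]) * φ (mk [r])).norm ∧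
      ((φ (mk [s]) * φ (mk [r])).norm = (φ (mk [r])).norm →
        halvesValue (φ (mk [r])) ≤ halvesValue (φ (mk [s]) * φ (mk [r]))) := by
    intro s r hsr
    obtain ⟨θ, hθ, h1, h2⟩ := exists_nielsen_mul s r hsr
    have hm : ¬ nielsenComplexity (φ * θ) < nielsenComplexity φ :=
      hmin (φ * θ) ⟨θ₀ * θ, mul_mem hθ₀ hθ, by rw [hφ, mul_assoc]⟩
    have e1 : φ (mk [s]) * φ (mk [r]) = (φ * θ) (mk [r]) := by
      rw [MulAut.mul_apply, h1, map_mul]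
    have e2 : ∀ k, k ≠ r.1 → (φ * θ) (of k) = φ (of k) := fun k hk => by
      rw [MulAut.mul_apply, h2 k hk]
    rw [e1, norm_apply_mk, norm_apply_mk, halvesValue_apply_mk, halvesValue_apply_mk]
    constructor
    · by_contra hlt
      push Not at hlt
      refine hm (Prod.Lex.toLex_lt_toLex.2 (Or.inl ?_))
      exact sum_lt_sum_of_single r.1 (fun k hk => by rw [e2 k hk]) hlt
    · intro heq
      by_contra hlt
      push Not at hlt
      refine hm (Prod.Lex.toLex_lt_toLex.2 (Or.inr ⟨?_, ?_⟩))
      · exact sum_eq_sum_of_single r.1 (fun k hk => by rw [e2 k hk]) heq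
      · exact sum_lt_sum_of_single r.1 (fun k hk => by rw [e2 k hk]) hlt
  have hbar : ∀ s : Fin n × Bool, (φ (mk [s]))⁻¹ = φ (mk [(s.1, !s.2)]) := by
    intro s; rw [← map_inv]; rfl
  have hne : ∀ t : Fin n × Bool, φ (mk [t]) ≠ 1 := by
    intro t ht
    have h1 : (mk [t] : FreeGroup (Fin n)) = 1 := φ.injective (by rw [ht, map_one])
    have := congrArg FreeGroup.norm h1
    have h2 := norm_apply_mk (1 : MulAut (FreeGroup (Fin n))) t
    simp only [MulAut.one_apply, norm_of] at h2
    rw [h2] at this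
    simp at this
  -- at most one half of either factor cancels: the product is not shorter than either
  have hN1 : ∀ s t : Fin n × Bool, (s.1 = t.1 → s.2 = t.2) →
      2 * cancelLen (φ (mk [s])) (φ (mk [t])) ≤ (φ (mk [t])).norm ∧
      2 * cancelLen (φ (mk [s])) (φ (mk [t])) ≤ (φ (mk [s])).norm := by
    intro s t hst
    by_cases h : s.1 = t.1
    · have : s = t := Prod.ext h (hst h)
      subst this
      have := cancelLen_self_lt (hne s)
      omega
    · have h1 := (hmove s t h).1
      have h2 := (hmove (t.1, !t.2) (s.1, !s.2) (Ne.symm h)).1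
      rw [← hbar, ← hbar, ← mul_inv_rev, norm_inv_eq, norm_inv_eq] at h2
      have := norm_mul_add (φ (mk [s])) (φ (mk [t]))
      omega
  -- If both halves of `φ t` cancel, comparing the values of the initial halves of `φ t` and its
  -- inverse gives a transvection that lowers the secondary complexity of a neighbour. Equality of
  -- the values would make `φ t` cancel against itself.
  have hN2 : ∀ s t r : Fin n × Bool, (s.1 = t.1 → s.2 = t.2) → (t.1 = r.1 → t.2 = r.2) →
      cancelLen (φ (mk [s])) (φ (mk [t])) + cancelLen (φ (mk [t])) (φ (mk [r])) <
        (φ (mk [t])).norm := by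
    intro s t r hst htr
    by_contra hcon
    push Not at hcon
    have h1 := hN1 s t hst
    have h2 := hN1 t r htr
    have hst' : s.1 ≠ t.1 := by
      intro h
      have : s = t := Prod.ext h (hst h)
      subst this
      have := cancelLen_self_lt (hne s)
      omega
    have htr' : t.1 ≠ r.1 := by
      intro h
      have : t = r := Prod.ext h (htr h)
      subst this
      have := cancelLen_self_lt (hne t)
      omega
    set h := cancelLen (φ (mk [t])) (φ (mk [r])) with hh
    have hn : (φ (mk [t])).norm = 2 * h := by omega
    have hs : cancelLen (φ (mk [t]))⁻¹ (φ (mk [s]))⁻¹ = h := by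
      have : cancelLen (φ (mk [t]))⁻¹ (φ (mk [s]))⁻¹ = cancelLen (φ (mk [s])) (φ (mk [t])) := by
        rw [cancelLen, inv_inv, commonPrefixLen_comm, cancelLen]
      omega
    rcases lt_trichotomy (wordValue ((φ (mk [t])).toWord.take h))
      (wordValue ((φ (mk [t]))⁻¹.toWord.take h)) with hlt | heq | hgt
    · have h3 := halvesValue_mul_lt hn hh.symm (by omega) hlt
      have h4 := (hmove t r htr').2 h3.1
      omega
    · have hl1 : (φ (mk [t])).toWord.length = 2 * h := hn
      have hl2 : ((φ (mk [t]))⁻¹).toWord.length = 2 * h := by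
        change ((φ (mk [t]))⁻¹).norm = _
        rw [norm_inv_eq, hn]
      have h3 := wordValue_injective (by simp [hl1]) heq
      have h4 : h ≤ cancelLen (φ (mk [t])) (φ (mk [t])) :=
        (le_commonPrefixLen_iff _ _ _).2 ⟨by omega, by omega, h3.symm⟩
      have := cancelLen_self_lt (hne t)
      omega
    · have h3 := halvesValue_mul_lt (x := (φ (mk [t]))⁻¹) (y := (φ (mk [s]))⁻¹) (h := h)
        (by rw [norm_inv_eq, hn]) hs (by rw [norm_inv_eq]; omega) (by rwa [inv_inv])
      have h4 := hmove (t.1, !t.2) (s.1, !s.2) (Ne.symm hst')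
      rw [← hbar, ← hbar] at h4
      have := h4.2 h3.1
      omega
  -- the images of the letters being Nielsen reduced, `φ⁻¹ x_j` has length one
  have hlet : ∀ j, ∃ a b, φ⁻¹ (of j) = sgen a b := by
    intro j
    have hj : φ (φ⁻¹ (of j)) = of j := MulAut.apply_inv_self _ _ _
    rcases hw : (φ⁻¹ (of j)).toWord with _ | ⟨t, l⟩
    · rw [toWord_eq_nil_iff] at hw
      rw [hw, map_one] at hj
      exact absurd hj.symm (of_ne_one j)
    · have hred : IsReduced (t :: l) := hw ▸ isReduced_toWord
      have hmk : φ⁻¹ (of j) = mk (t :: l) := by rw [← hw, mk_toWord]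
      have := (length_le_norm_of_nielsenReduced φ.toMonoidHom hne (fun s t h => (hN1 s t h).1) hN2
        t l hred t (fun _ => rfl)).2
      have e : φ.toMonoidHom (mk (t :: l)) = of j := by rw [← hmk]; exact hj
      rw [e, norm_of] at this
      have hl : l = [] := List.length_eq_zero_iff.1 (by simp only [List.length_cons] at this; omega)
      exact ⟨t.1, t.2, by rw [hmk, hl]; rfl⟩
  obtain ⟨σ, ε, h⟩ := eq_signedPerm_of_letters hlet
  have : φ₀ = (φ⁻¹)⁻¹ * θ₀⁻¹ := by rw [hφ]; group
  rw [this, h]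
  exact mul_mem (inv_mem (signedPerm_mem_nielsenSubgroup _ _)) (inv_mem hθ₀)

end Nielsen

/-! ### Relations modulo the Magnus subgroup -/

section MagnusQuotient

variable {n : ℕ}

theorem conjIA_mem_closure_letters (θ : MulAut (FreeGroup (Fin n))) {g : IA n}
    (hg : g ∈ Subgroup.closure (letters n)) : conjIA θ g ∈ Subgroup.closure (letters n) := by
  have hθ : θ ∈ nielsenSubgroup n := by rw [nielsenSubgroup_eq_top]; trivial
  have gen : ∀ θ : MulAut (FreeGroup (Fin n)),
      (∀ x ∈ letters n, conjIA θ x ∈ Subgroup.closure (letters n)) →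
      ∀ g ∈ Subgroup.closure (letters n), conjIA θ g ∈ Subgroup.closure (letters n) := by
    intro θ h
    have : Subgroup.closure (letters n) ≤
        (Subgroup.closure (letters n)).comap (conjIA θ).toMonoidHom := by
      rw [Subgroup.closure_le]; exact h
    exact this
  induction hθ using Subgroup.closure_induction'' generalizing g with
  | one => simpa [conjIA] using hg
  | mul x y _ _ hx hy => rw [conjIA_mul]; exact hx (hy hg)
  | mem x hx =>
    refine gen x (fun y hy => ?_) g hg
    rcases hx with ⟨a, b, hab, rfl⟩ | ⟨σ, ε, rfl⟩
    · exact ((HasLen.of_mem hy).conjIA_transv hab).mem_closure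
    · exact ((HasLen.of_mem hy).conjIA_signedPerm σ ε).mem_closure
  | inv_mem x hx =>
    rcases hx with ⟨a, b, hab, rfl⟩ | ⟨σ, ε, rfl⟩
    · exact gen _ (fun y hy => ((HasLen.of_mem hy).conjIA_transv_inv hab).mem_closure) g hg
    · obtain ⟨τ, η, h⟩ : ∃ τ η, (signedPerm σ ε)⁻¹ = signedPerm τ η := by
        refine eq_signedPerm_of_letters fun j => ⟨σ.symm j, ε (σ.symm j), ?_⟩
        exact FreeGroup.lift_apply_of (f := fun j => sgen (σ.symm j) (ε (σ.symm j)))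
      rw [h]
      exact gen _ (fun y hy => ((HasLen.of_mem hy).conjIA_signedPerm _ _).mem_closure) g hg

/-- The subgroup of `Aut(F_n)` generated by the elements of `letters n`. -/
def magnusSubgroup (n : ℕ) : Subgroup (MulAut (FreeGroup (Fin n))) :=
  (Subgroup.closure (letters n)).map (IA n).subtype

instance magnusSubgroup_normal (n : ℕ) : (magnusSubgroup n).Normal where
  conj_mem := by
    rintro _ ⟨g, hg, rfl⟩ θ
    exact ⟨conjIA θ g, conjIA_mem_closure_letters θ hg, coe_conjIA θ g⟩

theorem coe_letter_mem_magnusSubgroup {g : IA n} (hg : g ∈ letters n) :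
    (g : MulAut (FreeGroup (Fin n))) ∈ magnusSubgroup n :=
  ⟨g, Subgroup.subset_closure hg, rfl⟩

/-- The vector of exponent sums of a word. -/
def exponents (n : ℕ) : FreeGroup (Fin n) →* Multiplicative (Fin n → ℤ) :=
  FreeGroup.lift fun i => Multiplicative.ofAdd (Pi.single i 1)

theorem exponents_of (i : Fin n) :
    (exponents n (FreeGroup.of i)).toAdd = Pi.single i 1 := by simp [exponents]

/-- The action of `Aut(F_n)` on the abelianization `ℤ^n` of `F_n`. -/
noncomputable def abAction (n : ℕ) : MulAut (FreeGroup (Fin n)) →* Module.End ℤ (Fin n → ℤ) where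
  toFun φ := (Pi.basisFun ℤ (Fin n)).constr ℤ fun i => (exponents n (φ (FreeGroup.of i))).toAdd
  map_one' := by
    refine (Pi.basisFun ℤ (Fin n)).ext fun i => ?_
    rw [Module.Basis.constr_basis, MulAut.one_apply, exponents_of, Module.End.one_apply,
      Pi.basisFun_apply]
  map_mul' φ ψ := by
    have key : ∀ w, (exponents n (φ w)).toAdd =
        (Pi.basisFun ℤ (Fin n)).constr ℤ (fun i => (exponents n (φ (FreeGroup.of i))).toAdd)
          (exponents n w).toAdd := by
      intro w
      induction w using FreeGroup.induction_on with
      | C1 => simp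
      | of i =>
        rw [exponents_of, ← Pi.basisFun_apply, Module.Basis.constr_basis]
      | inv_of i ih => simp only [map_inv, toAdd_inv, ih, map_neg]
      | mul x y hx hy => simp only [map_mul, toAdd_mul, hx, hy, map_add]
    refine (Pi.basisFun ℤ (Fin n)).ext fun i => ?_
    rw [Module.Basis.constr_basis, Module.End.mul_apply, Module.Basis.constr_basis,
      MulAut.mul_apply, key]

theorem abAction_single (φ : MulAut (FreeGroup (Fin n))) (i : Fin n) :
    abAction n φ (Pi.single i 1) = (exponents n (φ (FreeGroup.of i))).toAdd := by
  rw [← Pi.basisFun_apply]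
  exact (Pi.basisFun ℤ (Fin n)).constr_basis ℤ _ i

theorem abAction_of_mem_IA {φ : MulAut (FreeGroup (Fin n))} (h : φ ∈ IA n) :
    abAction n φ = 1 := by
  refine (Pi.basisFun ℤ (Fin n)).ext fun i => ?_
  rw [Pi.basisFun_apply, abAction_single]
  have := congrArg (Abelianization.lift (exponents n)) (h (FreeGroup.of i))
  rw [Abelianization.lift_apply_of, Abelianization.lift_apply_of] at this
  rw [this, exponents_of]; rfl

/-- Adding `m` times the coordinate `b` to the coordinate `a`. -/
def addCoord (a b : Fin n) (m : ℤ) (v : Fin n → ℤ) : Fin n → ℤ :=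
  v + Pi.single a (m * v b)

theorem addCoord_self (a b : Fin n) (m : ℤ) (v : Fin n → ℤ) :
    addCoord a b m v a = v a + m * v b := by simp [addCoord]

theorem addCoord_ne {a c : Fin n} (h : c ≠ a) (b : Fin n) (m : ℤ) (v : Fin n → ℤ) :
    addCoord a b m v c = v c := by simp [addCoord, h]

theorem abAction_transv {a b : Fin n} (h : a ≠ b) (v : Fin n → ℤ) :
    abAction n (transv a b) v = addCoord a b 1 v := by
  have : abAction n (transv a b) =
      LinearMap.id + (LinearMap.single ℤ (fun _ : Fin n => ℤ) a).comp (LinearMap.proj b) := by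
    refine (Pi.basisFun ℤ (Fin n)).ext fun i => ?_
    rw [Pi.basisFun_apply, abAction_single]
    by_cases hi : i = b
    · subst hi
      rw [transv_self h, map_mul, toAdd_mul, exponents_of, exponents_of]
      simp
    · rw [transv_ne hi, exponents_of]
      simp [hi]
  rw [this]
  simp [addCoord]

theorem addCoord_neg_addCoord {a b : Fin n} (h : a ≠ b) (m : ℤ) (v : Fin n → ℤ) :
    addCoord a b (-m) (addCoord a b m v) = v := by
  ext c
  by_cases hc : c = a
  · subst hc; rw [addCoord_self, addCoord_self, addCoord_ne h.symm]; ring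
  · rw [addCoord_ne hc, addCoord_ne hc]

theorem abAction_transv_inv {a b : Fin n} (h : a ≠ b) (v : Fin n → ℤ) :
    abAction n (transv a b)⁻¹ v = addCoord a b (-1) v := by
  have h1 : abAction n (transv a b)⁻¹ (abAction n (transv a b) (addCoord a b (-1) v)) =
      addCoord a b (-1) v := by
    rw [← Module.End.mul_apply, ← map_mul]; simp
  rw [abAction_transv h] at h1
  have h2 := addCoord_neg_addCoord h (-1) v
  rw [neg_neg] at h2
  rw [h2] at h1
  exact h1

/-- The sign `1` or `-1` attached to the exponent of a letter. -/
def boolSign (b : Bool) : ℤ := if b then 1 else -1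

theorem boolSign_eq (b : Bool) : boolSign b = 1 ∨ boolSign b = -1 := by
  cases b <;> simp [boolSign]

/-- The action of a signed permutation on `ℤ^n`. -/
def permCoord (σ : Equiv.Perm (Fin n)) (ε : Fin n → Bool) (v : Fin n → ℤ) : Fin n → ℤ :=
  fun j => boolSign (ε (σ.symm j)) * v (σ.symm j)

theorem permCoord_apply (σ : Equiv.Perm (Fin n)) (ε : Fin n → Bool) (v : Fin n → ℤ) (i : Fin n) :
    permCoord σ ε v (σ i) = boolSign (ε i) * v i := by simp [permCoord]

theorem abAction_signedPerm (σ : Equiv.Perm (Fin n)) (ε : Fin n → Bool) (v : Fin n → ℤ) :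
    abAction n (signedPerm σ ε) v = permCoord σ ε v := by
  let f : Module.End ℤ (Fin n → ℤ) :=
    { toFun := permCoord σ ε
      map_add' := fun v w => by ext j; simp [permCoord, mul_add]
      map_smul' := fun m v => by ext j; simp [permCoord, mul_left_comm] }
  have : abAction n (signedPerm σ ε) = f := by
    refine (Pi.basisFun ℤ (Fin n)).ext fun i => ?_
    rw [Pi.basisFun_apply, abAction_single, signedPerm_of]
    ext j
    obtain ⟨j, rfl⟩ := σ.surjective j
    change _ = permCoord σ ε _ (σ j)
    rw [permCoord_apply]
    by_cases hj : j = i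
    · subst hj
      cases h : ε j <;> simp [sgen_true, sgen_false, exponents_of, boolSign]
    · have : σ j ≠ σ i := fun h => hj (σ.injective h)
      cases h : ε i <;> simp [sgen_true, sgen_false, exponents_of, hj]
  rw [this]; rfl

theorem signedPerm_mul (σ τ : Equiv.Perm (Fin n)) (ε η : Fin n → Bool) :
    signedPerm σ ε * signedPerm τ η = signedPerm (σ * τ) fun i => ε (τ i) == η i := by
  refine mulAut_ext_of fun k => ?_
  rw [MulAut.mul_apply, signedPerm_of, signedPerm_sgen, signedPerm_of]; rfl

theorem signedPerm_one : signedPerm (1 : Equiv.Perm (Fin n)) (fun _ => true) = 1 := by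
  refine mulAut_ext_of fun k => ?_
  rw [signedPerm_of]; rfl

/-- The quotient of `Aut(F_n)` by the subgroup generated by the Magnus generators. It will turn out
to be `GL_n(ℤ)`. -/
abbrev MagnusQuotient (n : ℕ) := MulAut (FreeGroup (Fin n)) ⧸ magnusSubgroup n

/-- The power `m` of the class of the transvection `x_b ↦ x_b x_a`. -/
def elem (a b : Fin n) (m : ℤ) : MagnusQuotient n := (transv a b : MagnusQuotient n) ^ m

/-- The class of a signed permutation. -/
def perm (σ : Equiv.Perm (Fin n)) (ε : Fin n → Bool) : MagnusQuotient n := signedPerm σ ε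

theorem elem_mul_elem (a b : Fin n) (m k : ℤ) : elem a b m * elem a b k = elem a b (m + k) :=
  (zpow_add _ _ _).symm

theorem elem_inv (a b : Fin n) (m : ℤ) : (elem a b m)⁻¹ = elem a b (-m) := (zpow_neg _ _).symm

theorem elem_neg_mul_elem_mul (a b : Fin n) (m : ℤ) (x : MagnusQuotient n) :
    elem a b (-m) * (elem a b m * x) = x := by
  rw [← mul_assoc, elem_mul_elem]; simp [elem]

theorem commute_elem {a b c d : Fin n} (hab : a ≠ b) (hcd : c ≠ d) (had : a ≠ d) (hbc : b ≠ c)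
    (m k : ℤ) : Commute (elem a b m) (elem c d k) := by
  refine Commute.zpow_zpow ?_ m k
  rw [Commute, SemiconjBy, ← QuotientGroup.mk_mul, ← QuotientGroup.mk_mul, QuotientGroup.eq]
  by_cases hbd : b = d
  · subst hbd
    have : (transv a b * transv c b)⁻¹ * (transv c b * transv a b) =
        commRight b (FreeGroup.of c) (FreeGroup.of a) := by
      simp [coe_commRight, transv, flank_mul, flank_inv, rcomm, mul_assoc]
    rw [this]
    exact coe_letter_mem_magnusSubgroup (commRight_mem_letters b c a true true)
  · have : transv a b * transv c d = transv c d * transv a b := by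
      refine mulAut_ext_of fun k => ?_
      by_cases hkb : k = b
      · subst hkb
        simp [transv_self hab, transv_ne hbd, transv_ne had]
      · by_cases hkd : k = d
        · subst hkd
          simp [transv_self hcd, transv_ne hkb, transv_ne hbc.symm]
        · simp [transv_ne hkb, transv_ne hkd]
    rw [this]; simp

/-- The Steinberg relation between transvections with a common index, for exponents `±1`. -/
theorem elem_steinberg {a b d : Fin n} (hab : a ≠ b) (hbd : b ≠ d) (had : a ≠ d) {ε δ : ℤ}
    (hε : ε = 1 ∨ ε = -1) (hδ : δ = 1 ∨ δ = -1) :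
    elem a b ε * elem b d δ = elem b d δ * elem a d (ε * δ) * elem a b ε := by
  have h1 : elem a b 1 * elem b d 1 = elem b d 1 * elem a d 1 * elem a b 1 := by
    have : transv a b * transv b d = transv b d * transv a d * transv a b := by
      refine mulAut_ext_of fun k => ?_
      by_cases hkb : k = b
      · subst hkb
        simp [transv_self hab, transv_ne hbd, transv_ne had]
      · by_cases hkd : k = d
        · subst hkd
          simp [transv_self hbd, transv_self had, transv_ne hkb, transv_self hab, transv_ne had,
            mul_assoc]
        · simp [transv_ne hkb, transv_ne hkd]
    simp only [elem, zpow_one, ← QuotientGroup.mk_mul, this]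
  have c1 := commute_elem hbd had hbd had.symm 1 1
  have c2 := commute_elem hab had had hab.symm 1 1
  have e : ∀ p q : Fin n, elem p q (-1) = (elem p q 1)⁻¹ := fun p q => by rw [elem_inv]
  set x := elem a b 1
  set y := elem b d 1
  set z := elem a d 1
  have c1' : y * z = z * y := c1
  have c2' : x * z = z * x := c2
  have h2 : x⁻¹ * y = y * z⁻¹ * x⁻¹ := by
    have : x * z⁻¹ = z⁻¹ * x := c2.inv_right
    rw [inv_mul_eq_iff_eq_mul, ← mul_assoc, ← mul_assoc, h1, mul_assoc (y * z), this]
    group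
  rcases hε with rfl | rfl <;> rcases hδ with rfl | rfl
  · simpa using h1
  · simp only [e, mul_neg, mul_one]
    calc x * y⁻¹ = y⁻¹ * z⁻¹ * (z * y * x) * y⁻¹ := by group
      _ = y⁻¹ * z⁻¹ * x := by rw [← c1', ← h1]; group
  · simp only [e, mul_one]
    exact h2
  · simp only [e, mul_neg, mul_one]
    have : y * z⁻¹ = z⁻¹ * y := c1.inv_right
    calc x⁻¹ * y⁻¹ = y⁻¹ * z * (z⁻¹ * y) * x⁻¹ * y⁻¹ := by group
      _ = y⁻¹ * z * x⁻¹ := by rw [← this, mul_assoc (y⁻¹ * z), ← h2]; group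

theorem perm_conj_elem (σ : Equiv.Perm (Fin n)) (ε : Fin n → Bool) {a b : Fin n}
    (m : ℤ) :
    perm σ ε * elem a b m = elem (σ a) (σ b) (boolSign (ε a) * boolSign (ε b) * m) * perm σ ε := by
  rw [← mul_inv_eq_iff_eq_mul, elem, elem, ← conj_zpow, zpow_mul]
  congr 1
  rw [perm, ← QuotientGroup.mk_mul, ← QuotientGroup.mk_inv, ← QuotientGroup.mk_mul, transv,
    signedPerm_conj_flank, signedPerm_of]
  have h1 : ((transv (σ a) (σ b) : MulAut (FreeGroup (Fin n))) : MagnusQuotient n)⁻¹ =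
      (flank (σ b) (FreeGroup.of (σ a))⁻¹ 1 : MulAut (FreeGroup (Fin n))) := by
    rw [← QuotientGroup.mk_inv, QuotientGroup.eq, inv_inv]
    have : transv (σ a) (σ b) * flank (σ b) (FreeGroup.of (σ a))⁻¹ 1 =
        conjGen (σ b) (FreeGroup.of (σ a)) := by
      rw [transv, flank_mul, coe_conjGen]; simp
    rw [this]
    exact coe_letter_mem_magnusSubgroup (conjGen_mem_letters _ _ true)
  have h2 : ((transv (σ a) (σ b) : MulAut (FreeGroup (Fin n))) : MagnusQuotient n) =
      (flank (σ b) (FreeGroup.of (σ a)) 1 : MulAut (FreeGroup (Fin n))) := by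
    rw [← inv_inj, h1, ← QuotientGroup.mk_inv, flank_inv]; simp
  cases ha : ε a <;> cases hb : ε b <;>
    simp only [boolSign, sgen_true, sgen_false, map_one, inv_inv, inv_one, if_true, if_false,
      Bool.false_eq_true, mul_one, mul_neg, zpow_one, zpow_neg]
  · exact h2.symm
  · rw [← QuotientGroup.mk_inv, transv_inv]
  · exact h1.symm
  · rfl

/-- The braid element `T_ab T_ba⁻¹ T_ab` is the signed permutation `x_a ↦ x_b⁻¹`, `x_b ↦ x_a`. -/
theorem elem_braid {a b : Fin n} (hab : a ≠ b) :
    elem a b 1 * elem b a (-1) * elem a b 1 =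
      perm (Equiv.swap a b) fun i => decide (i ≠ a) := by
  have : transv a b * (transv b a)⁻¹ * transv a b =
      conjGen a (sgen b false) * signedPerm (Equiv.swap a b) fun i => decide (i ≠ a) := by
    refine mulAut_ext_of fun k => ?_
    simp only [MulAut.mul_apply, signedPerm_of, coe_conjGen, sgen_false]
    by_cases hka : k = a
    · subst hka
      simp [transv_ne hab, transv_inv_self hab.symm, transv_self hab, sgen_false,
        flank_ne hab.symm]
    · by_cases hkb : k = b
      · subst hkb
        simp only [transv_self hab, map_mul, transv_inv_self hab.symm, transv_inv_ne hka]
        simp [transv_self hab, transv_ne hab, sgen_true, hka, flank_self, substHom_ne hka,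
          mul_assoc]
      · simp [transv_ne hkb, transv_inv_ne hka, sgen_true, hka,
          Equiv.swap_apply_of_ne_of_ne hka hkb, flank_ne hka]
  have h1 : ((conjGen a (sgen b false) : MulAut (FreeGroup (Fin n))) : MagnusQuotient n) = 1 :=
    (QuotientGroup.eq_one_iff _).2 (coe_letter_mem_magnusSubgroup (conjGen_mem_letters _ _ _))
  simp only [elem, zpow_one, zpow_neg]
  rw [← QuotientGroup.mk_inv, ← QuotientGroup.mk_mul, ← QuotientGroup.mk_mul, this,
    QuotientGroup.mk_mul, h1, one_mul, perm]

/-- The signed permutation `T_ab^ε T_ba^{-ε} T_ab^ε` for `ε = 1` (`c = true`) and `ε = -1`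
(`c = false`). -/
def braidPerm (a b : Fin n) (c : Bool) : MagnusQuotient n :=
  perm (Equiv.swap a b) fun i => if c then decide (i ≠ a) else decide (i ≠ b)

theorem elem_braid_sign {a b : Fin n} (hab : a ≠ b) (c : Bool) :
    elem a b (boolSign c) * elem b a (-boolSign c) * elem a b (boolSign c) = braidPerm a b c := by
  cases c
  · have h1 := perm_conj_elem (1 : Equiv.Perm (Fin n)) (fun i => decide (i ≠ a)) 1 (a := a) (b := b)
    have h2 := perm_conj_elem (1 : Equiv.Perm (Fin n)) (fun i => decide (i ≠ a)) (-1)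
      (a := b) (b := a)
    have e : perm 1 (fun i => decide (i ≠ a)) * perm 1 (fun i => decide (i ≠ a)) = 1 := by
      rw [perm, ← QuotientGroup.mk_mul, signedPerm_mul, ← QuotientGroup.mk_one]
      congr 1
      rw [← signedPerm_one]
      congr 1
      funext i; by_cases h : i = a <;> simp [h]
    have e2 : perm (1 : Equiv.Perm (Fin n)) (fun i => decide (i ≠ a)) *
        perm (Equiv.swap a b) (fun i => decide (i ≠ a)) *
        perm (1 : Equiv.Perm (Fin n)) (fun i => decide (i ≠ a)) = braidPerm a b false := by
      rw [braidPerm]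
      simp only [perm, ← QuotientGroup.mk_mul, signedPerm_mul]
      congr 2
      funext i
      by_cases hia : i = a
      · subst hia; simp [hab, hab.symm]
      · by_cases hib : i = b
        · subst hib; simp [hab.symm]
        · simp [hia, hib, Equiv.swap_apply_of_ne_of_ne hia hib]
    simp [boolSign, hab.symm] at h1 h2
    rw [← e2, ← elem_braid hab]
    simp only [boolSign, Bool.false_eq_true, if_false, neg_neg]
    set p := perm (1 : Equiv.Perm (Fin n)) (fun i => !decide (i = a)) with hp
    have hp' : perm (1 : Equiv.Perm (Fin n)) (fun i => decide (i ≠ a)) = p := by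
      rw [hp]; congr 1; funext i; by_cases h : i = a <;> simp [h]
    rw [hp'] at e ⊢
    have e' : p = p⁻¹ := eq_inv_of_mul_eq_one_left e
    calc _ = (elem a b (-1) * elem b a 1 * elem a b (-1)) * (p * p) := by rw [e, mul_one]
      _ = elem a b (-1) * elem b a 1 * (elem a b (-1) * p) * p := by group
      _ = elem a b (-1) * (elem b a 1 * p) * elem a b 1 * p := by rw [← h1]; group
      _ = elem a b (-1) * p * elem b a (-1) * elem a b 1 * p := by rw [← h2]; group
      _ = _ := by rw [← h1]; group
  · simpa [boolSign, braidPerm] using elem_braid hab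

theorem elem_braid_sign' {a b : Fin n} (hab : a ≠ b) (c : Bool) :
    elem b a (-boolSign c) * elem a b (boolSign c) * elem b a (-boolSign c) = braidPerm a b c := by
  have h := elem_braid_sign hab c
  have h1 : braidPerm a b c * elem a b (boolSign c) =
      elem b a (-boolSign c) * braidPerm a b c := by
    rw [braidPerm, perm_conj_elem]
    simp only [Equiv.swap_apply_left, Equiv.swap_apply_right]
    congr 2
    cases c <;> simp [boolSign, hab, hab.symm]
  set x := elem a b (boolSign c)
  set y := elem b a (-boolSign c)
  rw [← h] at h1 ⊢
  have h2 : x * y * x * x = y * x * y * x := by rw [h1]; group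
  exact (mul_right_cancel h2).symm

end MagnusQuotient

/-! ### Reduction of integral vectors by transvections -/

section Reduction

variable {n : ℕ}

/-- The action of the quotient of `Aut(F_n)` on `ℤ^n`. -/
noncomputable def act (n : ℕ) : MagnusQuotient n →* Module.End ℤ (Fin n → ℤ) :=
  QuotientGroup.lift (magnusSubgroup n) (abAction n) (by
    rintro _ ⟨g, -, rfl⟩
    exact abAction_of_mem_IA g.2)

theorem act_mk (φ : MulAut (FreeGroup (Fin n))) :
    act n (φ : MagnusQuotient n) = abAction n φ := rfl

theorem act_elem {a b : Fin n} (h : a ≠ b) {ε : ℤ} (hε : ε = 1 ∨ ε = -1) (v : Fin n → ℤ) :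
    act n (elem a b ε) v = addCoord a b ε v := by
  rcases hε with rfl | rfl
  · rw [elem, zpow_one, act_mk, abAction_transv h]
  · rw [elem, zpow_neg, zpow_one, ← QuotientGroup.mk_inv, act_mk, abAction_transv_inv h]

theorem act_elem_self {a b : Fin n} (h : a ≠ b) {ε : ℤ} (hε : ε = 1 ∨ ε = -1) (v : Fin n → ℤ) :
    act n (elem a b ε) v a = v a + ε * v b := by rw [act_elem h hε, addCoord_self]

theorem act_elem_ne {a b c : Fin n} (h : a ≠ b) {ε : ℤ} (hε : ε = 1 ∨ ε = -1) (v : Fin n → ℤ)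
    (hc : c ≠ a) : act n (elem a b ε) v c = v c := by rw [act_elem h hε, addCoord_ne hc]

theorem act_elem_eq_self {a b : Fin n} (h : a ≠ b) {ε : ℤ} (hε : ε = 1 ∨ ε = -1) {v : Fin n → ℤ}
    (hv : v b = 0) : act n (elem a b ε) v = v := by
  rw [act_elem h hε, addCoord, hv]; simp

theorem act_perm (σ : Equiv.Perm (Fin n)) (ε : Fin n → Bool) (v : Fin n → ℤ) :
    act n (perm σ ε) v = permCoord σ ε v := by
  rw [perm, act_mk, abAction_signedPerm]

theorem act_mul (p q : MagnusQuotient n) (v : Fin n → ℤ) :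
    act n (p * q) v = act n p (act n q v) := by
  rw [map_mul]; rfl

theorem isSign_neg {ε : ℤ} (hε : ε = 1 ∨ ε = -1) : -ε = 1 ∨ -ε = -1 := by omega

theorem isSign_mul {ε δ : ℤ} (hε : ε = 1 ∨ ε = -1) (hδ : δ = 1 ∨ δ = -1) :
    ε * δ = 1 ∨ ε * δ = -1 := by
  rcases hε with rfl | rfl <;> rcases hδ with rfl | rfl <;> simp

/-- A signed permutation that fixes the coordinates below `k`. -/
def FixesBelow (k : ℕ) (σ : Equiv.Perm (Fin n)) (ε : Fin n → Bool) : Prop :=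
  ∀ i : Fin n, (i : ℕ) < k → σ i = i ∧ ε i = true

theorem FixesBelow.le {k : ℕ} {σ : Equiv.Perm (Fin n)} {ε : Fin n → Bool}
    (h : FixesBelow k σ ε) {a : Fin n} (ha : k ≤ a) : k ≤ σ a := by
  by_contra hlt
  push Not at hlt
  have := σ.injective (h _ hlt).1
  rw [this] at hlt; omega

theorem FixesBelow.symm_le {k : ℕ} {σ : Equiv.Perm (Fin n)} {ε : Fin n → Bool}
    (h : FixesBelow k σ ε) {a : Fin n} (ha : k ≤ a) : k ≤ σ.symm a := by
  by_contra hlt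
  push Not at hlt
  have := (h _ hlt).1
  rw [Equiv.apply_symm_apply] at this
  rw [← this] at hlt; omega

theorem FixesBelow.mul {k : ℕ} {σ τ : Equiv.Perm (Fin n)} {ε η : Fin n → Bool}
    (h : FixesBelow k σ ε) (h' : FixesBelow k τ η) :
    FixesBelow k (σ * τ) (fun i => ε (τ i) == η i) := by
  intro i hi
  obtain ⟨h1, h2⟩ := h' i hi
  obtain ⟨h3, h4⟩ := h i hi
  simp [h1, h2, h3, h4]

/-- The stabilizer of `e_k` inside the elements acting on the coordinates from `k` on, given by
generators. -/
def stabSubgroup (k : Fin n) : Subgroup (MagnusQuotient n) :=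
  Subgroup.closure ({q | ∃ a b : Fin n, ∃ ε : ℤ, k ≤ a ∧ k < b ∧ a ≠ b ∧ (ε = 1 ∨ ε = -1) ∧
    q = elem a b ε} ∪ {q | ∃ σ ε, FixesBelow (k + 1) σ ε ∧ q = perm σ ε})

/-- The transvection `elem a b ε` shortens the vector `v` by cancelling the whole of the
coordinate `v b` against `v a`. -/
structure Shortens (k : Fin n) (v : Fin n → ℤ) (a b : Fin n) (ε : ℤ) : Prop where
  le_left : k ≤ a
  le_right : k ≤ b
  ne : a ≠ b
  sign : ε = 1 ∨ ε = -1
  ne_zero : v b ≠ 0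
  natAbs_add : (v a + ε * v b).natAbs + (v b).natAbs = (v a).natAbs

/-- `Reach k v x` says that `x` carries a positive multiple of `e_k` to `v`, and that some chain of
shortening transvections, started at `v`, turns `x` into a signed permutation times an element of
the stabilizer subgroup. -/
inductive Reach (k : Fin n) : (Fin n → ℤ) → MagnusQuotient n → Prop
  | base (σ : Equiv.Perm (Fin n)) (ε : Fin n → Bool) (m : ℤ) (w : MagnusQuotient n)
      (hσ : FixesBelow k σ ε) (hm : 0 < m) (hw : w ∈ stabSubgroup k) :
      Reach k (permCoord σ ε (Pi.single k m)) (perm σ ε * w)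
  | step (v : Fin n → ℤ) (x : MagnusQuotient n) (a b : Fin n) (ε : ℤ) (h : Shortens k v a b ε)
      (hr : Reach k (act n (elem a b ε) v) (elem a b ε * x)) : Reach k v x

theorem perm_mul_perm (σ τ : Equiv.Perm (Fin n)) (ε η : Fin n → Bool) :
    perm σ ε * perm τ η = perm (σ * τ) fun i => ε (τ i) == η i := by
  rw [perm, perm, ← QuotientGroup.mk_mul, signedPerm_mul]; rfl

theorem perm_inv {k : ℕ} {σ : Equiv.Perm (Fin n)} {ε : Fin n → Bool} (h : FixesBelow k σ ε) :
    ∃ τ η, FixesBelow k τ η ∧ (perm σ ε)⁻¹ = perm τ η := by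
  refine ⟨σ⁻¹, fun i => ε (σ⁻¹ i), ?_, ?_⟩
  · intro i hi
    have h1 : σ⁻¹ i = i := by rw [Equiv.Perm.inv_eq_iff_eq, (h i hi).1]
    exact ⟨h1, by beta_reduce; rw [h1]; exact (h i hi).2⟩
  · rw [inv_eq_iff_mul_eq_one, perm_mul_perm, mul_inv_cancel]
    simp only [beq_self_eq_true]
    rw [perm, signedPerm_one, QuotientGroup.mk_one]

/-- The subgroup generated by the transvections adding multiples of the coordinate `b`. -/
def columnSubgroup (k b : Fin n) : Subgroup (MagnusQuotient n) :=
  Subgroup.closure {q | ∃ (a : Fin n) (ε : ℤ), k ≤ a ∧ a ≠ b ∧ (ε = 1 ∨ ε = -1) ∧ q = elem a b ε}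

theorem elem_mem_columnSubgroup {k a b : Fin n} {ε : ℤ} (ha : k ≤ a) (hab : a ≠ b)
    (hε : ε = 1 ∨ ε = -1) : elem a b ε ∈ columnSubgroup k b :=
  Subgroup.subset_closure ⟨a, ε, ha, hab, hε, rfl⟩

/-- A transvection that does not change the coordinate `b` normalizes the column subgroup of `b`, by
the Steinberg relations. -/
theorem columnSubgroup_conj {k b c d : Fin n} {δ : ℤ} (hc : k ≤ c) (hcd : c ≠ d) (hbc : b ≠ c)
    (hbd : b ≠ d) (hδ : δ = 1 ∨ δ = -1) {q : MagnusQuotient n} (hq : q ∈ columnSubgroup k b) :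
    elem c d δ * q * (elem c d δ)⁻¹ ∈ columnSubgroup k b := by
  have : columnSubgroup k b ≤
      (columnSubgroup k b).comap (MulAut.conj (elem c d δ)).toMonoidHom := by
    rw [columnSubgroup, Subgroup.closure_le]
    rintro _ ⟨a, ε, ha, hab, hε, rfl⟩
    change elem c d δ * elem a b ε * (elem c d δ)⁻¹ ∈ columnSubgroup k b
    -- In the remaining cases the moves either commute or are linked by a Steinberg relation.
    by_cases had : a = d
    · subst had
      rw [elem_steinberg hcd hab hbc.symm hδ hε, mul_inv_cancel_right]
      exact Subgroup.mul_mem _ (elem_mem_columnSubgroup ha hab hε)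
        (elem_mem_columnSubgroup hc hbc.symm (isSign_mul hδ hε))
    · rw [(commute_elem hcd hab (Ne.symm hbc) (Ne.symm had) δ ε).eq, mul_inv_cancel_right]
      exact elem_mem_columnSubgroup ha hab hε
  exact this hq

/-- Transvections fixing `v` preserve `Reach`. -/
theorem Reach.stab_column {k : Fin n} {v : Fin n → ℤ} {x : MagnusQuotient n} (hr : Reach k v x)
    {b : Fin n} (hb : k ≤ b) (hv : v b = 0) {q : MagnusQuotient n} (hq : q ∈ columnSubgroup k b) :
    Reach k v (q * x) := by
  induction hr generalizing q with
  | base σ η m w hσ hm hw =>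
    obtain ⟨b, rfl⟩ := σ.surjective b
    rw [permCoord_apply] at hv
    have hbk : b ≠ k := by
      rintro rfl
      rw [Pi.single_eq_same] at hv
      rcases boolSign_eq (η b) with h | h <;> rw [h] at hv <;> omega
    have hb' := hσ.symm_le hb
    rw [Equiv.symm_apply_apply] at hb'
    have : columnSubgroup k (σ b) ≤
        (stabSubgroup k).comap (MulAut.conj (perm σ η)⁻¹).toMonoidHom := by
      rw [columnSubgroup, Subgroup.closure_le]
      rintro _ ⟨a, ε, ha, hab, hε, rfl⟩
      change (perm σ η)⁻¹ * elem a (σ b) ε * (perm σ η)⁻¹⁻¹ ∈ stabSubgroup k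
      obtain ⟨a, rfl⟩ := σ.surjective a
      have hab' : a ≠ b := fun h => hab (by rw [h])
      have ha' := hσ.symm_le ha
      rw [Equiv.symm_apply_apply] at ha'
      have key := perm_conj_elem σ η (a := a) (b := b) (boolSign (η a) * boolSign (η b) * ε)
      have : boolSign (η a) * boolSign (η b) * (boolSign (η a) * boolSign (η b) * ε) = ε := by
        rcases boolSign_eq (η a) with h | h <;> rcases boolSign_eq (η b) with h' | h' <;>
          rw [h, h'] <;> ring
      rw [this] at key
      rw [inv_inv, mul_assoc, ← key, inv_mul_cancel_left]
      exact Subgroup.subset_closure (Or.inl ⟨a, b, _, ha', lt_of_le_of_ne hb' hbk.symm, hab',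
        isSign_mul (isSign_mul (boolSign_eq _) (boolSign_eq _)) hε, rfl⟩)
    have hq' : (perm σ η)⁻¹ * q * (perm σ η)⁻¹⁻¹ ∈ stabSubgroup k := this hq
    have e : q * (perm σ η * w) = perm σ η * ((perm σ η)⁻¹ * q * (perm σ η)⁻¹⁻¹ * w) := by group
    rw [e]
    exact Reach.base σ η m _ hσ hm (Subgroup.mul_mem _ hq' hw)
  | step v x c d δ h hr ih =>
    have h1 := h.natAbs_add
    have h2 := h.ne_zero
    have hbd : b ≠ d := by rintro rfl; exact h2 hv
    have hbc : b ≠ c := by rintro rfl; rw [hv] at h1; omega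
    have hv' : act n (elem c d δ) v b = 0 := by rw [act_elem_ne h.ne h.sign _ hbc, hv]
    refine Reach.step v _ c d δ h ?_
    have e : elem c d δ * (q * x) =
        elem c d δ * q * (elem c d δ)⁻¹ * (elem c d δ * x) := by group
    rw [e]
    exact ih hv' (columnSubgroup_conj h.le_left h.ne hbc hbd h.sign hq)

theorem Reach.stab {k : Fin n} {v : Fin n → ℤ} {x : MagnusQuotient n} (hr : Reach k v x)
    {a b : Fin n} {ε : ℤ} (ha : k ≤ a) (hb : k ≤ b) (hab : a ≠ b) (hε : ε = 1 ∨ ε = -1)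
    (hv : v b = 0) : Reach k (act n (elem a b ε) v) (elem a b ε * x) := by
  rw [act_elem_eq_self hab hε hv]
  exact hr.stab_column hb hv (elem_mem_columnSubgroup ha hab hε)

theorem Reach.of_stab {k : Fin n} {v : Fin n → ℤ} {x : MagnusQuotient n}
    {a b : Fin n} {ε : ℤ} (ha : k ≤ a) (hb : k ≤ b) (hab : a ≠ b) (hε : ε = 1 ∨ ε = -1)
    (hv : v b = 0) (hr : Reach k (act n (elem a b ε) v) (elem a b ε * x)) : Reach k v x := by
  rw [act_elem_eq_self hab hε hv] at hr
  simpa using hr.stab_column hb hv (Subgroup.inv_mem _ (elem_mem_columnSubgroup ha hab hε))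

/-- A shortening transvection at `v`, or one that does not move `v`. -/
theorem Reach.of_shortens_or {k : Fin n} {v : Fin n → ℤ} {x : MagnusQuotient n}
    {a b : Fin n} {ε : ℤ} (h : Shortens k v a b ε ∨ k ≤ a ∧ k ≤ b ∧ a ≠ b ∧
      (ε = 1 ∨ ε = -1) ∧ v b = 0)
    (hr : Reach k (act n (elem a b ε) v) (elem a b ε * x)) : Reach k v x := by
  rcases h with h | ⟨h1, h2, h3, h4, h5⟩
  · exact Reach.step v x a b ε h hr
  · exact Reach.of_stab h1 h2 h3 h4 h5 hr

theorem Reach.perm {k : Fin n} {v : Fin n → ℤ} {x : MagnusQuotient n} (hr : Reach k v x)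
    {σ : Equiv.Perm (Fin n)} {ε : Fin n → Bool} (hσ : FixesBelow k σ ε) :
    Reach k (act n (perm σ ε) v) (perm σ ε * x) := by
  induction hr with
  | base τ η m w hτ hm hw =>
    rw [← act_perm, ← act_mul, ← mul_assoc, perm_mul_perm, act_perm]
    exact Reach.base _ _ m w (hσ.mul hτ) hm hw
  | step v x c d δ h hr ih =>
    have key := perm_conj_elem σ ε (a := c) (b := d) δ
    refine Reach.step _ _ (σ c) (σ d) (boolSign (ε c) * boolSign (ε d) * δ) ?_ ?_
    · refine ⟨hσ.le h.le_left, hσ.le h.le_right, fun e => h.ne (σ.injective e),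
        isSign_mul (isSign_mul (boolSign_eq _) (boolSign_eq _)) h.sign, ?_, ?_⟩
      · rw [act_perm, permCoord_apply]
        have := h.ne_zero
        rcases boolSign_eq (ε d) with h | h <;> rw [h] <;> omega
      · rw [act_perm, permCoord_apply, permCoord_apply]
        have := h.natAbs_add
        rcases boolSign_eq (ε d) with h1 | h1 <;> rcases boolSign_eq (ε c) with h2 | h2 <;>
          rcases h.sign with h3 | h3 <;> rw [h3] at this <;> rw [h1, h2, h3] <;> omega
    · rw [← act_mul, ← mul_assoc, ← key, mul_assoc, act_mul]
      exact ih

/-- Up to a signed permutation and a further transvection, transvections in opposite directions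
are equal. -/
theorem exists_braid {k a b : Fin n} (ha : k ≤ a) (hb : k ≤ b) (hab : a ≠ b) {ε : ℤ}
    (hε : ε = 1 ∨ ε = -1) : ∃ η : Fin n → Bool, FixesBelow k (Equiv.swap a b) η ∧
      elem a b ε = elem b a ε * perm (Equiv.swap a b) η * elem b a ε := by
  obtain ⟨c, rfl⟩ : ∃ c, ε = boolSign c := by
    rcases hε with rfl | rfl
    exacts [⟨true, rfl⟩, ⟨false, rfl⟩]
  refine ⟨fun i => if c then decide (i ≠ a) else decide (i ≠ b), ?_, ?_⟩
  · intro i hi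
    have h1 : i ≠ a := by rintro rfl; exact absurd hi (not_lt.2 ha)
    have h2 : i ≠ b := by rintro rfl; exact absurd hi (not_lt.2 hb)
    refine ⟨Equiv.swap_apply_of_ne_of_ne h1 h2, ?_⟩
    simp [h1, h2]
  · have := elem_braid_sign' hab c
    rw [braidPerm] at this
    rw [← this, ← elem_inv]
    group

theorem elem_steinberg_left {a b d : Fin n} (hab : a ≠ b) (hbd : b ≠ d) (had : a ≠ d) {ε δ : ℤ}
    (hε : ε = 1 ∨ ε = -1) (hδ : δ = 1 ∨ δ = -1) :
    elem b d δ * elem a b ε = elem a d (-(ε * δ)) * elem a b ε * elem b d δ := by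
  rw [mul_assoc, elem_steinberg hab hbd had hε hδ,
    (commute_elem hbd had hbd had.symm δ (ε * δ)).eq, mul_assoc, elem_neg_mul_elem_mul]

theorem elem_steinberg_right {a b d : Fin n} (hab : a ≠ b) (hbd : b ≠ d) (had : a ≠ d) {ε δ : ℤ}
    (hε : ε = 1 ∨ ε = -1) (hδ : δ = 1 ∨ δ = -1) :
    elem b d δ * elem a b ε = elem a b ε * elem b d δ * elem a d (-(ε * δ)) := by
  rw [elem_steinberg_left hab hbd had hε hδ, mul_assoc, mul_assoc,
    (commute_elem hbd had hbd had.symm δ (-(ε * δ))).eq, ← mul_assoc, ← mul_assoc,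
    (commute_elem hab had had hab.symm ε (-(ε * δ))).eq]

/-- The sum of the absolute values of the coordinates. -/
def ellOne (v : Fin n → ℤ) : ℕ := ∑ i, (v i).natAbs

theorem Shortens.ellOne_lt {k : Fin n} {v : Fin n → ℤ} {a b : Fin n} {ε : ℤ}
    (h : Shortens k v a b ε) : ellOne (act n (elem a b ε) v) < ellOne v := by
  refine Finset.sum_lt_sum (fun i _ => ?_) ⟨a, Finset.mem_univ _, ?_⟩
  · by_cases hi : i = a
    · subst hi
      rw [act_elem_self h.ne h.sign]
      have := h.natAbs_add; omega
    · rw [act_elem_ne h.ne h.sign _ hi]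
  · rw [act_elem_self h.ne h.sign]
    have := h.natAbs_add
    have := h.ne_zero; omega

set_option maxHeartbeats 1600000 in
/-- Two shortening transvections at the same vector can be completed to a confluent diagram, so a
shortening transvection at `v` preserves `Reach`. -/
theorem Reach.shortens {k : Fin n} : ∀ (N : ℕ) {v : Fin n → ℤ} {x : MagnusQuotient n}
    {a b : Fin n} {ε : ℤ}, ellOne v ≤ N → Reach k v x → Shortens k v a b ε →
      Reach k (act n (elem a b ε) v) (elem a b ε * x) := by
  intro N
  induction N using Nat.strong_induction_on with
  | _ N IH =>
  intro v x a b ε hN hr hT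
  cases hr with
  | base σ η m w hσ hm hw =>
    exfalso
    obtain ⟨ha, hb, hab, hε, hne, habs⟩ := hT
    obtain ⟨a, rfl⟩ := σ.surjective a
    obtain ⟨b, rfl⟩ := σ.surjective b
    rw [permCoord_apply] at hne
    rw [permCoord_apply, permCoord_apply] at habs
    have hbk : b = k := by
      by_contra h
      rw [Pi.single_eq_of_ne h, mul_zero] at hne; exact hne rfl
    have hak : a ≠ k := by rintro rfl; exact hab (by rw [hbk])
    rw [Pi.single_eq_of_ne hak, mul_zero] at habs
    omega
  | step _ _ c d δ hS hr =>
    have IH' : ∀ {v' : Fin n → ℤ} {x' : MagnusQuotient n} {a' b' : Fin n} {ε' : ℤ},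
        ellOne v' < N → Reach k v' x' → Shortens k v' a' b' ε' →
          Reach k (act n (elem a' b' ε') v') (elem a' b' ε' * x') :=
      fun h h1 h2 => IH _ h le_rfl h1 h2
    have hSN := hS.ellOne_lt.trans_le hN
    have hTN := hT.ellOne_lt.trans_le hN
    obtain ⟨ha, hb, hab, hε, hvb, hT'⟩ := id hT
    obtain ⟨hc, hd, hcd, hδ, hvd, hS'⟩ := id hS
    -- If both moves change the same coordinate, using different ones, the diagram is completed by
    -- a transvection between the two coordinates that are used.
    by_cases hac : a = c
    · subst hac
      by_cases hbd : b = d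
      · subst hbd
        have : ε = δ := by rcases hε with rfl | rfl <;> rcases hδ with rfl | rfl <;> omega
        rw [this]; exact hr
      obtain ⟨η, hη, e⟩ : ∃ η : ℤ, (η = 1 ∨ η = -1) ∧ η = -(ε * δ) :=
        ⟨_, isSign_neg (isSign_mul hε hδ), rfl⟩
      rcases le_or_gt (v b).natAbs (v d).natAbs with hle | hlt
      · have r := elem_steinberg_right hcd (Ne.symm hbd) hab hδ hη
        have e2 : -(δ * η) = ε := by
          rcases hε with rfl | rfl <;> rcases hδ with rfl | rfl <;> omega
        rw [e2] at r
        have s1 : Shortens k (act n (elem a b ε) v) d b η := by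
          refine ⟨hd, hb, Ne.symm hbd, hη, ?_, ?_⟩
          · rwa [act_elem_ne hab hε _ hab.symm]
          · rw [act_elem_ne hab hε _ hab.symm, act_elem_ne hab hε _ hcd.symm]
            rcases hε with rfl | rfl <;> rcases hδ with rfl | rfl <;> subst e <;> omega
        have s2 : Shortens k (act n (elem a d δ) v) d b η := by
          refine ⟨hd, hb, Ne.symm hbd, hη, ?_, ?_⟩
          · rwa [act_elem_ne hcd hδ _ hab.symm]
          · rw [act_elem_ne hcd hδ _ hab.symm, act_elem_ne hcd hδ _ hcd.symm]
            rcases hε with rfl | rfl <;> rcases hδ with rfl | rfl <;> subst e <;> omega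
        refine Reach.step _ _ d b η s1 (Reach.of_shortens_or (a := a) (b := d) (ε := δ) ?_ ?_)
        · by_cases h0 : act n (elem d b η) (act n (elem a b ε) v) d = 0
          · exact Or.inr ⟨ha, hd, hcd, hδ, h0⟩
          · refine Or.inl ⟨ha, hd, hcd, hδ, h0, ?_⟩
            rw [act_elem_self (Ne.symm hbd) hη, act_elem_ne (Ne.symm hbd) hη _ hcd,
              act_elem_self hab hε, act_elem_ne hab hε _ hab.symm, act_elem_ne hab hε _ hcd.symm]
            rcases hε with rfl | rfl <;> rcases hδ with rfl | rfl <;> subst e <;> omega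
        · have := IH' hSN hr s2
          rwa [← act_mul, ← mul_assoc, r, act_mul, act_mul, mul_assoc, mul_assoc] at this
      · have r := elem_steinberg_right hab hbd hcd hε hη
        have e2 : -(ε * η) = δ := by
          rcases hε with rfl | rfl <;> rcases hδ with rfl | rfl <;> omega
        rw [e2] at r
        have s1 : Shortens k (act n (elem a b ε) v) b d η := by
          refine ⟨hb, hd, hbd, hη, ?_, ?_⟩
          · rwa [act_elem_ne hab hε _ hcd.symm]
          · rw [act_elem_ne hab hε _ hab.symm, act_elem_ne hab hε _ hcd.symm]
            rcases hε with rfl | rfl <;> rcases hδ with rfl | rfl <;> subst e <;> omega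
        have s2 : Shortens k (act n (elem a d δ) v) b d η := by
          refine ⟨hb, hd, hbd, hη, ?_, ?_⟩
          · rwa [act_elem_ne hcd hδ _ hcd.symm]
          · rw [act_elem_ne hcd hδ _ hab.symm, act_elem_ne hcd hδ _ hcd.symm]
            rcases hε with rfl | rfl <;> rcases hδ with rfl | rfl <;> subst e <;> omega
        have s3 : Shortens k (act n (elem b d η) (act n (elem a d δ) v)) a b ε := by
          refine ⟨ha, hb, hab, hε, ?_, ?_⟩
          · rw [act_elem_self hbd hη, act_elem_ne hcd hδ _ hcd.symm, act_elem_ne hcd hδ _ hab.symm]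
            rcases hε with rfl | rfl <;> rcases hδ with rfl | rfl <;> subst e <;> omega
          · rw [act_elem_self hbd hη, act_elem_ne hbd hη _ hab, act_elem_self hcd hδ,
              act_elem_ne hcd hδ _ hcd.symm, act_elem_ne hcd hδ _ hab.symm]
            rcases hε with rfl | rfl <;> rcases hδ with rfl | rfl <;> subst e <;> omega
        refine Reach.step _ _ b d η s1 ?_
        have := IH' (s2.ellOne_lt.trans hSN) (IH' hSN hr s2) s3
        rwa [← act_mul, ← act_mul, ← mul_assoc, ← mul_assoc, ← r, act_mul, mul_assoc] at this
    -- If one move changes the coordinate that the other one uses, the Steinberg relation for the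
    -- three coordinates completes the diagram.
    by_cases had : a = d
    · subst had
      by_cases hbc : b = c
      · -- the two moves are in opposite directions between two coordinates of the same absolute
        -- value, and they differ by a signed permutation
        subst hbc
        have : δ = ε := by rcases hε with rfl | rfl <;> rcases hδ with rfl | rfl <;> omega
        subst this
        obtain ⟨η, hη, e⟩ := exists_braid ha hb hab hε
        have h1 := hr.perm hη
        have h2 := h1.stab hb ha hab.symm hε (by
          rw [act_perm]
          have := permCoord_apply (Equiv.swap a b) η (act n (elem b a δ) v) b
          rw [Equiv.swap_apply_right] at this
          rw [this, act_elem_self hab.symm hε]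
          have : v b + δ * v a = 0 := by rcases hε with rfl | rfl <;> omega
          rw [this, mul_zero])
        rw [e]
        rwa [← act_mul, ← act_mul, ← mul_assoc, ← mul_assoc] at h2
      · have r := elem_steinberg_left hcd hab (Ne.symm hbc) hδ hε
        obtain ⟨ζ, hζ, e⟩ : ∃ ζ : ℤ, (ζ = 1 ∨ ζ = -1) ∧ ζ = -(δ * ε) :=
          ⟨_, isSign_neg (isSign_mul hδ hε), rfl⟩
        rw [← e] at r
        have s1 : Shortens k (act n (elem c a δ) v) a b ε := by
          refine ⟨ha, hb, hab, hε, ?_, ?_⟩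
          · rwa [act_elem_ne hcd hδ _ hbc]
          · rwa [act_elem_ne hcd hδ _ hbc, act_elem_ne hcd hδ _ hac]
        refine Reach.of_shortens_or (a := c) (b := a) (ε := δ) ?_ (Reach.step _ _ c b ζ ?_ ?_)
        · by_cases h0 : act n (elem a b ε) v a = 0
          · exact Or.inr ⟨hc, ha, hcd, hδ, h0⟩
          · refine Or.inl ⟨hc, ha, hcd, hδ, h0, ?_⟩
            rw [act_elem_self hab hε, act_elem_ne hab hε _ (Ne.symm hac)]
            rcases hε with rfl | rfl <;> rcases hδ with rfl | rfl <;> omega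
        · refine ⟨hc, hb, Ne.symm hbc, hζ, ?_, ?_⟩
          · rwa [act_elem_ne hcd hδ _ hbc, act_elem_ne hab hε _ hab.symm]
          · rw [act_elem_self hcd hδ, act_elem_ne hcd hδ _ hbc, act_elem_ne hab hε _ hab.symm,
              act_elem_ne hab hε _ (Ne.symm hac), act_elem_self hab hε]
            rcases hε with rfl | rfl <;> rcases hδ with rfl | rfl <;> subst e <;> omega
        · have := IH' hSN hr s1
          rwa [← act_mul, ← mul_assoc, r, act_mul, act_mul, mul_assoc, mul_assoc] at this
    by_cases hbc : b = c
    · subst hbc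
      have r := elem_steinberg_left hab hcd had hε hδ
      obtain ⟨ζ, hζ, e⟩ : ∃ ζ : ℤ, (ζ = 1 ∨ ζ = -1) ∧ ζ = -(ε * δ) :=
        ⟨_, isSign_neg (isSign_mul hε hδ), rfl⟩
      rw [← e] at r
      have s1 : Shortens k (act n (elem a b ε) v) b d δ := by
        refine ⟨hc, hd, hcd, hδ, ?_, ?_⟩
        · rwa [act_elem_ne hab hε _ (Ne.symm had)]
        · rwa [act_elem_ne hab hε _ (Ne.symm had), act_elem_ne hab hε _ hab.symm]
      refine Reach.step _ _ b d δ s1 ?_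
      have s3 : Shortens k (act n (elem a b ε) (act n (elem b d δ) v)) a d ζ := by
        refine ⟨ha, hd, had, hζ, ?_, ?_⟩
        · rwa [act_elem_ne hab hε _ (Ne.symm had), act_elem_ne hcd hδ _ hcd.symm]
        · rw [act_elem_self hab hε, act_elem_ne hab hε _ (Ne.symm had),
            act_elem_ne hcd hδ _ hcd.symm, act_elem_ne hcd hδ _ hab, act_elem_self hcd hδ]
          rcases hε with rfl | rfl <;> rcases hδ with rfl | rfl <;> subst e <;> omega
      have key : Reach k (act n (elem a b ε) (act n (elem b d δ) v))
          (elem a b ε * (elem b d δ * x)) ∧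
          ellOne (act n (elem a b ε) (act n (elem b d δ) v)) < N := by
        by_cases h0 : act n (elem b d δ) v b = 0
        · refine ⟨hr.stab ha hb hab hε h0, ?_⟩
          rw [act_elem_eq_self hab hε h0]; exact hSN
        · have s2 : Shortens k (act n (elem b d δ) v) a b ε := by
            refine ⟨ha, hb, hab, hε, h0, ?_⟩
            rw [act_elem_ne hcd hδ _ hab, act_elem_self hcd hδ]
            rcases hε with rfl | rfl <;> rcases hδ with rfl | rfl <;> omega
          exact ⟨IH' hSN hr s2, s2.ellOne_lt.trans hSN⟩
      have := IH' key.2 key.1 s3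
      rwa [← act_mul, ← act_mul, ← mul_assoc, ← mul_assoc, ← r, act_mul, mul_assoc] at this
    · -- the remaining moves commute
      have r := (commute_elem hab hcd had hbc ε δ).eq
      have s1 : Shortens k (act n (elem a b ε) v) c d δ := by
        refine ⟨hc, hd, hcd, hδ, ?_, ?_⟩
        · rwa [act_elem_ne hab hε _ (Ne.symm had)]
        · rwa [act_elem_ne hab hε _ (Ne.symm had), act_elem_ne hab hε _ (Ne.symm hac)]
      have s2 : Shortens k (act n (elem c d δ) v) a b ε := by
        refine ⟨ha, hb, hab, hε, ?_, ?_⟩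
        · rwa [act_elem_ne hcd hδ _ hbc]
        · rwa [act_elem_ne hcd hδ _ hbc, act_elem_ne hcd hδ _ hac]
      refine Reach.step _ _ c d δ s1 ?_
      have := IH' hSN hr s2
      rwa [← act_mul, ← mul_assoc, r, act_mul, mul_assoc] at this

/-- Every transvection in the coordinates from `k` on preserves `Reach`. -/
theorem Reach.transvection {k : Fin n} {v : Fin n → ℤ} {x : MagnusQuotient n} (hr : Reach k v x)
    {a b : Fin n} {ε : ℤ} (ha : k ≤ a) (hb : k ≤ b) (hab : a ≠ b) (hε : ε = 1 ∨ ε = -1) :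
    Reach k (act n (elem a b ε) v) (elem a b ε * x) := by
  by_cases hvb : v b = 0
  · exact hr.stab ha hb hab hε hvb
  by_cases h1 : (v a + ε * v b).natAbs + (v b).natAbs = (v a).natAbs
  · exact Reach.shortens _ le_rfl hr ⟨ha, hb, hab, hε, hvb, h1⟩
  by_cases h2 : (v a + ε * v b).natAbs = (v a).natAbs + (v b).natAbs
  · refine Reach.step _ _ a b (-ε) ⟨ha, hb, hab, isSign_neg hε, ?_, ?_⟩ ?_
    · rwa [act_elem_ne hab hε _ hab.symm]
    · rw [act_elem_ne hab hε _ hab.symm, act_elem_self hab hε]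
      rcases hε with rfl | rfl <;> omega
    · rwa [elem_neg_mul_elem_mul, ← act_mul, elem_mul_elem, neg_add_cancel,
        show elem a b 0 = 1 from zpow_zero _, map_one]
  · -- the signs are opposite and `|v a| < |v b|`: pass through the transvection in the other
    -- direction, with which `elem a b ε` differs by a signed permutation
    obtain ⟨η, hη, e⟩ := exists_braid ha hb hab hε
    have s1 : Shortens k v b a ε := by
      refine ⟨hb, ha, hab.symm, hε, ?_, ?_⟩ <;> rcases hε with rfl | rfl <;> omega
    have h3 := (Reach.shortens _ le_rfl hr s1).perm hη
    refine Reach.step _ _ b a (-ε) ⟨hb, ha, hab.symm, isSign_neg hε, ?_, ?_⟩ ?_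
    · rw [act_elem_self hab hε]
      rcases hε with rfl | rfl <;> omega
    · rw [act_elem_self hab hε, act_elem_ne hab hε _ hab.symm]
      rcases hε with rfl | rfl <;> omega
    · rwa [e, mul_assoc, mul_assoc, elem_neg_mul_elem_mul, ← act_mul, mul_assoc,
        elem_neg_mul_elem_mul, act_mul]

end Reduction

/-! ### Magnus' theorem on generators of `IA_n` -/

section MagnusGenerators

variable {n : ℕ}

/-- The subgroup generated by the transvections and signed permutations of the coordinates from
`k` on. -/
def lowerSubgroup (n k : ℕ) : Subgroup (MagnusQuotient n) :=
  Subgroup.closure ({q | ∃ a b : Fin n, ∃ ε : ℤ, k ≤ a ∧ k ≤ b ∧ a ≠ b ∧ (ε = 1 ∨ ε = -1) ∧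
    q = elem a b ε} ∪ {q | ∃ σ ε, FixesBelow k σ ε ∧ q = perm σ ε})

theorem elem_mem_lowerSubgroup {k : ℕ} {a b : Fin n} {ε : ℤ} (ha : k ≤ a) (hb : k ≤ b) (hab : a ≠ b)
    (hε : ε = 1 ∨ ε = -1) : elem a b ε ∈ lowerSubgroup n k :=
  Subgroup.subset_closure (Or.inl ⟨a, b, ε, ha, hb, hab, hε, rfl⟩)

theorem perm_mem_lowerSubgroup {k : ℕ} {σ : Equiv.Perm (Fin n)} {ε : Fin n → Bool}
    (h : FixesBelow k σ ε) : perm σ ε ∈ lowerSubgroup n k :=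
  Subgroup.subset_closure (Or.inr ⟨σ, ε, h, rfl⟩)

/-- `Reach` is preserved by the simultaneous action on the vector and on the group element, so that
it holds for every element carrying `e_k` to the given vector. -/
theorem Reach.lowerSubgroup {k : Fin n} {q : MagnusQuotient n} (hq : q ∈ lowerSubgroup n k) :
    ∀ {v : Fin n → ℤ} {x : MagnusQuotient n}, Reach k v x → Reach k (act n q v) (q * x) := by
  induction hq using Subgroup.closure_induction'' with
  | one => intro v x h; simpa using h
  | mem q hq =>
    intro v x h
    rcases hq with ⟨a, b, ε, ha, hb, hab, hε, rfl⟩ | ⟨σ, ε, hσ, rfl⟩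
    · exact h.transvection ha hb hab hε
    · exact h.perm hσ
  | inv_mem q hq =>
    intro v x h
    rcases hq with ⟨a, b, ε, ha, hb, hab, hε, rfl⟩ | ⟨σ, ε, hσ, rfl⟩
    · rw [elem_inv]
      exact h.transvection ha hb hab (isSign_neg hε)
    · obtain ⟨τ, η, h', e⟩ := perm_inv hσ
      rw [e]
      exact h.perm h'
  | mul p q _ _ hp hq =>
    intro v x h
    rw [act_mul, mul_assoc]
    exact hp (hq h)

/-- The stabilizer of `e_k` is generated by its obvious elements: no shortening transvection applies
to `e_k`, so that `Reach` at `e_k` describes an element of `stabSubgroup k`. -/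
theorem mem_stabSubgroup_of_act_eq {k : Fin n} {q : MagnusQuotient n} (hq : q ∈ lowerSubgroup n k)
    (h : act n q (Pi.single k 1) = Pi.single k 1) : q ∈ stabSubgroup k := by
  have h1 : Reach k (Pi.single k 1) 1 := by
    have := Reach.base (k := k) 1 (fun _ => true) 1 1 (fun i _ => ⟨rfl, rfl⟩) one_pos
      (Subgroup.one_mem _)
    have e : perm (1 : Equiv.Perm (Fin n)) (fun _ => true) = 1 := by
      rw [perm, signedPerm_one, QuotientGroup.mk_one]
    rw [e, one_mul, ← act_perm, e, map_one] at this
    exact this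
  have h2 := Reach.lowerSubgroup hq h1
  rw [h, mul_one] at h2
  generalize hv : (Pi.single k 1 : Fin n → ℤ) = v at h2
  cases h2 with
  | base σ ε m w hσ hm hw =>
    have hk : σ k = k := by
      by_contra hne
      have := congrFun hv (σ k)
      rw [permCoord_apply, Pi.single_eq_same, Pi.single_eq_of_ne hne] at this
      rcases boolSign_eq (ε k) with h | h <;> rw [h] at this <;> omega
    have hεk : ε k = true := by
      have := congrFun hv (σ k)
      rw [permCoord_apply, Pi.single_eq_same, hk, Pi.single_eq_same] at this
      by_contra hne
      rw [Bool.not_eq_true] at hne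
      rw [hne] at this
      simp [boolSign] at this
      omega
    refine Subgroup.mul_mem _ (Subgroup.subset_closure (Or.inr ⟨σ, ε, fun i hi => ?_, rfl⟩)) hw
    rcases Nat.lt_succ_iff_lt_or_eq.1 hi with h | h
    · exact hσ i h
    · rw [Fin.ext h]; exact ⟨hk, hεk⟩
  | step _ _ a b ε hs hr =>
    exfalso
    obtain ⟨ha, hb, hab, hε, hne, habs⟩ := hs
    rw [← hv] at hne habs
    have hbk : b = k := by
      by_contra h
      rw [Pi.single_eq_of_ne h] at hne; exact hne rfl
    have hak : a ≠ k := by rintro rfl; exact hab hbk.symm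
    rw [Pi.single_eq_of_ne hak, hbk, Pi.single_eq_same] at habs
    omega

/-- The powers of `elem k b 1` if `k < b`, and the trivial homomorphism otherwise. -/
def rowFactor (k b : Fin n) : Multiplicative ℤ →* MagnusQuotient n :=
  if k < b then zpowersHom (MagnusQuotient n) (elem k b 1) else 1

theorem pairwise_commute_rowFactor (k : Fin n) :
    Pairwise fun b c => ∀ x y, Commute (rowFactor k b x) (rowFactor k c y) := by
  intro b c hbc x y
  rw [rowFactor, rowFactor]
  split_ifs with h1 h2
  · exact (commute_elem h1.ne h2.ne h2.ne h1.ne' 1 1).zpow_zpow _ _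
  · exact Commute.one_right _
  · exact Commute.one_left _
  · exact Commute.one_left _

/-- The class of the automorphism `x_b ↦ x_b x_k ^ (m b)`, `b > k`. -/
noncomputable def rowHom (k : Fin n) : (Fin n → Multiplicative ℤ) →* MagnusQuotient n :=
  MonoidHom.noncommPiCoprod (rowFactor k) (pairwise_commute_rowFactor k)

theorem rowHom_mulSingle {k b : Fin n} (h : k < b) (m : ℤ) :
    rowHom k (Pi.mulSingle b (Multiplicative.ofAdd m)) = elem k b m := by
  rw [rowHom, MonoidHom.noncommPiCoprod_mulSingle, rowFactor, if_pos h]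
  simp [elem]

theorem rowHom_eq_one {k : Fin n} {m : Fin n → Multiplicative ℤ} (h : ∀ b, k < b → m b = 1) :
    rowHom k m = 1 := by
  change Finset.univ.noncommProd (fun b => rowFactor k b (m b))
    (fun _ _ _ _ hbc => pairwise_commute_rowFactor k hbc _ _) = 1
  refine (Finset.noncommProd_eq_pow_card _ _ _ 1 fun b _ => ?_).trans (one_pow _)
  rw [rowFactor]
  split_ifs with hb
  · rw [h b hb, map_one]
  · rfl

theorem rowHom_mulSingle_of_not_lt {k b : Fin n} (h : ¬k < b) (m : Multiplicative ℤ) :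
    rowHom k (Pi.mulSingle b m) = 1 :=
  rowHom_eq_one fun c hc => Pi.mulSingle_eq_of_ne (by rintro rfl; exact h hc) _

theorem act_elem_zpow {a b : Fin n} (h : a ≠ b) (m : ℤ) (v : Fin n → ℤ) :
    act n (elem a b m) v = addCoord a b m v := by
  induction m using Int.induction_on generalizing v with
  | zero => simp [elem, addCoord]
  | succ i ih =>
    rw [← elem_mul_elem, act_mul, act_elem h (Or.inl rfl), ih]
    ext c
    by_cases hc : c = a
    · subst hc; simp only [addCoord_self, addCoord_ne h.symm]; ring
    · simp only [addCoord_ne hc]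
  | pred i ih =>
    rw [sub_eq_add_neg, ← elem_mul_elem, act_mul, act_elem h (Or.inr rfl), ih]
    ext c
    by_cases hc : c = a
    · subst hc; simp only [addCoord_self, addCoord_ne h.symm]; ring
    · simp only [addCoord_ne hc]

theorem act_rowHom (k : Fin n) (m : Fin n → Multiplicative ℤ) (v : Fin n → ℤ) :
    act n (rowHom k m) v =
      v + Pi.single k (∑ b, if k < b then (m b).toAdd * v b else 0) := by
  induction m using Pi.mulSingle_induction generalizing v with
  | one => simp
  | mul f g hf hg =>
    have e : ∀ (z : ℤ) (b : Fin n), k < b → (v + Pi.single k z : Fin n → ℤ) b = v b :=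
      fun z b h => by simp [h.ne']
    rw [map_mul, act_mul, hf, hg, add_assoc, ← Pi.single_add, ← Finset.sum_add_distrib]
    congr 2
    refine Finset.sum_congr rfl fun b _ => ?_
    split_ifs with h
    · rw [e _ _ h, Pi.mul_apply, toAdd_mul]; ring
    · simp
  | mulSingle b m =>
    by_cases h : k < b
    · obtain ⟨m, rfl⟩ := Multiplicative.ofAdd.surjective m
      rw [rowHom_mulSingle h, act_elem_zpow h.ne, addCoord, Finset.sum_eq_single b]
      · simp [h]
      · intro c _ hc; simp [hc]
      · simp
    · rw [rowHom_mulSingle_of_not_lt h, map_one, Finset.sum_eq_zero]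
      · simp
      · intro c _
        split_ifs with hc
        · have : c ≠ b := by rintro rfl; exact h hc
          simp [this]
        · rfl

theorem elem_mem_range_rowHom {k b : Fin n} (h : k < b) (m : ℤ) :
    elem k b m ∈ (rowHom k).range := ⟨_, rowHom_mulSingle h m⟩

theorem range_rowHom_conj {k : Fin n} {g : MagnusQuotient n}
    (hg : ∀ b, k < b → g * elem k b 1 * g⁻¹ ∈ (rowHom k).range) {u : MagnusQuotient n}
    (hu : u ∈ (rowHom k).range) : g * u * g⁻¹ ∈ (rowHom k).range := by
  obtain ⟨m, rfl⟩ := hu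
  induction m using Pi.mulSingle_induction with
  | one => rw [map_one, mul_one, mul_inv_cancel]; exact Subgroup.one_mem _
  | mul f f' hf hf' =>
    rw [map_mul]
    have : g * (rowHom k f * rowHom k f') * g⁻¹ =
      (g * rowHom k f * g⁻¹) * (g * rowHom k f' * g⁻¹) := by group
    rw [this]
    exact Subgroup.mul_mem _ hf hf'
  | mulSingle b m =>
    by_cases h : k < b
    · obtain ⟨m, rfl⟩ := Multiplicative.ofAdd.surjective m
      have : g * elem k b m * g⁻¹ = (g * elem k b 1 * g⁻¹) ^ m := by
        rw [conj_zpow, elem, elem, zpow_one]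
      rw [rowHom_mulSingle h, this]
      exact Subgroup.zpow_mem _ (hg b h) m
    · rw [rowHom_mulSingle_of_not_lt h, mul_one, mul_inv_cancel]; exact Subgroup.one_mem _

theorem lowerSubgroup_le_normalizer (k : Fin n) :
    lowerSubgroup n (k + 1) ≤ Subgroup.normalizer (rowHom k).range := by
  have elem_conj : ∀ (a b : Fin n) (ε : ℤ), k < a → k < b → a ≠ b → (ε = 1 ∨ ε = -1) →
      ∀ u ∈ (rowHom k).range, elem a b ε * u * (elem a b ε)⁻¹ ∈ (rowHom k).range := by
    intro a b ε ha hb hab hε u hu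
    refine range_rowHom_conj (fun c hc => ?_) hu
    by_cases hac : a = c
    · subst hac
      rw [elem_steinberg_left hc.ne hab hb.ne (Or.inl rfl) hε, mul_inv_cancel_right]
      exact Subgroup.mul_mem _ (elem_mem_range_rowHom hb _) (elem_mem_range_rowHom hc _)
    · rw [(commute_elem hab hc.ne hac hb.ne' ε 1).eq, mul_inv_cancel_right]
      exact elem_mem_range_rowHom hc _
  have perm_conj : ∀ (σ : Equiv.Perm (Fin n)) (ε : Fin n → Bool), FixesBelow (k + 1) σ ε →
      ∀ u ∈ (rowHom k).range, perm σ ε * u * (perm σ ε)⁻¹ ∈ (rowHom k).range := by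
    intro σ ε hσ u hu
    refine range_rowHom_conj (fun c hc => ?_) hu
    rw [perm_conj_elem, mul_inv_cancel_right, (hσ k (Nat.lt_succ_self _)).1]
    exact elem_mem_range_rowHom (Nat.lt_of_succ_le (hσ.le hc)) _
  rw [lowerSubgroup, Subgroup.closure_le]
  rintro _ (⟨a, b, ε, ha, hb, hab, hε, rfl⟩ | ⟨σ, ε, hσ, rfl⟩)
  · refine Subgroup.mem_normalizer_iff.2 fun u => ⟨elem_conj a b ε ha hb hab hε u, fun h => ?_⟩
    have := elem_conj a b (-ε) ha hb hab (isSign_neg hε) _ h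
    rw [← elem_inv] at this
    simpa [mul_assoc] using this
  · refine Subgroup.mem_normalizer_iff.2 fun u => ⟨perm_conj σ ε hσ u, fun h => ?_⟩
    obtain ⟨τ, η, h', e⟩ := perm_inv hσ
    have := perm_conj τ η h' _ h
    rw [← e] at this
    simpa [mul_assoc] using this

/-- The stabilizer is the semidirect product of the transvections changing the coordinate `k` and
the elements that involve only the later coordinates. -/
theorem exists_rowHom_mul {k : Fin n} {q : MagnusQuotient n} (hq : q ∈ stabSubgroup k) :
    ∃ m, ∃ h ∈ lowerSubgroup n (k + 1), q = rowHom k m * h := by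
  have hle : stabSubgroup k ≤ (rowHom k).range ⊔ lowerSubgroup n (k + 1) := by
    rw [stabSubgroup, Subgroup.closure_le]
    rintro _ (⟨a, b, ε, ha, hb, hab, hε, rfl⟩ | ⟨σ, ε, hσ, rfl⟩)
    · rcases ha.eq_or_lt with rfl | ha
      · exact Subgroup.mem_sup_left (elem_mem_range_rowHom hb _)
      · exact Subgroup.mem_sup_right (elem_mem_lowerSubgroup ha hb hab hε)
    · exact Subgroup.mem_sup_right (perm_mem_lowerSubgroup hσ)
  have h1 : q ∈ (((rowHom k).range ⊔ lowerSubgroup n (k + 1) : Subgroup _) : Set _) := hle hq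
  rw [Subgroup.coe_mul_of_right_le_normalizer_left _ _ (lowerSubgroup_le_normalizer k)] at h1
  obtain ⟨_, ⟨m, rfl⟩, h, hh, e⟩ := h1
  exact ⟨m, h, hh, e.symm⟩

theorem act_lowerSubgroup_apply {k : ℕ} {q : MagnusQuotient n} (hq : q ∈ lowerSubgroup n k)
    {i : Fin n} (hi : (i : ℕ) < k) (v : Fin n → ℤ) : act n q v i = v i := by
  induction hq using Subgroup.closure_induction'' generalizing v with
  | one => simp
  | mem q hq =>
    rcases hq with ⟨a, b, ε, ha, hb, hab, hε, rfl⟩ | ⟨σ, ε, hσ, rfl⟩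
    · exact act_elem_ne hab hε _ (by rintro rfl; omega)
    · rw [act_perm]
      have := permCoord_apply σ ε v i
      rwa [(hσ i hi).1, (hσ i hi).2, boolSign, if_pos rfl, one_mul] at this
  | inv_mem q hq =>
    rcases hq with ⟨a, b, ε, ha, hb, hab, hε, rfl⟩ | ⟨σ, ε, hσ, rfl⟩
    · rw [elem_inv]
      exact act_elem_ne hab (isSign_neg hε) _ (by rintro rfl; omega)
    · obtain ⟨τ, η, h', e⟩ := perm_inv hσ
      rw [e, act_perm]
      have := permCoord_apply τ η v i
      rwa [(h' i hi).1, (h' i hi).2, boolSign, if_pos rfl, one_mul] at this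
  | mul p q _ _ hp hq => rw [act_mul, hp, hq]

/-- An element acting trivially on `ℤ^n` that involves only the coordinates from `k` on can be
rewritten without the coordinate `k`: its factor in the range of `rowHom k` is determined by the
action. -/
theorem mem_lowerSubgroup_succ {k : Fin n} {q : MagnusQuotient n} (hq : q ∈ lowerSubgroup n k)
    (h : act n q = 1) : q ∈ lowerSubgroup n (k + 1) := by
  obtain ⟨m, p, hp, rfl⟩ := exists_rowHom_mul (mem_stabSubgroup_of_act_eq hq (by rw [h]; rfl))
  suffices hm : ∀ b, k < b → m b = 1 by rwa [rowHom_eq_one hm, one_mul]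
  intro b hb
  have h1 : act n (rowHom k m * p) (act n p⁻¹ (Pi.single b 1)) k = 0 := by
    rw [h, Module.End.one_apply,
      act_lowerSubgroup_apply (Subgroup.inv_mem _ hp) (Nat.lt_succ_self _)]
    simp [hb.ne]
  rw [← act_mul, mul_inv_cancel_right, act_rowHom, Finset.sum_eq_single b] at h1
  · simpa [hb, hb.ne] using h1
  · intro c _ hc; simp [hc]
  · simp

/-- **Magnus' theorem**, for the generating set `letters n`: transvections and signed permutations
generate `Aut(F_n)`, and modulo `magnusSubgroup n` they satisfy enough relations for the vectors
in `ℤ^n` to determine them. -/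
theorem closure_letters (n : ℕ) : Subgroup.closure (letters n) = ⊤ := by
  rw [eq_top_iff]
  intro φ _
  have key : ∀ k ≤ n,
      ((φ : MulAut (FreeGroup (Fin n))) : MagnusQuotient n) ∈ lowerSubgroup n k := by
    intro k
    induction k with
    | zero =>
      intro _
      have : ∀ θ ∈ nielsenSubgroup n, (θ : MagnusQuotient n) ∈ lowerSubgroup n 0 := by
        have : nielsenSubgroup n ≤
            (lowerSubgroup n 0).comap (QuotientGroup.mk' (magnusSubgroup n)) := by
          rw [nielsenSubgroup, Subgroup.closure_le]
          rintro _ (⟨a, b, hab, rfl⟩ | ⟨σ, ε, rfl⟩)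
          · have := elem_mem_lowerSubgroup (k := 0) (Nat.zero_le _) (Nat.zero_le _) hab (Or.inl rfl)
            rwa [elem, zpow_one] at this
          · exact perm_mem_lowerSubgroup fun i hi => absurd hi (Nat.not_lt_zero _)
        exact this
      exact this _ (by rw [nielsenSubgroup_eq_top]; trivial)
    | succ k ih =>
      intro hk
      exact mem_lowerSubgroup_succ (k := ⟨k, hk⟩) (ih (by omega)) (abAction_of_mem_IA φ.2)
  have h1 : lowerSubgroup n n = ⊥ := by
    rw [lowerSubgroup, Subgroup.closure_eq_bot_iff]
    rintro _ (⟨a, b, ε, ha, -⟩ | ⟨σ, ε, hσ, rfl⟩)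
    · exact absurd a.2 (not_lt.2 ha)
    · have e1 : σ = 1 := Equiv.ext fun i => (hσ i i.2).1
      have e2 : ε = fun _ => true := funext fun i => (hσ i i.2).2
      rw [e1, e2, perm, signedPerm_one]; rfl
  have h2 := key n le_rfl
  rw [h1, Subgroup.mem_bot, QuotientGroup.eq_one_iff] at h2
  obtain ⟨ψ, hψ, e⟩ := h2
  rwa [← Subtype.ext e]

end MagnusGenerators

/-! ### Functionals dual to the Magnus generators -/

section Johnson

variable {n : ℕ}

/-- The integral Heisenberg group: unipotent upper triangular matrices with entries `a` and `b`
next to the diagonal and `c` in the corner. -/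
@[ext]
structure Heis where
  a : ℤ
  b : ℤ
  c : ℤ

namespace Heis

instance : Mul Heis := ⟨fun g h => ⟨g.a + h.a, g.b + h.b, g.c + h.c + g.a * h.b⟩⟩
instance : One Heis := ⟨⟨0, 0, 0⟩⟩
instance : Inv Heis := ⟨fun g => ⟨-g.a, -g.b, g.a * g.b - g.c⟩⟩

theorem mul_def (g h : Heis) : g * h = ⟨g.a + h.a, g.b + h.b, g.c + h.c + g.a * h.b⟩ := rfl
theorem one_def : (1 : Heis) = ⟨0, 0, 0⟩ := rfl
theorem inv_def (g : Heis) : g⁻¹ = ⟨-g.a, -g.b, g.a * g.b - g.c⟩ := rfl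

instance : Group Heis := Group.ofLeftAxioms
  (fun g h k => by ext <;> simp only [mul_def] <;> ring)
  (fun g => by ext <;> simp [mul_def, one_def])
  (fun g => by ext <;> simp [mul_def, one_def, inv_def])

end Heis

/-- The homomorphism from the free group to the Heisenberg group sending `x_j` and `x_k` to the
two standard generators and the other basis elements to `1`. -/
def toHeis (j k : Fin n) : FreeGroup (Fin n) →* Heis :=
  FreeGroup.lift fun l => ⟨if l = j then 1 else 0, if l = k then 1 else 0, 0⟩

theorem toHeis_of (j k l : Fin n) :
    toHeis j k (FreeGroup.of l) = ⟨if l = j then 1 else 0, if l = k then 1 else 0, 0⟩ := by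
  simp [toHeis]

/-- The pair of the coordinates `a`, `b`. -/
def Heis.ab : Heis →* Multiplicative (ℤ × ℤ) where
  toFun g := Multiplicative.ofAdd (g.a, g.b)
  map_one' := rfl
  map_mul' _ _ := rfl

theorem ab_toHeis_of_mem_IA (j k : Fin n) {φ : MulAut (FreeGroup (Fin n))} (h : φ ∈ IA n)
    (w : FreeGroup (Fin n)) : Heis.ab (toHeis j k (φ w)) = Heis.ab (toHeis j k w) := by
  have := congrArg (Abelianization.lift (Heis.ab.comp (toHeis j k))) (h w)
  rwa [Abelianization.lift_apply_of, Abelianization.lift_apply_of] at this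

theorem a_toHeis_of_mem_IA (j k : Fin n) {φ : MulAut (FreeGroup (Fin n))} (h : φ ∈ IA n)
    (w : FreeGroup (Fin n)) : (toHeis j k (φ w)).a = (toHeis j k w).a :=
  congrArg (fun x => (Multiplicative.toAdd x).1) (ab_toHeis_of_mem_IA j k h w)

theorem b_toHeis_of_mem_IA (j k : Fin n) {φ : MulAut (FreeGroup (Fin n))} (h : φ ∈ IA n)
    (w : FreeGroup (Fin n)) : (toHeis j k (φ w)).b = (toHeis j k w).b :=
  congrArg (fun x => (Multiplicative.toAdd x).2) (ab_toHeis_of_mem_IA j k h w)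

/-- The change of the corner coordinate of `w` under `φ ∈ IA n`; it is a homomorphism in `w`. -/
def heisDefect (j k : Fin n) (φ : IA n) : FreeGroup (Fin n) →* Multiplicative ℤ where
  toFun w := Multiplicative.ofAdd ((toHeis j k (φ.1 w)).c - (toHeis j k w).c)
  map_one' := by simp
  map_mul' v w := by
    have h1 := a_toHeis_of_mem_IA j k φ.2 v
    have h2 := b_toHeis_of_mem_IA j k φ.2 w
    rw [← ofAdd_add]
    congr 1
    simp only [map_mul, Heis.mul_def, h1, h2]
    ring

/-- The coordinate of the Johnson homomorphism that reads off the coefficient of `x_j ∧ x_k` in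
`x_i⁻¹ φ(x_i)`. -/
def johnson (i j k : Fin n) : IA n →* Multiplicative ℤ where
  toFun φ := heisDefect j k φ (FreeGroup.of i)
  map_one' := by simp [heisDefect]
  map_mul' φ ψ := by
    have h1 : heisDefect j k φ (ψ.1 (FreeGroup.of i)) = heisDefect j k φ (FreeGroup.of i) := by
      have := congrArg (Abelianization.lift (heisDefect j k φ)) (ψ.2 (FreeGroup.of i))
      rwa [Abelianization.lift_apply_of, Abelianization.lift_apply_of] at this
    rw [← h1]
    change Multiplicative.ofAdd _ = Multiplicative.ofAdd _ * Multiplicative.ofAdd _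
    rw [← ofAdd_add]
    congr 1
    simp only [Subgroup.coe_mul, MulAut.mul_apply]
    ring

theorem johnson_apply (i j k : Fin n) (φ : IA n) : johnson i j k φ =
    Multiplicative.ofAdd ((toHeis j k (φ.1 (FreeGroup.of i))).c -
      (toHeis j k (FreeGroup.of i)).c) :=
  rfl

theorem johnson_magnusPair (i j k p q : Fin n) (hpq : p ≠ q) : johnson i j k (magnusPair p q hpq) =
    Multiplicative.ofAdd (if p = i then
      (if p = j ∧ q = k then 1 else 0) - (if q = j ∧ p = k then 1 else 0) else 0) := by
  rw [johnson_apply]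
  congr 1
  split_ifs with hp
  all_goals try subst hp
  all_goals first
    | rw [magnusPair_ne _ _ _ _ (Ne.symm hp), sub_self]
    | (rw [magnusPair_self]
       simp only [map_mul, map_inv, toHeis_of, Heis.mul_def, Heis.inv_def]
       split_ifs <;> simp_all)

theorem johnson_magnusTriple (i j k p q r : Fin n) (hpq : p ≠ q) (hpr : p ≠ r) :
    johnson i j k (magnusTriple p q r hpq hpr) =
    Multiplicative.ofAdd (if p = i then
      (if q = j ∧ r = k then 1 else 0) - (if r = j ∧ q = k then 1 else 0) else 0) := by
  rw [johnson_apply]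
  congr 1
  by_cases hp : p = i
  · subst hp
    rw [if_pos rfl, magnusTriple_self]
    simp only [map_mul, map_inv, toHeis_of, Heis.mul_def, Heis.inv_def, rcomm]
    split_ifs <;> simp_all
  · rw [if_neg hp, magnusTriple_ne _ _ _ _ _ _ (Ne.symm hp), sub_self]

/-- The functional dual to a Magnus generator. -/
theorem exists_dual {g : IA n} (hg : g ∈ magnusSet n) : ∃ d : IA n →* Multiplicative ℤ,
    d g = Multiplicative.ofAdd 1 ∧ ∀ h ∈ magnusSet n, h ≠ g → d h = 1 := by
  rcases hg with ⟨i, m, him, rfl⟩ | ⟨i, j, k, hij, hik, hjk, rfl⟩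
  · refine ⟨johnson i i m, ?_, ?_⟩
    · rw [johnson_magnusPair]
      simp [him]
    · rintro _ (⟨p, q, hpq, rfl⟩ | ⟨p, q, r, hpq, hpr, hqr, rfl⟩) hne
      · rw [johnson_magnusPair, ← ofAdd_zero]
        congr 1
        by_cases hp : p = i
        · subst hp
          have : q ≠ m := by rintro rfl; exact hne rfl
          simp [this, him]
        · simp [hp]
      · rw [johnson_magnusTriple, ← ofAdd_zero]
        congr 1
        by_cases hp : p = i
        · subst hp
          simp [hpq.symm, hpr.symm]
        · simp [hp]
  · refine ⟨johnson i j k, ?_, ?_⟩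
    · rw [johnson_magnusTriple]
      simp [hjk.ne, hjk.ne']
    · rintro _ (⟨p, q, hpq, rfl⟩ | ⟨p, q, r, hpq, hpr, hqr, rfl⟩) hne
      · rw [johnson_magnusPair, ← ofAdd_zero]
        congr 1
        by_cases hp : p = i
        · subst hp
          simp [hij, hik]
        · simp [hp]
      · rw [johnson_magnusTriple, ← ofAdd_zero]
        congr 1
        by_cases hp : p = i
        · subst hp
          have h1 : ¬(q = j ∧ r = k) := by rintro ⟨rfl, rfl⟩; exact hne rfl
          have h2 : ¬(r = j ∧ q = k) := by rintro ⟨rfl, rfl⟩; exact absurd hqr (not_lt.2 hjk.le)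
          simp [h1, h2]
        · simp [hp]

theorem card_lt_pairs (n : ℕ) :
    Fintype.card {p : Fin n × Fin n // p.1 < p.2} = n.choose 2 := by
  rw [Fintype.card_subtype, Nat.choose_two_right, ← Finset.sum_range_id]
  have : (Finset.univ.filter fun p : Fin n × Fin n => p.1 < p.2) =
      Finset.univ.biUnion fun k : Fin n => (Finset.Iio k).image fun j => (j, k) := by
    ext ⟨j, k⟩; simp
  rw [this, Finset.card_biUnion]
  · rw [Finset.sum_range]
    refine Finset.sum_congr rfl fun k _ => ?_
    rw [Finset.card_image_of_injective _ fun _ _ h => (Prod.ext_iff.1 h).1, Fin.card_Iio]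
  · intro k _ l _ hkl
    rw [Function.onFun, Finset.disjoint_left]
    rintro ⟨p, q⟩ h1 h2
    simp only [Finset.mem_image, Prod.mk.injEq] at h1 h2
    obtain ⟨_, _, _, rfl⟩ := h1
    obtain ⟨_, _, _, rfl⟩ := h2
    exact hkl rfl

/-- The Magnus generator moving `x_i` attached to the pair `j < k`. -/
def magnusGen (i j k : Fin n) : IA n :=
  if hij : i = j then (if hik : i = k then 1 else magnusPair i k hik)
  else if hik : i = k then magnusPair i j hij else magnusTriple i j k hij hik

theorem magnusGen_left {i k : Fin n} (h : i ≠ k) : magnusGen i i k = magnusPair i k h := by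
  simp [magnusGen, h]

theorem magnusGen_right {i j : Fin n} (h : i ≠ j) : magnusGen i j i = magnusPair i j h := by
  simp [magnusGen, h]

theorem magnusGen_ne {i j k : Fin n} (h : i ≠ j) (h' : i ≠ k) :
    magnusGen i j k = magnusTriple i j k h h' := by
  simp [magnusGen, h, h']

theorem johnson_magnusGen {i j k p q r : Fin n} (hjk : j < k) (hqr : q < r) :
    johnson i j k (magnusGen p q r) ≠ 1 ↔ p = i ∧ q = j ∧ r = k := by
  rw [← ofAdd_zero]
  by_cases h1 : p = q
  · subst h1
    rw [magnusGen_left hqr.ne, johnson_magnusPair, Multiplicative.ofAdd.injective.ne_iff]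
    by_cases hp : p = i
    · subst hp
      have h2 : ¬(r = j ∧ p = k) := by rintro ⟨rfl, rfl⟩; exact absurd hqr (not_lt.2 hjk.le)
      simp [h2]
    · simp [hp]
  · by_cases h2 : p = r
    · subst h2
      rw [magnusGen_right h1, johnson_magnusPair, Multiplicative.ofAdd.injective.ne_iff]
      by_cases hp : p = i
      · subst hp
        have h2 : ¬(p = j ∧ q = k) := by rintro ⟨rfl, rfl⟩; exact absurd hqr (not_lt.2 hjk.le)
        simp [h2]
      · simp [hp]
    · rw [magnusGen_ne h1 h2, johnson_magnusTriple, Multiplicative.ofAdd.injective.ne_iff]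
      by_cases hp : p = i
      · subst hp
        have h2 : ¬(r = j ∧ q = k) := by rintro ⟨rfl, rfl⟩; exact absurd hqr (not_lt.2 hjk.le)
        simp [h2]
      · simp [hp]

theorem magnusSet_eq_range : magnusSet n =
    Set.range fun x : Fin n × {p : Fin n × Fin n // p.1 < p.2} =>
      magnusGen x.1 x.2.1.1 x.2.1.2 := by
  ext g
  constructor
  · rintro (⟨i, j, hij, rfl⟩ | ⟨i, j, k, hij, hik, hjk, rfl⟩)
    · rcases lt_or_gt_of_ne hij with h | h
      · exact ⟨(i, ⟨(i, j), h⟩), magnusGen_left hij⟩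
      · exact ⟨(i, ⟨(j, i), h⟩), magnusGen_right hij⟩
    · exact ⟨(i, ⟨(j, k), hjk⟩), magnusGen_ne hij hik⟩
  · rintro ⟨⟨i, ⟨⟨j, k⟩, hjk⟩⟩, rfl⟩
    change j < k at hjk
    change magnusGen i j k ∈ _
    by_cases h1 : i = j
    · subst h1; rw [magnusGen_left hjk.ne]; exact Or.inl ⟨_, _, _, rfl⟩
    · by_cases h2 : i = k
      · subst h2; rw [magnusGen_right h1]; exact Or.inl ⟨_, _, _, rfl⟩
      · rw [magnusGen_ne h1 h2]; exact Or.inr ⟨_, _, _, _, _, hjk, rfl⟩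

theorem magnusGen_injective : Function.Injective
    fun x : Fin n × {p : Fin n × Fin n // p.1 < p.2} => magnusGen x.1 x.2.1.1 x.2.1.2 := by
  rintro ⟨i, ⟨⟨j, k⟩, hjk⟩⟩ ⟨p, ⟨⟨q, r⟩, hqr⟩⟩ h
  change magnusGen i j k = magnusGen p q r at h
  have h1 := (johnson_magnusGen (i := p) hqr hjk).1 (by
    rw [h]; exact (johnson_magnusGen hqr hqr).2 ⟨rfl, rfl, rfl⟩)
  obtain ⟨rfl, rfl, rfl⟩ := h1
  rfl

theorem ncard_magnusSet (n : ℕ) : (magnusSet n).ncard = n * n.choose 2 := by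
  rw [magnusSet_eq_range, Set.ncard_range_of_injective magnusGen_injective, Nat.card_prod,
    Nat.card_eq_fintype_card, Nat.card_eq_fintype_card, Fintype.card_fin, card_lt_pairs]

end Johnson

/-! ### Letters as short words in the Magnus generators -/

section LetterWords

variable {n : ℕ}

/-- The Magnus generators and their inverses. -/
def signedMagnusSet (n : ℕ) : Set (IA n) := magnusSet n ∪ (magnusSet n)⁻¹

theorem inv_mem_signedMagnusSet {g : IA n} (hg : g ∈ signedMagnusSet n) :
    g⁻¹ ∈ signedMagnusSet n := by
  rcases hg with hg | hg
  · exact Or.inr (by simpa using hg)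
  · exact Or.inl hg

theorem HasLen.sinv {l : ℕ} {g : IA n} (hg : HasLen (signedMagnusSet n) l g) :
    HasLen (signedMagnusSet n) l g⁻¹ :=
  HasLen.inv (fun _ => inv_mem_signedMagnusSet) hg

/-- `g` is a product of at most `l` Magnus generators and inverses of such, and abelian quotients
do not distinguish it from a Magnus generator, the inverse of one, or the identity. -/
def IsShort (l : ℕ) (g : IA n) : Prop :=
  HasLen (signedMagnusSet n) l g ∧
    ∃ h ∈ insert 1 (signedMagnusSet n), Abelianization.of g = Abelianization.of h

theorem IsShort.inv {l : ℕ} {g : IA n} (hg : IsShort l g) : IsShort l g⁻¹ := by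
  obtain ⟨h1, h, hh, e⟩ := hg
  refine ⟨h1.sinv, h⁻¹, ?_, by rw [map_inv, map_inv, e]⟩
  rcases hh with rfl | hh
  · simp
  · exact Or.inr (inv_mem_signedMagnusSet hh)

theorem IsShort.conj {l k : ℕ} {g c : IA n} (hg : IsShort l g)
    (hc : HasLen (signedMagnusSet n) k c) : IsShort (k + l + k) (c * g * c⁻¹) := by
  obtain ⟨h1, h, hh, e⟩ := hg
  exact ⟨(hc.mul h1).mul hc.sinv, h, hh, by simp [e]⟩

theorem IsShort.one (l : ℕ) : IsShort l (1 : IA n) := ⟨HasLen.one l, 1, by simp, rfl⟩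

theorem isShort_of_mem {g : IA n} (hg : g ∈ magnusSet n) : IsShort 1 g :=
  ⟨HasLen.of_mem (Or.inl hg), g, Or.inr (Or.inl hg), rfl⟩

theorem IsShort.mono {l k : ℕ} {g : IA n} (hg : IsShort l g) (h : l ≤ k) : IsShort k g :=
  ⟨hg.1.mono h, hg.2⟩

theorem isShort_conjGen (i j : Fin n) (b : Bool) : IsShort 1 (conjGen i (sgen j b)) := by
  have h1 : IsShort 1 (conjGen i (FreeGroup.of j)) := by
    by_cases h : i = j
    · subst h
      have : conjGen i (FreeGroup.of i) = 1 := by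
        ext1
        refine mulAut_ext_of fun k => ?_
        by_cases hk : k = i
        · subst hk; simp [coe_conjGen, flank_self, substHom_self]
        · simp [coe_conjGen, flank_ne hk]
      rw [this]; exact IsShort.one 1
    · rw [← magnusPair_eq i j h]
      exact isShort_of_mem (Or.inl ⟨_, _, _, rfl⟩)
  cases b
  · rw [sgen_false, map_inv]; exact h1.inv
  · exact h1

theorem isShort_commRight (i j k : Fin n) (b c : Bool) :
    IsShort 5 (commRight i (sgen j b) (sgen k c)) := by
  by_cases hj : j = i
  · subst hj
    rw [commRight_congr (u' := 1) (w' := sgen k c) (by simp [substHom_one_sgen_self]) rfl,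
      commRight_one_left]
    exact IsShort.one _
  by_cases hk : k = i
  · subst hk
    rw [commRight_congr (u' := sgen j b) (w' := 1) rfl (by simp [substHom_one_sgen_self]),
      commRight_one_right]
    exact IsShort.one _
  have h0 : IsShort 1 (commRight i (FreeGroup.of j) (FreeGroup.of k)) := by
    rcases lt_trichotomy j k with h | rfl | h
    · rw [← magnusTriple_eq i j k (Ne.symm hj) (Ne.symm hk)]
      exact isShort_of_mem (Or.inr ⟨_, _, _, _, _, h, rfl⟩)
    · rw [commRight_self]; exact IsShort.one _
    · rw [commRight_swap, ← magnusTriple_eq i k j (Ne.symm hk) (Ne.symm hj)]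
      exact (isShort_of_mem (Or.inr ⟨_, _, _, _, _, h, rfl⟩)).inv
  have h1 : IsShort 3 (commRight i (sgen j b) (FreeGroup.of k)) := by
    cases b
    · rw [sgen_false, commRight_inv_left]
      exact h0.inv.conj (isShort_conjGen i j true).1
    · exact h0.mono (by omega)
  cases c
  · rw [sgen_false, commRight_inv_right]
    exact h1.inv.conj (isShort_conjGen i k true).1
  · exact h1.mono (by omega)

/-- Letters with inverses inside their words are conjugates of Magnus generators, by the commutator
identities, and a left multiplication by a commutator is a right multiplication up to a product of
partial conjugations. -/
theorem isShort_of_mem_letters {g : IA n} (hg : g ∈ letters n) : IsShort 9 g := by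
  rcases hg with ⟨i, j, b, rfl⟩ | ⟨i, j, b, k, c, rfl⟩ | ⟨i, j, b, k, c, rfl⟩
  · exact (isShort_conjGen _ _ _).mono (by omega)
  · exact (isShort_commRight _ _ _ _ _).mono (by omega)
  · obtain ⟨h1, h, hh, e⟩ := isShort_commRight i j k b c
    rw [commLeft_eq]
    have hj := (isShort_conjGen i j b).1
    have hk := (isShort_conjGen i k c).1
    refine ⟨h1.mul (HasLen.sinv (l := 4) ?_), h, hh, ?_⟩
    · simp only [rcomm, map_mul, map_inv]
      exact ((hj.sinv.mul hk.sinv).mul hj).mul hk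
    · rw [map_mul, e, mul_eq_left, map_inv]
      simp [rcomm, mul_comm]

theorem closure_magnusSet (n : ℕ) : Subgroup.closure (magnusSet n) = ⊤ := by
  have h1 : ∀ g ∈ letters n, g ∈ Subgroup.closure (magnusSet n) := by
    intro g hg
    have := (isShort_of_mem_letters hg).1.mem_closure
    rwa [signedMagnusSet, Subgroup.closure_union, Subgroup.closure_inv, sup_idem] at this
  rw [eq_top_iff, ← closure_letters, Subgroup.closure_le]
  exact h1

end LetterWords

/-! ### Anchors and good elements -/

section Good

variable {G : Type*} [Group G]

/-- `y` is a word of length at most `L` on which the character `χ` takes at least half of the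
value `M`. -/
def IsAnchor (S : Set G) (χ : G →* Multiplicative ℤ) (M : ℤ) (L : ℕ) (y : G) : Prop :=
  HasLen S L y ∧ M ≤ 2 * |(χ y).toAdd|

/-- Anchors `y` that can be reached from `y₀` by a chain of anchors in which consecutive terms
commute. -/
def Linked (S : Set G) (χ : G →* Multiplicative ℤ) (M : ℤ) (L : ℕ) : G → G → Prop :=
  Relation.ReflTransGen fun u v => Commute u v ∧ IsAnchor S χ M L v

/-- Products, of total length at most `ℓ`, of elements each of which commutes with some anchor
linked to `y₀`. -/
inductive Good (S : Set G) (χ : G →* Multiplicative ℤ) (M : ℤ) (L : ℕ) (y₀ : G) : ℕ → G → Prop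
  | basic {ℓ : ℕ} {u y : G} (hy : Linked S χ M L y₀ y) (hc : Commute u y) (hu : HasLen S ℓ u) :
      Good S χ M L y₀ ℓ u
  | mul {ℓ m : ℕ} {u v : G} (hu : Good S χ M L y₀ ℓ u) (hv : Good S χ M L y₀ m v) :
      Good S χ M L y₀ (ℓ + m) (u * v)

variable {S : Set G} {χ : G →* Multiplicative ℤ} {M : ℤ} {L : ℕ} {y₀ : G}

theorem Linked.single {y y' : G} (hc : Commute y y') (hy : IsAnchor S χ M L y') :
    Linked S χ M L y y' := Relation.ReflTransGen.single ⟨hc, hy⟩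

theorem Good.mono {ℓ m : ℕ} {u : G} (hu : Good S χ M L y₀ ℓ u) (h : ℓ ≤ m) :
    Good S χ M L y₀ m u := by
  induction hu generalizing m with
  | basic hy hc hu => exact .basic hy hc (hu.mono h)
  | @mul ℓ k u v hu hv ih1 ih2 =>
    have := (ih1 (le_refl ℓ)).mul (ih2 (m := m - ℓ) (by omega))
    rwa [Nat.add_sub_cancel' (by omega)] at this

theorem Good.one (ℓ : ℕ) : Good S χ M L y₀ ℓ 1 :=
  .basic Relation.ReflTransGen.refl (Commute.one_left _) (HasLen.one ℓ)

theorem Good.inv (hS : ∀ x ∈ S, x⁻¹ ∈ S) {ℓ : ℕ} {u : G} (hu : Good S χ M L y₀ ℓ u) :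
    Good S χ M L y₀ ℓ u⁻¹ := by
  induction hu with
  | basic hy hc hu => exact .basic hy hc.inv_left (hu.inv hS)
  | mul hu hv ih1 ih2 =>
    rw [mul_inv_rev]
    exact (ih2.mul ih1).mono (by omega)

theorem Good.of_linked {y₁ : G} (h : Linked S χ M L y₀ y₁) {ℓ : ℕ} {u : G}
    (hu : Good S χ M L y₁ ℓ u) : Good S χ M L y₀ ℓ u := by
  induction hu with
  | basic hy hc hu => exact .basic (h.trans hy) hc hu
  | mul hu hv ih1 ih2 => exact ih1.mul ih2

theorem Good.of_hasLen {T : Set G} {ℓ m : ℕ} (hT : ∀ x ∈ T, Good S χ M L y₀ ℓ x) {u : G}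
    (hu : HasLen T m u) : Good S χ M L y₀ (m * ℓ) u := by
  obtain ⟨l, h1, h2, rfl⟩ := hu
  refine Good.mono (ℓ := l.length * ℓ) ?_ (Nat.mul_le_mul_right _ h2)
  clear h2
  induction l with
  | nil => simpa using Good.one _
  | cons x l ih =>
    rw [List.prod_cons, List.length_cons]
    have := (hT x (h1 x (by simp))).mul (ih fun y hy => h1 y (by simp [hy]))
    exact this.mono (by rw [Nat.succ_mul]; omega)

theorem IsAnchor.mono {L' : ℕ} {y : G} (hy : IsAnchor S χ M L y) (h : L ≤ L') :
    IsAnchor S χ M L' y := ⟨hy.1.mono h, hy.2⟩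

theorem Linked.mono {L' : ℕ} {y y' : G} (hy : Linked S χ M L y y') (h : L ≤ L') :
    Linked S χ M L' y y' :=
  Relation.ReflTransGen.mono (fun _ _ h' => ⟨h'.1, h'.2.mono h⟩) _ _ hy

theorem Good.mono_left {L' ℓ : ℕ} {u : G} (hu : Good S χ M L y₀ ℓ u) (h : L ≤ L') :
    Good S χ M L' y₀ ℓ u := by
  induction hu with
  | basic hy hc hu => exact .basic (hy.mono h) hc hu
  | mul hu hv ih1 ih2 => exact ih1.mul ih2

/-- Goodness is carried along homomorphisms, such as changes of the basis of the free group, that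
increase word lengths by a bounded factor. -/
theorem Good.map {H : Type*} [Group H] {S' : Set H} (f : G →* H) {χ' : H →* Multiplicative ℤ}
    {c : ℕ} (hf : ∀ x ∈ S, HasLen S' c (f x)) {ℓ : ℕ} {u : G}
    (hu : Good S (χ'.comp f) M L y₀ ℓ u) : Good S' χ' M (c * L) (f y₀) (c * ℓ) (f u) := by
  have key : ∀ y y', Linked S (χ'.comp f) M L y y' → Linked S' χ' M (c * L) (f y) (f y') := by
    intro y y' h
    refine Relation.ReflTransGen.lift f ?_ _ _ h
    rintro x z ⟨h1, h2, h3⟩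
    exact ⟨h1.map f, h2.map f hf, h3⟩
  induction hu with
  | basic hy hc hu => exact .basic (key _ _ hy) (hc.map f) (hu.map f hf)
  | mul hu hv ih1 ih2 =>
    rw [map_mul, Nat.mul_add]
    exact ih1.mul ih2

end Good

/-! ### Commuting automorphisms -/

section Commutation

variable {n : ℕ}

/-- The word `w` does not involve `x_p`. -/
def Free (p : Fin n) (w : FreeGroup (Fin n)) : Prop := substHom p 1 w = w

theorem Free.mul {p : Fin n} {u w : FreeGroup (Fin n)} (hu : Free p u) (hw : Free p w) :
    Free p (u * w) := by rw [Free, map_mul, hu, hw]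

theorem Free.inv {p : Fin n} {u : FreeGroup (Fin n)} (hu : Free p u) : Free p u⁻¹ := by
  rw [Free, map_inv, hu]

theorem free_sgen {p q : Fin n} (h : q ≠ p) (b : Bool) : Free p (sgen q b) :=
  substHom_sgen_ne h b 1

theorem free_of {p q : Fin n} (h : q ≠ p) : Free p (FreeGroup.of q) := substHom_ne h 1

theorem Free.rcomm {p : Fin n} {u w : FreeGroup (Fin n)} (hu : Free p u) (hw : Free p w) :
    Free p (rcomm u w) := ((hu.inv.mul hw.inv).mul hu).mul hw

/-- The element `g` of `IA_n` fixes the word `w`. -/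
def Fixes (g : IA n) (w : FreeGroup (Fin n)) : Prop := g.1 w = w

theorem Fixes.mul {g : IA n} {u w : FreeGroup (Fin n)} (hu : Fixes g u) (hw : Fixes g w) :
    Fixes g (u * w) := by rw [Fixes, map_mul, hu, hw]

theorem Fixes.inv {g : IA n} {u : FreeGroup (Fin n)} (hu : Fixes g u) : Fixes g u⁻¹ := by
  rw [Fixes, map_inv, hu]

theorem Fixes.rcomm {g : IA n} {u w : FreeGroup (Fin n)} (hu : Fixes g u) (hw : Fixes g w) :
    Fixes g (rcomm u w) := ((hu.inv.mul hw.inv).mul hu).mul hw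

theorem Fixes.sgen {g : IA n} {k : Fin n} (h : Fixes g (FreeGroup.of k)) (b : Bool) :
    Fixes g (sgen k b) := by
  cases b
  · exact h.inv
  · exact h

theorem Fixes.comp {g h : IA n} {w : FreeGroup (Fin n)} (hg : Fixes g w) (hh : Fixes h w) :
    Fixes (g * h) w := by
  change g.1 (h.1 w) = w
  rw [hh, hg]

theorem apply_conjGen_self {p : Fin n} {w : FreeGroup (Fin n)} (hw : Free p w) :
    (conjGen p w).1 (FreeGroup.of p) = w⁻¹ * FreeGroup.of p * w := by
  rw [coe_conjGen, flank_self, hw, hw.inv]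

theorem apply_commRight_self {p : Fin n} {u w : FreeGroup (Fin n)} (hu : Free p u)
    (hw : Free p w) : (commRight p u w).1 (FreeGroup.of p) = FreeGroup.of p * rcomm u w := by
  rw [coe_commRight, flank_self, hu.rcomm hw, map_one, one_mul]

theorem apply_commLeft_self {p : Fin n} {u w : FreeGroup (Fin n)} (hu : Free p u)
    (hw : Free p w) : (commLeft p u w).1 (FreeGroup.of p) = rcomm u w * FreeGroup.of p := by
  rw [coe_commLeft, flank_self, hu.rcomm hw, map_one, mul_one]

theorem fixes_conjGen {p k : Fin n} (h : k ≠ p) (w : FreeGroup (Fin n)) :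
    Fixes (conjGen p w) (FreeGroup.of k) := flank_ne h _ _

theorem fixes_commRight {p k : Fin n} (h : k ≠ p) (u w : FreeGroup (Fin n)) :
    Fixes (commRight p u w) (FreeGroup.of k) := flank_ne h _ _

theorem fixes_commLeft {p k : Fin n} (h : k ≠ p) (u w : FreeGroup (Fin n)) :
    Fixes (commLeft p u w) (FreeGroup.of k) := flank_ne h _ _

theorem fixes_conjGen_of_free {p : Fin n} {v : FreeGroup (Fin n)} (hv : Free p v)
    (w : FreeGroup (Fin n)) : Fixes (conjGen p w) v := by
  rw [Fixes, ← hv]; exact flank_erase _ _ _ _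

theorem fixes_commRight_of_free {p : Fin n} {v : FreeGroup (Fin n)} (hv : Free p v)
    (u w : FreeGroup (Fin n)) : Fixes (commRight p u w) v := by
  rw [Fixes, ← hv]; exact flank_erase _ _ _ _

theorem fixes_commLeft_of_free {p : Fin n} {v : FreeGroup (Fin n)} (hv : Free p v)
    (u w : FreeGroup (Fin n)) : Fixes (commLeft p u w) v := by
  rw [Fixes, ← hv]; exact flank_erase _ _ _ _

/-- A criterion for commutation: every basis element is fixed by one of the two automorphisms,
which also fixes its image under the other. -/
theorem commute_of_forall {g h : IA n} (H : ∀ k : Fin n,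
    Fixes g (FreeGroup.of k) ∧ Fixes g (h.1 (FreeGroup.of k)) ∨
    Fixes h (FreeGroup.of k) ∧ Fixes h (g.1 (FreeGroup.of k))) : Commute g h := by
  refine Subtype.ext (mulAut_ext_of fun k => ?_)
  change g.1 (h.1 _) = h.1 (g.1 _)
  rcases H k with ⟨h1, h2⟩ | ⟨h1, h2⟩
  · rw [h2, h1]
  · rw [h2, h1]

theorem commute_conjGen {g : IA n} {p : Fin n} {w : FreeGroup (Fin n)}
    (hp : Fixes g (FreeGroup.of p)) (hw : Fixes g w) (fw : Free p w)
    (hg : ∀ k ≠ p, Free p (g.1 (FreeGroup.of k))) : Commute (conjGen p w) g := by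
  refine commute_of_forall fun k => ?_
  by_cases hk : k = p
  · subst hk
    refine Or.inr ⟨hp, ?_⟩
    rw [apply_conjGen_self fw]
    exact (hw.inv.mul hp).mul hw
  · exact Or.inl ⟨fixes_conjGen hk _, fixes_conjGen_of_free (hg k hk) _⟩

theorem commute_commRight {g : IA n} {p : Fin n} {u w : FreeGroup (Fin n)}
    (hp : Fixes g (FreeGroup.of p)) (hu : Fixes g u) (hw : Fixes g w) (fu : Free p u)
    (fw : Free p w) (hg : ∀ k ≠ p, Free p (g.1 (FreeGroup.of k))) :
    Commute (commRight p u w) g := by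
  refine commute_of_forall fun k => ?_
  by_cases hk : k = p
  · subst hk
    refine Or.inr ⟨hp, ?_⟩
    rw [apply_commRight_self fu fw]
    exact hp.mul (hu.rcomm hw)
  · exact Or.inl ⟨fixes_commRight hk _ _, fixes_commRight_of_free (hg k hk) _ _⟩

theorem commute_commLeft {g : IA n} {p : Fin n} {u w : FreeGroup (Fin n)}
    (hp : Fixes g (FreeGroup.of p)) (hu : Fixes g u) (hw : Fixes g w) (fu : Free p u)
    (fw : Free p w) (hg : ∀ k ≠ p, Free p (g.1 (FreeGroup.of k))) : Commute (commLeft p u w) g := by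
  refine commute_of_forall fun k => ?_
  by_cases hk : k = p
  · subst hk
    refine Or.inr ⟨hp, ?_⟩
    rw [apply_commLeft_self fu fw]
    exact (hu.rcomm hw).mul hp
  · exact Or.inl ⟨fixes_commLeft hk _ _, fixes_commLeft_of_free (hg k hk) _ _⟩

theorem commute_commRight_commLeft (p : Fin n) {u w u' w' : FreeGroup (Fin n)} :
    Commute (commRight p u w) (commLeft p u' w') := by
  refine Subtype.ext ?_
  change flank p _ _ * flank p _ _ = flank p _ _ * flank p _ _
  simp [flank_mul]

theorem free_conjGen_apply {a p k : Fin n} {w : FreeGroup (Fin n)} (hp : p ≠ a)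
    (hw : Free p w) (ha : Free a w) (hk : k ≠ p) :
    Free p ((conjGen a w).1 (FreeGroup.of k)) := by
  by_cases hka : k = a
  · subst hka
    rw [apply_conjGen_self ha]
    exact (hw.inv.mul (free_of hk)).mul hw
  · rw [fixes_conjGen hka]; exact free_of hk

theorem free_commRight_apply {a p k : Fin n} {u w : FreeGroup (Fin n)} (hp : p ≠ a)
    (hu : Free p u) (hw : Free p w) (hau : Free a u) (haw : Free a w) (hk : k ≠ p) :
    Free p ((commRight a u w).1 (FreeGroup.of k)) := by
  by_cases hka : k = a
  · subst hka
    rw [apply_commRight_self hau haw]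
    exact (free_of hk).mul (hu.rcomm hw)
  · rw [fixes_commRight hka]; exact free_of hk

/-- The automorphism `t ↦ t [u, w]`, where `t` is the letter `x_i` or `x_i⁻¹`. -/
def commMove (i : Fin n) (b : Bool) (u w : FreeGroup (Fin n)) : IA n :=
  if b then commRight i u w else commLeft i w u

theorem commMove_true (i : Fin n) (u w : FreeGroup (Fin n)) :
    commMove i true u w = commRight i u w := rfl

theorem commMove_false (i : Fin n) (u w : FreeGroup (Fin n)) :
    commMove i false u w = commLeft i w u := rfl

theorem apply_commMove_self {i : Fin n} {u w : FreeGroup (Fin n)} (hu : Free i u)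
    (hw : Free i w) (b : Bool) :
    (commMove i b u w).1 (sgen i b) = sgen i b * rcomm u w := by
  cases b
  · rw [commMove_false, sgen_false, map_inv, apply_commLeft_self hw hu]
    simp [rcomm, mul_assoc]
  · exact apply_commRight_self hu hw

theorem fixes_commMove {i k : Fin n} (h : k ≠ i) (b : Bool) (u w : FreeGroup (Fin n)) :
    Fixes (commMove i b u w) (FreeGroup.of k) := by
  cases b
  · exact fixes_commLeft h _ _
  · exact fixes_commRight h _ _

/-- For words `u` not involving `x_a`, `x_i`, the automorphism `x_a ↦ [u, x_c] x_a`,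
`t ↦ t [u, x_c]⁻¹`, with `t` the letter `x_i` or `x_i⁻¹`. It fixes the word `t x_a`. -/
def pivot (a i : Fin n) (b : Bool) (u : FreeGroup (Fin n)) (c : Fin n) : IA n :=
  commLeft a u (FreeGroup.of c) * commMove i b (FreeGroup.of c) u

variable {a i c : Fin n} {u : FreeGroup (Fin n)}

theorem fixes_pivot {k : Fin n} (ha : k ≠ a) (hi : k ≠ i) (b : Bool) :
    Fixes (pivot a i b u c) (FreeGroup.of k) :=
  (fixes_commLeft ha _ _).comp (fixes_commMove hi _ _ _)

theorem apply_pivot_left (hia : i ≠ a) (hca : c ≠ a) (hua : Free a u) (b : Bool) :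
    (pivot a i b u c).1 (FreeGroup.of a) = rcomm u (FreeGroup.of c) * FreeGroup.of a := by
  change (commLeft a _ _).1 ((commMove i b _ _).1 _) = _
  rw [fixes_commMove hia.symm, apply_commLeft_self hua (free_of hca)]

theorem apply_pivot_right (hia : i ≠ a) (hca : c ≠ a) (hci : c ≠ i) (hua : Free a u)
    (hui : Free i u) (b : Bool) :
    (pivot a i b u c).1 (sgen i b) = sgen i b * rcomm (FreeGroup.of c) u := by
  change (commLeft a _ _).1 ((commMove i b _ _).1 _) = _
  rw [apply_commMove_self (free_of hci) hui]
  exact fixes_commLeft_of_free ((free_sgen hia b).mul ((free_of hca).rcomm hua)) _ _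

theorem fixes_pivot_mul (hia : i ≠ a) (hca : c ≠ a) (hci : c ≠ i) (hua : Free a u)
    (hui : Free i u) (b : Bool) : Fixes (pivot a i b u c) (sgen i b * FreeGroup.of a) := by
  rw [Fixes, map_mul, apply_pivot_right hia hca hci hua hui, apply_pivot_left hia hca hua]
  simp [rcomm, mul_assoc]

/-- A property of words closed under multiplication and inversion that holds for the constituents
of `pivot` holds for the images of the basis elements. -/
theorem pivot_apply_induction {P : FreeGroup (Fin n) → Prop} (mul : ∀ v w, P v → P w → P (v * w))
    (inv : ∀ v, P v → P v⁻¹) (hia : i ≠ a) (hca : c ≠ a) (hci : c ≠ i) (hua : Free a u)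
    (hui : Free i u) (b : Bool) {k : Fin n} (hk : P (FreeGroup.of k)) (hu : P u)
    (hc : P (FreeGroup.of c)) : P ((pivot a i b u c).1 (FreeGroup.of k)) := by
  have hr : ∀ v w, P v → P w → P (rcomm v w) := fun v w hv hw =>
    mul _ _ (mul _ _ (mul _ _ (inv _ hv) (inv _ hw)) hv) hw
  by_cases hka : k = a
  · subst hka
    rw [apply_pivot_left hia hca hua]
    exact mul _ _ (hr _ _ hu hc) hk
  by_cases hki : k = i
  · subst hki
    have h := apply_pivot_right hia hca hci hua hui b
    cases b
    · rw [sgen_false, map_inv, inv_eq_iff_eq_inv] at h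
      rw [h]
      exact inv _ (mul _ _ (inv _ hk) (hr _ _ hc hu))
    · rw [sgen_true] at h
      rw [h]
      exact mul _ _ hk (hr _ _ hc hu)
  · rw [fixes_pivot hka hki]; exact hk

theorem free_pivot_apply (hia : i ≠ a) (hca : c ≠ a) (hci : c ≠ i) (hua : Free a u)
    (hui : Free i u) (b : Bool) {p k : Fin n} (hpu : Free p u) (hpc : p ≠ c) (hk : k ≠ p) :
    Free p ((pivot a i b u c).1 (FreeGroup.of k)) :=
  pivot_apply_induction (P := Free p) (fun _ _ => Free.mul) (fun _ => Free.inv)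
    hia hca hci hua hui b
    (free_of hk) hpu (free_of hpc.symm)

theorem fixes_pivot_apply (hia : i ≠ a) (hca : c ≠ a) (hci : c ≠ i) (hua : Free a u)
    (hui : Free i u) (b : Bool) {g : IA n} {k : Fin n} (hk : Fixes g (FreeGroup.of k))
    (hgu : Fixes g u) (hgc : Fixes g (FreeGroup.of c)) :
    Fixes g ((pivot a i b u c).1 (FreeGroup.of k)) :=
  pivot_apply_induction (P := Fixes g) (fun _ _ => Fixes.mul) (fun _ => Fixes.inv) hia hca hci hua
    hui b hk hgu hgc

/-- If `s` maps `x_b` to `e⁻¹ x_b` and `E` maps the letter `t` to `t e`, then `E s` fixes `t x_b`.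
It therefore commutes with any `Y` fixing `x_j`, `x_b` and `e` whose remaining values are words in
`t x_b` and basis elements other than `x_j` and `x_b`. -/
theorem commute_mul_of_slide {Y E s : IA n} {b j : Fin n} {γ : Bool} {e : FreeGroup (Fin n)}
    (hs : ∀ k ≠ b, Fixes s (FreeGroup.of k)) (hsb : s.1 (FreeGroup.of b) = e⁻¹ * FreeGroup.of b)
    (hE : ∀ k ≠ j, Fixes E (FreeGroup.of k)) (hEj : E.1 (sgen j γ) = sgen j γ * e)
    (hEe : Fixes E e) (hjb : j ≠ b) (hYj : Fixes Y (FreeGroup.of j))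
    (hYb : Fixes Y (FreeGroup.of b))
    (hYe : Fixes Y e)
    (hY : ∀ g : IA n, (∀ k, k ≠ j → k ≠ b → Fixes g (FreeGroup.of k)) →
      Fixes g (sgen j γ * FreeGroup.of b) → ∀ k, k ≠ j → k ≠ b → Fixes g (Y.1 (FreeGroup.of k))) :
    Commute (E * s) Y := by
  have hfix : ∀ k, k ≠ j → k ≠ b → Fixes (E * s) (FreeGroup.of k) := fun k h1 h2 =>
    (hE k h1).comp (hs k h2)
  have hzb : (E * s).1 (FreeGroup.of b) = e⁻¹ * FreeGroup.of b := by
    change E.1 (s.1 _) = _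
    rw [hsb, map_mul, hE b hjb.symm, hEe.inv]
  have hzj : (E * s).1 (sgen j γ) = sgen j γ * e := by
    change E.1 (s.1 _) = _
    rw [(hs j hjb).sgen γ, hEj]
  have hw : Fixes (E * s) (sgen j γ * FreeGroup.of b) := by
    rw [Fixes, map_mul, hzb, hzj]; group
  refine commute_of_forall fun k => ?_
  by_cases hkj : k = j
  · subst hkj
    refine Or.inr ⟨hYj, ?_⟩
    cases γ
    · rw [sgen_false, map_inv, inv_eq_iff_eq_inv] at hzj
      rw [hzj]
      exact (hYj.inv.mul hYe).inv
    · rw [sgen_true] at hzj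
      rw [hzj]
      exact hYj.mul hYe
  by_cases hkb : k = b
  · subst hkb
    refine Or.inr ⟨hYb, ?_⟩
    rw [hzb]
    exact hYe.inv.mul hYb
  · exact Or.inl ⟨hfix k hkj hkb, hY _ hfix hw k hkj hkb⟩

end Commutation

/-! ### Letters with a given target, and the sliding argument -/

section TargetLetters

variable {n : ℕ}

/-- The letters that move only the basis element `x_p`. -/
def targetLetters (p : Fin n) : Set (IA n) :=
  {g | (∃ j b, g = conjGen p (sgen j b)) ∨
    (∃ j b k c, g = commRight p (sgen j b) (sgen k c)) ∨
    (∃ j b k c, g = commLeft p (sgen j b) (sgen k c))}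

theorem targetLetters_subset (p : Fin n) : targetLetters p ⊆ letters n := by
  rintro g (⟨j, b, rfl⟩ | ⟨j, b, k, c, rfl⟩ | ⟨j, b, k, c, rfl⟩)
  exacts [conjGen_mem_letters _ _ _, commRight_mem_letters _ _ _ _ _,
    commLeft_mem_letters _ _ _ _ _]

theorem exists_mem_targetLetters {g : IA n} (hg : g ∈ letters n) : ∃ p, g ∈ targetLetters p := by
  rcases hg with ⟨i, j, b, rfl⟩ | ⟨i, j, b, k, c, rfl⟩ | ⟨i, j, b, k, c, rfl⟩
  exacts [⟨i, Or.inl ⟨_, _, rfl⟩⟩, ⟨i, Or.inr (Or.inl ⟨_, _, _, _, rfl⟩)⟩,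
    ⟨i, Or.inr (Or.inr ⟨_, _, _, _, rfl⟩)⟩]

theorem HasLen.subset {G : Type*} [Group G] {S T : Set G} (h : S ⊆ T) {l : ℕ} {g : G}
    (hg : HasLen S l g) : HasLen T l g := by
  obtain ⟨L, h1, h2⟩ := hg
  exact ⟨L, fun x hx => h (h1 x hx), h2⟩

theorem HasLen.letters {p : Fin n} {l : ℕ} {g : IA n} (hg : HasLen (targetLetters p) l g) :
    HasLen (_root_.letters n) l g := hg.subset (targetLetters_subset p)

theorem inv_mem_targetLetters {p : Fin n} {g : IA n} (hg : g ∈ targetLetters p) :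
    g⁻¹ ∈ targetLetters p := by
  rcases hg with ⟨j, b, rfl⟩ | ⟨j, b, k, c, rfl⟩ | ⟨j, b, k, c, rfl⟩
  · rw [← map_inv, sgen_inv]; exact Or.inl ⟨_, _, rfl⟩
  · rw [← commRight_swap]; exact Or.inr (Or.inl ⟨_, _, _, _, rfl⟩)
  · rw [← commLeft_swap]; exact Or.inr (Or.inr ⟨_, _, _, _, rfl⟩)

theorem HasLen.tinv {p : Fin n} {l : ℕ} {g : IA n} (hg : HasLen (targetLetters p) l g) :
    HasLen (targetLetters p) l g⁻¹ := HasLen.inv (fun _ => inv_mem_targetLetters) hg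

/-- A word consisting of one or two letters. -/
def IsShortWord (u : FreeGroup (Fin n)) : Prop :=
  ∃ p b q c, u = sgen p b ∨ u = sgen p b * sgen q c

theorem isShortWord_sgen (p : Fin n) (b : Bool) : IsShortWord (sgen p b) :=
  ⟨p, b, p, b, Or.inl rfl⟩

theorem isShortWord_of (p : Fin n) : IsShortWord (FreeGroup.of p) := isShortWord_sgen p true

theorem isShortWord_mul (p : Fin n) (b : Bool) (q : Fin n) :
    IsShortWord (sgen p b * FreeGroup.of q) := ⟨p, b, q, true, Or.inr rfl⟩

theorem commLeft_mul_left (i : Fin n) (u v w : FreeGroup (Fin n)) :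
    commLeft i (u * v) w = commLeft i v w * ((conjGen i v)⁻¹ * commLeft i u w * conjGen i v) := by
  ext1
  simp only [coe_commLeft, coe_conjGen, Subgroup.coe_inv, Subgroup.coe_mul, flank_inv, flank_mul,
    rcomm]
  congr 1 <;> group

theorem hasLen_target_conjGen (p j : Fin n) (b : Bool) :
    HasLen (targetLetters p) 1 (conjGen p (sgen j b)) := .of_mem (Or.inl ⟨_, _, rfl⟩)

theorem IsShortWord.hasLen_conjGen {u : FreeGroup (Fin n)} (hu : IsShortWord u) (p : Fin n) :
    HasLen (targetLetters p) 2 (conjGen p u) := by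
  obtain ⟨j, b, k, c, rfl | rfl⟩ := hu
  · exact (hasLen_target_conjGen p j b).mono (by omega)
  · rw [map_mul]
    exact (hasLen_target_conjGen p j b).mul (hasLen_target_conjGen p k c)

theorem IsShortWord.hasLen_commRight {u : FreeGroup (Fin n)} (hu : IsShortWord u) (p k : Fin n)
    (d : Bool) : HasLen (targetLetters p) 4 (commRight p u (sgen k d)) := by
  have h : ∀ j b, HasLen (targetLetters p) 1 (commRight p (sgen j b) (sgen k d)) := fun j b =>
    .of_mem (Or.inr (Or.inl ⟨_, _, _, _, rfl⟩))
  obtain ⟨j, b, q, c, rfl | rfl⟩ := hu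
  · exact (h j b).mono (by omega)
  · rw [commRight_mul_left]
    exact (((hasLen_target_conjGen p q c).tinv.mul (h j b)).mul (hasLen_target_conjGen p q c)).mul
      (h q c)

theorem IsShortWord.hasLen_commLeft {u : FreeGroup (Fin n)} (hu : IsShortWord u) (p k : Fin n)
    (d : Bool) : HasLen (targetLetters p) 4 (commLeft p u (sgen k d)) := by
  have h : ∀ j b, HasLen (targetLetters p) 1 (commLeft p (sgen j b) (sgen k d)) := fun j b =>
    .of_mem (Or.inr (Or.inr ⟨_, _, _, _, rfl⟩))
  obtain ⟨j, b, q, c, rfl | rfl⟩ := hu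
  · exact (h j b).mono (by omega)
  · rw [commLeft_mul_left]
    exact (h q c).mul
      (((hasLen_target_conjGen p q c).tinv.mul (h j b)).mul (hasLen_target_conjGen p q c))

theorem IsShortWord.hasLen_commMove {u : FreeGroup (Fin n)} (hu : IsShortWord u) (p k : Fin n)
    (d b : Bool) : HasLen (targetLetters p) 4 (commMove p b (sgen k d) u) := by
  cases b
  · exact hu.hasLen_commLeft p k d
  · rw [commMove_true, commRight_swap]
    exact (hu.hasLen_commRight p k d).tinv

theorem IsShortWord.hasLen_pivot {u : FreeGroup (Fin n)} (hu : IsShortWord u) (a i c : Fin n)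
    (b : Bool) : HasLen (letters n) 8 (pivot a i b u c) :=
  (hu.hasLen_commLeft a c true).letters.mul (hu.hasLen_commMove i c true b).letters

variable {χ : IA n →* Multiplicative ℤ}

theorem chi_commLeft (χ : IA n →* Multiplicative ℤ) (i : Fin n) (u w : FreeGroup (Fin n)) :
    χ (commLeft i u w) = χ (commRight i u w) := by
  rw [commLeft_eq, map_mul, map_inv, mul_eq_left, inv_eq_one]
  simp only [rcomm, map_mul, map_inv]
  rw [mul_comm (χ _)⁻¹, mul_assoc, mul_assoc, inv_mul_cancel_left, inv_mul_cancel]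

theorem chi_commRight_mul_left (χ : IA n →* Multiplicative ℤ) (i : Fin n)
    (u v w : FreeGroup (Fin n)) :
    χ (commRight i (u * v) w) = χ (commRight i u w) * χ (commRight i v w) := by
  rw [commRight_mul_left]
  simp only [map_mul, map_inv]
  rw [mul_comm (χ (conjGen i v))⁻¹, inv_mul_cancel_right]

theorem chi_commRight_inv_left (χ : IA n →* Multiplicative ℤ) (i : Fin n)
    (u w : FreeGroup (Fin n)) : χ (commRight i u⁻¹ w) = (χ (commRight i u w))⁻¹ := by
  rw [commRight_inv_left, map_mul, map_mul, mul_comm, map_inv, inv_mul_cancel_left, map_inv]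

theorem abs_le_abs_sub_or (x y : ℤ) : |x| ≤ |x - y| ∨ |x| ≤ |x + y| := by
  rcases abs_cases x with h1 | h1 <;> rcases abs_cases (x - y) with h2 | h2 <;>
    rcases abs_cases (x + y) with h3 | h3 <;> omega

/-- The two signs of the pivot give the sum and the difference of two values of `χ`. -/
theorem exists_le_chi_pivot (χ : IA n →* Multiplicative ℤ) (a i c : Fin n)
    (u : FreeGroup (Fin n)) : ∃ b, |(χ (commRight a u (FreeGroup.of c))).toAdd| ≤
      |(χ (pivot a i b u c)).toAdd| := by
  have h1 : (χ (pivot a i true u c)).toAdd = (χ (commRight a u (FreeGroup.of c))).toAdd -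
      (χ (commRight i u (FreeGroup.of c))).toAdd := by
    rw [pivot, map_mul, chi_commLeft, commMove_true, commRight_swap i u, map_inv, toAdd_mul,
      toAdd_inv,
      sub_eq_add_neg]
  have h2 : (χ (pivot a i false u c)).toAdd = (χ (commRight a u (FreeGroup.of c))).toAdd +
      (χ (commRight i u (FreeGroup.of c))).toAdd := by
    rw [pivot, map_mul, chi_commLeft, commMove_false, chi_commLeft, toAdd_mul]
  rcases abs_le_abs_sub_or (χ (commRight a u (FreeGroup.of c))).toAdd
    (χ (commRight i u (FreeGroup.of c))).toAdd with h | h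
  · exact ⟨true, by rwa [h1]⟩
  · exact ⟨false, by rwa [h2]⟩

/-- As `χ` is additive in `x_b`, one of the words `x_j⁻¹ x_b`, `x_j x_b` does at least as well as
`x_b`. -/
theorem exists_le_chi_commRight (χ : IA n →* Multiplicative ℤ) (a j b : Fin n)
    (w : FreeGroup (Fin n)) : ∃ γ, |(χ (commRight a (FreeGroup.of b) w)).toAdd| ≤
      |(χ (commRight a (sgen j γ * FreeGroup.of b) w)).toAdd| := by
  rcases abs_le_abs_sub_or (χ (commRight a (FreeGroup.of b) w)).toAdd
    (χ (commRight a (FreeGroup.of j) w)).toAdd with h | h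
  · refine ⟨false, ?_⟩
    rwa [sgen_false, chi_commRight_mul_left, chi_commRight_inv_left, toAdd_mul, toAdd_inv,
      neg_add_eq_sub]
  · refine ⟨true, ?_⟩
    rwa [sgen_true, chi_commRight_mul_left, toAdd_mul, add_comm]

/-- As `χ` is additive in `x_b`, one of the words `x_j⁻¹ x_b`, `x_j x_b` does at least as well as
`x_b`. -/
theorem exists_le_chi_conjGen (χ : IA n →* Multiplicative ℤ) (a j b : Fin n) :
    ∃ γ, |(χ (conjGen a (FreeGroup.of b))).toAdd| ≤
      |(χ (conjGen a (sgen j γ * FreeGroup.of b))).toAdd| := by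
  rcases abs_le_abs_sub_or (χ (conjGen a (FreeGroup.of b))).toAdd
    (χ (conjGen a (FreeGroup.of j))).toAdd with h | h
  · refine ⟨false, ?_⟩
    rwa [sgen_false, map_mul, map_mul, map_inv, map_inv, toAdd_mul, toAdd_inv, neg_add_eq_sub]
  · refine ⟨true, ?_⟩
    rwa [sgen_true, map_mul, map_mul, toAdd_mul, add_comm]

variable {M : ℤ} {L : ℕ} {y₀ : IA n}

theorem Good.linv {ℓ : ℕ} {u : IA n} (hu : Good (letters n) χ M L y₀ ℓ u) :
    Good (letters n) χ M L y₀ ℓ u⁻¹ := Good.inv (fun _ => inv_mem_letters) hu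

/-- If the generators moving `x_p` are good, then so are all letters moving `x_p`. -/
theorem Good.targetLetters {p : Fin n} {ℓ m : ℕ}
    (h1 : ∀ q, Good (letters n) χ M L y₀ ℓ (conjGen p (FreeGroup.of q)))
    (h2 : ∀ q r, Good (letters n) χ M L y₀ m (commRight p (FreeGroup.of q) (FreeGroup.of r)))
    {x : IA n} (hx : x ∈ targetLetters p) : Good (letters n) χ M L y₀ (m + 8 * ℓ) x := by
  have h3 : ∀ q b, Good (letters n) χ M L y₀ ℓ (conjGen p (sgen q b)) := by
    intro q b
    cases b
    · rw [sgen_false, map_inv]; exact (h1 q).linv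
    · exact h1 q
  have h4 : ∀ q b r, Good (letters n) χ M L y₀ (m + 2 * ℓ)
      (commRight p (sgen q b) (FreeGroup.of r)) := by
    intro q b r
    cases b
    · rw [sgen_false, commRight_inv_left]
      exact (((h1 q).mul (h2 q r).linv).mul (h1 q).linv).mono (by omega)
    · exact (h2 q r).mono (by omega)
  have h5 : ∀ q b r c, Good (letters n) χ M L y₀ (m + 4 * ℓ)
      (commRight p (sgen q b) (sgen r c)) := by
    intro q b r c
    cases c
    · rw [sgen_false, commRight_inv_right]
      exact (((h1 r).mul (h4 q b r).linv).mul (h1 r).linv).mono (by omega)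
    · exact (h4 q b r).mono (by omega)
  rcases hx with ⟨j, b, rfl⟩ | ⟨j, b, k, c, rfl⟩ | ⟨j, b, k, c, rfl⟩
  · exact (h3 j b).mono (by omega)
  · exact (h5 j b k c).mono (by omega)
  · rw [commLeft_eq, rcomm, map_mul, map_mul, map_mul, map_inv, map_inv]
    exact ((h5 j b k c).mul
      ((((h3 j b).linv.mul (h3 k c).linv).mul (h3 j b)).mul (h3 k c)).linv).mono (by omega)

theorem conjGen_of_self (p : Fin n) : conjGen p (FreeGroup.of p) = 1 := by
  ext1
  refine mulAut_ext_of fun k => ?_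
  by_cases hk : k = p
  · subst hk; simp [coe_conjGen, flank_self, substHom_self]
  · simp [coe_conjGen, flank_ne hk]

theorem commRight_of_self_left (p : Fin n) (w : FreeGroup (Fin n)) :
    commRight p (FreeGroup.of p) w = 1 := by
  rw [commRight_congr (u' := 1) (w' := w) (by simp [substHom_self]) rfl, commRight_one_left]

theorem commRight_of_self_right (p : Fin n) (w : FreeGroup (Fin n)) :
    commRight p w (FreeGroup.of p) = 1 := by
  rw [commRight_swap, commRight_of_self_left, inv_one]

theorem conj_commMove {b j : Fin n} (hjb : j ≠ b) (γ : Bool) {u w : FreeGroup (Fin n)}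
    (hu : Free j u) (hw : Free j w) :
    (conjGen j (FreeGroup.of b) * commMove j γ u w * (conjGen j (FreeGroup.of b))⁻¹).1 (sgen j γ) =
      sgen j γ * (FreeGroup.of b * rcomm u w * (FreeGroup.of b)⁻¹) := by
  have h1 : ∀ v : FreeGroup (Fin n), Free j v →
      (conjGen j v).1 (sgen j γ) = v⁻¹ * sgen j γ * v := by
    intro v hv
    cases γ
    · rw [sgen_false, map_inv, apply_conjGen_self hv]; group
    · exact apply_conjGen_self hv
  have fb : Free j (FreeGroup.of b) := free_of hjb.symm
  have fr := hu.rcomm hw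
  rw [← map_inv]
  change (conjGen j _).1 ((commMove j γ u w).1 ((conjGen j _).1 _)) = _
  have hb : (commMove j γ u w).1 (FreeGroup.of b) = FreeGroup.of b := fixes_commMove hjb.symm _ _ _
  have hb' : (conjGen j (FreeGroup.of b)).1 (FreeGroup.of b) = FreeGroup.of b :=
    fixes_conjGen hjb.symm _
  have hr : (conjGen j (FreeGroup.of b)).1 (rcomm u w) = rcomm u w := fixes_conjGen_of_free fr _
  rw [h1 _ fb.inv]
  simp only [map_mul, map_inv, hb, inv_inv]
  rw [apply_commMove_self hu hw]
  simp only [map_mul, hb', h1 _ fb, hr]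
  group

/-- Goodness of generators moving `x_b`, deduced from the goodness of the letters moving some other
`x_j` by means of `commute_mul_of_slide`. -/
theorem Good.slide {Y : IA n} (hlink : Linked (letters n) χ M L y₀ Y) {b j : Fin n} {γ : Bool}
    (hjb : j ≠ b) (hYj : Fixes Y (FreeGroup.of j)) (hYb : Fixes Y (FreeGroup.of b))
    (hY : ∀ g : IA n, (∀ k, k ≠ j → k ≠ b → Fixes g (FreeGroup.of k)) →
      Fixes g (sgen j γ * FreeGroup.of b) → ∀ k, k ≠ j → k ≠ b → Fixes g (Y.1 (FreeGroup.of k)))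
    {ℓ : ℕ} (hj : ∀ x ∈ _root_.targetLetters j, Good (letters n) χ M L y₀ ℓ x)
    {v : FreeGroup (Fin n)} (hv : IsShortWord v) (fb : Free b v) (fj : Free j v) (hYv : Fixes Y v) :
    Good (letters n) χ M L y₀ (6 * ℓ + 10) (conjGen b v) ∧
    ∀ r, r ≠ b → r ≠ j → Fixes Y (FreeGroup.of r) →
      Good (letters n) χ M L y₀ (6 * ℓ + 10) (commRight b v (FreeGroup.of r)) := by
  have fjb : Free j (FreeGroup.of b) := free_of hjb.symm
  have key : ∀ (E s : IA n) (e : FreeGroup (Fin n)), HasLen (_root_.targetLetters j) 6 E →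
      HasLen (letters n) 4 s → (∀ k ≠ b, Fixes s (FreeGroup.of k)) →
      s.1 (FreeGroup.of b) = e⁻¹ * FreeGroup.of b → (∀ k ≠ j, Fixes E (FreeGroup.of k)) →
      E.1 (sgen j γ) = sgen j γ * e → Fixes E e → Fixes Y e →
      Good (letters n) χ M L y₀ (6 * ℓ + 10) s := by
    intro E s e hE hs h1 h2 h3 h4 h5 h6
    have hc := commute_mul_of_slide h1 h2 h3 h4 h5 hjb hYj hYb h6 hY
    have g1 : Good (letters n) χ M L y₀ 10 (E * s) := .basic hlink hc (hE.letters.mul hs)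
    have g2 := (Good.of_hasLen hj hE).linv.mul g1
    rwa [inv_mul_cancel_left] at g2
  constructor
  · refine key (commMove j γ (sgen b false) v) _ (rcomm (sgen b false) v)
      ((hv.hasLen_commMove j b false γ).mono (by omega))
      ((hv.hasLen_conjGen b).letters.mono (by omega)) (fun k hk => fixes_conjGen hk _) ?_
      (fun k hk => fixes_commMove hk _ _ _) (apply_commMove_self (free_sgen hjb.symm _) fj γ) ?_ ?_
    · rw [apply_conjGen_self fb, sgen_false, rcomm]; group
    · have h : ∀ w, Free j w → Fixes (commMove j γ (sgen b false) v) w := by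
        intro w hw
        cases γ
        · exact fixes_commLeft_of_free hw _ _
        · exact fixes_commRight_of_free hw _ _
      exact h _ ((free_sgen hjb.symm _).rcomm fj)
    · exact (hYb.sgen _).rcomm hYv
  · intro r hrb hrj hYr
    have fr : Free j (FreeGroup.of r) := free_of hrj
    have hC := hasLen_target_conjGen j b true
    rw [sgen_true] at hC
    refine key (conjGen j (FreeGroup.of b) * commMove j γ (FreeGroup.of r) v *
      (conjGen j (FreeGroup.of b))⁻¹) _
      (FreeGroup.of b * rcomm (FreeGroup.of r) v * (FreeGroup.of b)⁻¹)
      ((hC.mul (hv.hasLen_commMove j r true γ)).mul hC.tinv)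
      (hv.hasLen_commRight b r true).letters (fun k hk => fixes_commRight hk _ _) ?_ ?_
      (conj_commMove hjb γ fr fj) ?_ ?_
    · rw [apply_commRight_self fb (free_of hrb), rcomm, rcomm]; group
    · intro k hk
      rw [← map_inv]
      exact ((fixes_conjGen hk _).comp (fixes_commMove hk _ _ _)).comp (fixes_conjGen hk _)
    · have h : ∀ w, Free j w → Fixes (commMove j γ (FreeGroup.of r) v) w := by
        intro w hw
        cases γ
        · exact fixes_commLeft_of_free hw _ _
        · exact fixes_commRight_of_free hw _ _
      have fe := (fjb.mul (fr.rcomm fj)).mul fjb.inv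
      rw [← map_inv]
      exact ((fixes_conjGen_of_free fe _).comp (h _ fe)).comp (fixes_conjGen_of_free fe _)
    · exact (hYb.mul (hYr.rcomm hYv)).mul hYb.inv

end TargetLetters

/-! ### Goodness relative to `x_a ↦ x_a [x_b, x_c]` -/

section TripleAnchor

variable {n : ℕ}

theorem exists_two_notMem (hn : 8 ≤ n) (T : Finset (Fin n)) (hT : T.card ≤ 6) :
    ∃ i j, i ∉ T ∧ j ∉ T ∧ i ≠ j := by
  have h : 1 < (Finset.univ \ T).card := by
    rw [Finset.card_sdiff_of_subset (Finset.subset_univ T), Finset.card_univ, Fintype.card_fin]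
    omega
  obtain ⟨i, hi, j, hj, hij⟩ := Finset.one_lt_card.1 h
  exact ⟨i, j, (Finset.mem_sdiff.1 hi).2, (Finset.mem_sdiff.1 hj).2, hij⟩

/-- For `n ≥ 8` there are two indices besides any six given ones. -/
theorem exists_two_ne (hn : 8 ≤ n) (a b c p q r : Fin n) : ∃ i j : Fin n, i ≠ j ∧
    (i ≠ a ∧ i ≠ b ∧ i ≠ c ∧ i ≠ p ∧ i ≠ q ∧ i ≠ r) ∧
    (j ≠ a ∧ j ≠ b ∧ j ≠ c ∧ j ≠ p ∧ j ≠ q ∧ j ≠ r) := by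
  obtain ⟨i, j, hi, hj, hij⟩ := exists_two_notMem hn {a, b, c, p, q, r} Finset.card_le_six
  simp only [Finset.mem_insert, Finset.mem_singleton, not_or] at hi hj
  exact ⟨i, j, hij, hi, hj⟩

/-- The element `x_a ↦ x_a [x_b, x_c]` is an anchor for the character `χ`. -/
structure TripleAnchor (χ : IA n →* Multiplicative ℤ) (M : ℤ) (a b c : Fin n) : Prop where
  ab : a ≠ b
  ac : a ≠ c
  bc : b ≠ c
  le : M ≤ 2 * |(χ (commRight a (FreeGroup.of b) (FreeGroup.of c))).toAdd|

variable {χ : IA n →* Multiplicative ℤ} {M : ℤ} {a b c : Fin n}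

/-- Pivots on which `χ` is large are linked to the anchor, since they multiply `x_a` from the left
and fix `x_b` and `x_c`. -/
theorem TripleAnchor.linked_pivot (h : TripleAnchor χ M a b c) {i : Fin n} (hia : i ≠ a)
    (hib : i ≠ b) (hic : i ≠ c) {u : FreeGroup (Fin n)} (hu : IsShortWord u) (fa : Free a u)
    (fi : Free i u) {β : Bool} (hM : M ≤ 2 * |(χ (pivot a i β u c)).toAdd|) :
    Linked (letters n) χ M 8 (commRight a (FreeGroup.of b) (FreeGroup.of c)) (pivot a i β u c) := by
  refine Linked.single ?_ ⟨hu.hasLen_pivot a i c β, hM⟩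
  have fab : Free a (FreeGroup.of b) := free_of h.ab.symm
  have fac : Free a (FreeGroup.of c) := free_of h.ac.symm
  have fib : Free i (FreeGroup.of b) := free_of hib.symm
  have fic : Free i (FreeGroup.of c) := free_of hic.symm
  refine Commute.mul_right (commute_commRight_commLeft a) (Commute.symm ?_)
  have hg : ∀ k ≠ i, Free i ((commRight a (FreeGroup.of b) (FreeGroup.of c)).1 (FreeGroup.of k)) :=
    fun k hk => free_commRight_apply hia fib fic fab fac hk
  have h1 : Fixes (commRight a (FreeGroup.of b) (FreeGroup.of c)) (FreeGroup.of i) :=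
    fixes_commRight hia _ _
  have h2 := fixes_commRight_of_free fa (FreeGroup.of b) (FreeGroup.of c)
  have h3 := fixes_commRight_of_free fac (FreeGroup.of b) (FreeGroup.of c)
  cases β
  · exact commute_commLeft h1 h2 h3 fi fic hg
  · exact commute_commRight h1 h3 h2 fic fi hg

theorem TripleAnchor.exists_pivot (h : TripleAnchor χ M a b c) {i : Fin n} (hia : i ≠ a)
    (hib : i ≠ b) (hic : i ≠ c) : ∃ β,
    Linked (letters n) χ M 8 (commRight a (FreeGroup.of b) (FreeGroup.of c))
      (pivot a i β (FreeGroup.of b) c) := by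
  obtain ⟨β, hβ⟩ := exists_le_chi_pivot χ a i c (FreeGroup.of b)
  exact ⟨β, h.linked_pivot hia hib hic (isShortWord_of b) (free_of h.ab.symm) (free_of hib.symm)
    (h.le.trans (by omega))⟩

theorem TripleAnchor.exists_pivot_mul (h : TripleAnchor χ M a b c) {i j : Fin n} (hia : i ≠ a)
    (hib : i ≠ b) (hic : i ≠ c) (hja : j ≠ a) (hij : i ≠ j) : ∃ β γ,
    Linked (letters n) χ M 8 (commRight a (FreeGroup.of b) (FreeGroup.of c))
      (pivot a i β (sgen j γ * FreeGroup.of b) c) := by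
  obtain ⟨γ, hγ⟩ := exists_le_chi_commRight χ a j b (FreeGroup.of c)
  obtain ⟨β, hβ⟩ := exists_le_chi_pivot χ a i c (sgen j γ * FreeGroup.of b)
  exact ⟨β, γ, h.linked_pivot hia hib hic (isShortWord_mul j γ b)
    ((free_sgen hja _).mul (free_of h.ab.symm)) ((free_sgen hij.symm _).mul (free_of hib.symm))
    (h.le.trans (by omega))⟩

theorem TripleAnchor.swap (h : TripleAnchor χ M a b c) : TripleAnchor χ M a c b := by
  refine ⟨h.ac, h.ab, h.bc.symm, ?_⟩
  rw [commRight_swap, map_inv, toAdd_inv, abs_neg]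
  exact h.le

theorem TripleAnchor.linked_swap (h : TripleAnchor χ M a b c) :
    Linked (letters n) χ M 8 (commRight a (FreeGroup.of b) (FreeGroup.of c))
      (commRight a (FreeGroup.of c) (FreeGroup.of b)) := by
  refine Linked.single ?_ ⟨(hasLen_commRight a c b true true).mono (by omega), h.swap.le⟩
  rw [commRight_swap a (FreeGroup.of b)]
  exact (Commute.refl _).inv_right

/-- Splitting off a letter from `x_a`, so as to work with `t x_a` instead. -/
theorem of_eq_sgen_mul (a i : Fin n) (β : Bool) :
    FreeGroup.of a = sgen i (!β) * (sgen i β * FreeGroup.of a) := by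
  rw [← sgen_inv, inv_mul_cancel_left]

/-- Generators moving an `x_p` not involved in the anchor commute with the anchor itself, unless
their words involve `x_a`; in this case `x_a` is replaced by a word fixed by a pivot. -/
theorem TripleAnchor.good_outside (hn : 8 ≤ n) (h : TripleAnchor χ M a b c) {p : Fin n}
    (hpa : p ≠ a) (hpb : p ≠ b) (hpc : p ≠ c) {x : IA n} (hx : x ∈ targetLetters p) :
    Good (letters n) χ M 8 (commRight a (FreeGroup.of b) (FreeGroup.of c)) 33 x := by
  set y₀ := commRight a (FreeGroup.of b) (FreeGroup.of c) with hy₀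
  have fpb : Free p (FreeGroup.of b) := free_of hpb.symm
  have fpc : Free p (FreeGroup.of c) := free_of hpc.symm
  have fab : Free a (FreeGroup.of b) := free_of h.ab.symm
  have fac : Free a (FreeGroup.of c) := free_of h.ac.symm
  have hy : ∀ k ≠ p, Free p (y₀.1 (FreeGroup.of k)) := fun k hk =>
    free_commRight_apply hpa fpb fpc fab fac hk
  have fy : ∀ k ≠ a, ∀ δ, Fixes y₀ (sgen k δ) := fun k hk δ => (fixes_commRight hk _ _).sgen δ
  have c1 : ∀ q δ, q ≠ p → q ≠ a → Good (letters n) χ M 8 y₀ 1 (conjGen p (sgen q δ)) := by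
    intro q δ hqp hqa
    exact .basic Relation.ReflTransGen.refl
      (commute_conjGen (fy p hpa true) (fy q hqa δ) (free_sgen hqp δ) hy)
      (hasLen_conjGen_sgen _ _ _)
  have r1 : ∀ q δ r, q ≠ p → q ≠ a → r ≠ p → r ≠ a →
      Good (letters n) χ M 8 y₀ 1 (commRight p (sgen q δ) (FreeGroup.of r)) := by
    intro q δ r hqp hqa hrp hra
    exact .basic Relation.ReflTransGen.refl
      (commute_commRight (fy p hpa true) (fy q hqa δ) (fy r hra true) (free_sgen hqp δ)
        (free_sgen hrp true) hy) (hasLen_commRight _ _ _ _ true)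
  have pa : ∀ r, r ≠ p → r ≠ a → Good (letters n) χ M 8 y₀ 3 (conjGen p (FreeGroup.of a)) ∧
      Good (letters n) χ M 8 y₀ 9 (commRight p (FreeGroup.of a) (FreeGroup.of r)) := by
    intro r hrp hra
    obtain ⟨i, -, -, ⟨hia, hib, hic, hip, hir, -⟩, -⟩ := exists_two_ne hn a b c p r r
    obtain ⟨β, hβ⟩ := h.exists_pivot hia hib hic
    have fib : Free i (FreeGroup.of b) := free_of hib.symm
    have hp := fixes_pivot (c := c) (u := FreeGroup.of b) hpa hip.symm β
    have hv := fixes_pivot_mul hia h.ac.symm hic.symm fab fib β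
    have fv : Free p (sgen i β * FreeGroup.of a) := (free_sgen hip β).mul (free_of hpa.symm)
    have hpiv : ∀ k ≠ p, Free p ((pivot a i β (FreeGroup.of b) c).1 (FreeGroup.of k)) := fun k hk =>
      free_pivot_apply hia h.ac.symm hic.symm fab fib β fpb hpc hk
    have cv : Good (letters n) χ M 8 y₀ 2 (conjGen p (sgen i β * FreeGroup.of a)) :=
      .basic hβ (commute_conjGen hp hv fv hpiv) ((isShortWord_mul i β a).hasLen_conjGen p).letters
    have rv : Good (letters n) χ M 8 y₀ 4
        (commRight p (sgen i β * FreeGroup.of a) (FreeGroup.of r)) :=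
      .basic hβ (commute_commRight hp hv (fixes_pivot hra hir.symm β) fv (free_of hrp) hpiv)
        ((isShortWord_mul i β a).hasLen_commRight p r true).letters
    rw [of_eq_sgen_mul a i β, map_mul, commRight_mul_left]
    exact ⟨(c1 i _ hip hia).mul cv,
      (((cv.linv).mul (r1 i _ r hip hia hrp hra)).mul cv).mul rv⟩
  refine (Good.targetLetters (ℓ := 3) (m := 9) (fun q => ?_) (fun q r => ?_) hx).mono (by omega)
  · by_cases hqp : q = p
    · subst hqp; rw [conjGen_of_self]; exact Good.one _
    by_cases hqa : q = a
    · subst hqa; exact (pa b hpb.symm h.ab.symm).1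
    · exact (c1 q true hqp hqa).mono (by omega)
  · by_cases hqp : q = p
    · subst hqp; rw [commRight_of_self_left]; exact Good.one _
    by_cases hrp : r = p
    · subst hrp; rw [commRight_of_self_right]; exact Good.one _
    by_cases hqa : q = a
    · by_cases hra : r = a
      · rw [hqa, hra, commRight_self]; exact Good.one _
      · rw [hqa]; exact (pa r hrp hra).2
    · by_cases hra : r = a
      · rw [hra, commRight_swap p (FreeGroup.of a)]; exact (pa q hqp hqa).2.linv
      · exact (r1 q true r hqp hqa hrp hra).mono (by omega)

/-- Generators moving `x_b`, by the sliding argument. -/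
theorem TripleAnchor.good_second (hn : 8 ≤ n) (h : TripleAnchor χ M a b c) (q r : Fin n) :
    Good (letters n) χ M 8 (commRight a (FreeGroup.of b) (FreeGroup.of c)) 416
      (conjGen b (FreeGroup.of q)) ∧
    Good (letters n) χ M 8 (commRight a (FreeGroup.of b) (FreeGroup.of c)) 1248
      (commRight b (FreeGroup.of q) (FreeGroup.of r)) := by
  have slide : ∀ i j : Fin n, i ≠ a → i ≠ b → i ≠ c → j ≠ a → j ≠ b → j ≠ c → i ≠ j →
      ∃ β : Bool, ∀ v, IsShortWord v → Free b v → Free j v →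
        (v = sgen i β * FreeGroup.of a ∨ ∃ q δ, q ≠ a ∧ q ≠ i ∧ v = sgen q δ) →
        Good (letters n) χ M 8 (commRight a (FreeGroup.of b) (FreeGroup.of c)) 208 (conjGen b v) ∧
        ∀ r, r ≠ a → r ≠ b → r ≠ i → r ≠ j →
          Good (letters n) χ M 8 (commRight a (FreeGroup.of b) (FreeGroup.of c)) 208
            (commRight b v (FreeGroup.of r)) := by
    intro i j hia hib hic hja hjb hjc hij
    obtain ⟨β, γ, hlink⟩ := h.exists_pivot_mul hia hib hic hja hij
    have fa : Free a (sgen j γ * FreeGroup.of b) := (free_sgen hja _).mul (free_of h.ab.symm)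
    have fi : Free i (sgen j γ * FreeGroup.of b) := (free_sgen hij.symm _).mul (free_of hib.symm)
    refine ⟨β, fun v hv fb fj hv' => ?_⟩
    have hYv : Fixes (pivot a i β (sgen j γ * FreeGroup.of b) c) v := by
      rcases hv' with rfl | ⟨q, δ, hqa, hqi, rfl⟩
      · exact fixes_pivot_mul hia h.ac.symm hic.symm fa fi β
      · exact (fixes_pivot hqa hqi β).sgen δ
    obtain ⟨g1, g2⟩ := Good.slide hlink hjb (fixes_pivot hja hij.symm β)
      (fixes_pivot h.ab.symm hib.symm β)
      (fun g hg hgw k hkj hkb => fixes_pivot_apply hia h.ac.symm hic.symm fa fi β (hg k hkj hkb) hgw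
        (hg c hjc.symm h.bc.symm))
      (fun x hx => h.good_outside hn hja hjb hjc hx) hv fb fj hYv
    exact ⟨g1, fun r hra hrb hri hrj => g2 r hrb hrj (fixes_pivot hra hri β)⟩
  have away : ∀ q δ r, q ≠ a → q ≠ b → r ≠ a → r ≠ b →
      Good (letters n) χ M 8 (commRight a (FreeGroup.of b) (FreeGroup.of c)) 208
        (conjGen b (sgen q δ)) ∧
      Good (letters n) χ M 8 (commRight a (FreeGroup.of b) (FreeGroup.of c)) 208
        (commRight b (sgen q δ) (FreeGroup.of r)) := by
    intro q δ r hqa hqb hra hrb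
    obtain ⟨i, j, hij, ⟨hia, hib, hic, hiq, hir, -⟩, ⟨hja, hjb, hjc, hjq, hjr, -⟩⟩ :=
      exists_two_ne hn a b c q r r
    obtain ⟨β, hβ⟩ := slide i j hia hib hic hja hjb hjc hij
    obtain ⟨g1, g2⟩ := hβ _ (isShortWord_sgen q δ) (free_sgen hqb δ) (free_sgen hjq.symm δ)
      (Or.inr ⟨q, δ, hqa, hiq.symm, rfl⟩)
    exact ⟨g1, g2 r hra hrb hir.symm hjr.symm⟩
  have atA : ∀ r, r ≠ a → r ≠ b →
      Good (letters n) χ M 8 (commRight a (FreeGroup.of b) (FreeGroup.of c)) 416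
        (conjGen b (FreeGroup.of a)) ∧
      Good (letters n) χ M 8 (commRight a (FreeGroup.of b) (FreeGroup.of c)) 1248
        (commRight b (FreeGroup.of a) (FreeGroup.of r)) := by
    intro r hra hrb
    obtain ⟨i, j, hij, ⟨hia, hib, hic, hir, -, -⟩, ⟨hja, hjb, hjc, hjr, -, -⟩⟩ :=
      exists_two_ne hn a b c r r r
    obtain ⟨β, hβ⟩ := slide i j hia hib hic hja hjb hjc hij
    obtain ⟨g1, g2⟩ := hβ _ (isShortWord_mul i β a) ((free_sgen hib β).mul (free_of h.ab))
      ((free_sgen hij β).mul (free_of hja.symm)) (Or.inl rfl)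
    have g3 := away i (!β) r hia hib hra hrb
    rw [of_eq_sgen_mul a i β, map_mul, commRight_mul_left]
    exact ⟨g3.1.mul g1,
      ((((g1.linv).mul g3.2).mul g1).mul (g2 r hra hrb hir.symm hjr.symm)).mono (by omega)⟩
  constructor
  · by_cases hqb : q = b
    · rw [hqb, conjGen_of_self]; exact Good.one _
    by_cases hqa : q = a
    · rw [hqa]; exact (atA c h.ac.symm h.bc.symm).1
    · exact (away q true c hqa hqb h.ac.symm h.bc.symm).1.mono (by omega)
  · by_cases hqb : q = b
    · rw [hqb, commRight_of_self_left]; exact Good.one _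
    by_cases hrb : r = b
    · rw [hrb, commRight_of_self_right]; exact Good.one _
    by_cases hqa : q = a
    · by_cases hra : r = a
      · rw [hqa, hra, commRight_self]; exact Good.one _
      · rw [hqa]; exact (atA r hra hrb).2
    · by_cases hra : r = a
      · rw [hra, commRight_swap b (FreeGroup.of a)]; exact (atA q hqa hqb).2.linv
      · exact (away q true r hqa hqb hra hrb).2.mono (by omega)

/-- The anchor with `x_b` and `x_c` exchanged is the inverse of the given one. -/
theorem TripleAnchor.good_third (hn : 8 ≤ n) (h : TripleAnchor χ M a b c) (q r : Fin n) :
    Good (letters n) χ M 8 (commRight a (FreeGroup.of b) (FreeGroup.of c)) 416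
      (conjGen c (FreeGroup.of q)) ∧
    Good (letters n) χ M 8 (commRight a (FreeGroup.of b) (FreeGroup.of c)) 1248
      (commRight c (FreeGroup.of q) (FreeGroup.of r)) :=
  ⟨(h.swap.good_second hn q r).1.of_linked h.linked_swap,
    (h.swap.good_second hn q r).2.of_linked h.linked_swap⟩

theorem conjGen_apply_self (p q : Fin n) : (conjGen p (FreeGroup.of q)).1 (FreeGroup.of p) =
    (FreeGroup.of q)⁻¹ * FreeGroup.of p * FreeGroup.of q := by
  by_cases h : q = p
  · subst h; rw [conjGen_of_self]; simp
  · exact apply_conjGen_self (free_of h)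

theorem conjGen_apply_word (p q : Fin n) : (conjGen p (FreeGroup.of q)).1 (FreeGroup.of q) =
    FreeGroup.of q := by
  by_cases h : q = p
  · subst h; rw [conjGen_of_self]; rfl
  · exact fixes_conjGen h _

/-- Conjugating `x_a`, `x_b`, `x_c` simultaneously commutes with the anchor, and the pivot commutes
with the right multiplications of `x_a`. -/
theorem TripleAnchor.good_first (hn : 8 ≤ n) (h : TripleAnchor χ M a b c) (q r : Fin n) :
    Good (letters n) χ M 8 (commRight a (FreeGroup.of b) (FreeGroup.of c)) 835
      (conjGen a (FreeGroup.of q)) ∧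
    Good (letters n) χ M 8 (commRight a (FreeGroup.of b) (FreeGroup.of c)) 1
      (commRight a (FreeGroup.of q) (FreeGroup.of r)) := by
  have fab : Free a (FreeGroup.of b) := free_of h.ab.symm
  have fac : Free a (FreeGroup.of c) := free_of h.ac.symm
  constructor
  · by_cases hqa : q = a
    · rw [hqa, conjGen_of_self]; exact Good.one _
    -- the conjugation of `x_a`, `x_b` and `x_c` by `x_q` fixes `x_a [x_b, x_c]` up to this
    -- conjugation
    have hcomm : Commute (conjGen a (FreeGroup.of q) * (conjGen b (FreeGroup.of q) *
        conjGen c (FreeGroup.of q))) (commRight a (FreeGroup.of b) (FreeGroup.of c)) := by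
      have hR : ∀ k ≠ a, (commRight a (FreeGroup.of b) (FreeGroup.of c)).1 (FreeGroup.of k) =
        FreeGroup.of k := fun k hk => fixes_commRight hk _ _
      have hne : ∀ {k l : Fin n}, l ≠ k →
          (conjGen k (FreeGroup.of q)).1 (FreeGroup.of l) = FreeGroup.of l := fun hl =>
        fixes_conjGen hl _
      refine Subtype.ext (mulAut_ext_of fun k => ?_)
      change (conjGen a _).1 ((conjGen b _).1 ((conjGen c _).1
        ((commRight a (FreeGroup.of b) (FreeGroup.of c)).1 _))) =
        (commRight a (FreeGroup.of b) (FreeGroup.of c)).1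
          ((conjGen a _).1 ((conjGen b _).1 ((conjGen c _).1 _)))
      by_cases hka : k = a
      · subst hka
        rw [apply_commRight_self fab fac]
        simp only [rcomm, map_mul, map_inv, hne h.ab, hne h.ac, hne h.bc, conjGen_apply_self,
          conjGen_apply_word, hR q hqa, hne h.ab.symm, hne h.ac.symm, hne h.bc.symm,
          apply_commRight_self fab fac]
        group
      by_cases hkb : k = b
      · subst hkb
        rw [hR k hka]
        simp only [map_mul, map_inv, hne h.bc, conjGen_apply_self, conjGen_apply_word, hR q hqa,
          hne h.ab.symm, hR k hka]
      by_cases hkc : k = c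
      · subst hkc
        rw [hR k hka]
        simp only [map_mul, map_inv, hne h.bc.symm, conjGen_apply_self, conjGen_apply_word,
          hR q hqa, hne h.ac.symm, hR k hka]
      · simp only [hR k hka, hne hkc, hne hkb, hne hka]
    have g1 : Good (letters n) χ M 8 (commRight a (FreeGroup.of b) (FreeGroup.of c)) 3
        (conjGen a (FreeGroup.of q) * (conjGen b (FreeGroup.of q) * conjGen c (FreeGroup.of q))) :=
      .basic Relation.ReflTransGen.refl hcomm
        ((hasLen_conjGen_of a q).mul ((hasLen_conjGen_of b q).mul (hasLen_conjGen_of c q)))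
    have g2 := g1.mul ((h.good_second hn q q).1.mul (h.good_third hn q q).1).linv
    rwa [mul_inv_cancel_right] at g2
  · by_cases hqa : q = a
    · rw [hqa, commRight_of_self_left]; exact Good.one _
    by_cases hra : r = a
    · rw [hra, commRight_of_self_right]; exact Good.one _
    obtain ⟨i, -, -, ⟨hia, hib, hic, hiq, hir, -⟩, -⟩ := exists_two_ne hn a b c q r r
    obtain ⟨β, hβ⟩ := h.exists_pivot hia hib hic
    refine .basic hβ (Commute.mul_right (commute_commRight_commLeft a) ?_)
      (hasLen_commRight a q r true true)
    have hg : ∀ k ≠ i,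
        Free i ((commRight a (FreeGroup.of q) (FreeGroup.of r)).1 (FreeGroup.of k)) := fun k hk =>
      free_commRight_apply hia (free_of hiq.symm) (free_of hir.symm) (free_of hqa) (free_of hra) hk
    have h1 : Fixes (commRight a (FreeGroup.of q) (FreeGroup.of r)) (FreeGroup.of i) :=
      fixes_commRight hia _ _
    have h2 := fixes_commRight_of_free fab (FreeGroup.of q) (FreeGroup.of r)
    have h3 := fixes_commRight_of_free fac (FreeGroup.of q) (FreeGroup.of r)
    cases β
    · exact (commute_commLeft h1 h2 h3 (free_of hib.symm) (free_of hic.symm) hg).symm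
    · exact (commute_commRight h1 h3 h2 (free_of hic.symm) (free_of hib.symm) hg).symm

/-- All letters are good relative to an anchor `x_a ↦ x_a [x_b, x_c]`. -/
theorem TripleAnchor.good_letters (hn : 8 ≤ n) (h : TripleAnchor χ M a b c) {x : IA n}
    (hx : x ∈ letters n) :
    Good (letters n) χ M 8 (commRight a (FreeGroup.of b) (FreeGroup.of c)) 6700 x := by
  obtain ⟨p, hp⟩ := exists_mem_targetLetters hx
  by_cases hpa : p = a
  · subst hpa
    exact (Good.targetLetters (fun q => (h.good_first hn q q).1)
      (fun q r => (h.good_first hn q r).2) hp).mono (by omega)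
  by_cases hpb : p = b
  · subst hpb
    exact (Good.targetLetters (fun q => (h.good_second hn q q).1)
      (fun q r => (h.good_second hn q r).2) hp).mono (by omega)
  by_cases hpc : p = c
  · subst hpc
    exact (Good.targetLetters (fun q => (h.good_third hn q q).1)
      (fun q r => (h.good_third hn q r).2) hp).mono (by omega)
  · exact (h.good_outside hn hpa hpb hpc hp).mono (by omega)

end TripleAnchor

/-! ### Goodness relative to `x_a ↦ x_b⁻¹ x_a x_b` -/

section PairAnchor

variable {n : ℕ}

variable {χ : IA n →* Multiplicative ℤ} {M : ℤ} {a b : Fin n}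

theorem commute_conjGen_conjGen {i k b : Fin n} (hik : i ≠ k) (hib : b ≠ i) (hkb : b ≠ k) :
    Commute (conjGen i (FreeGroup.of b)) (conjGen k (FreeGroup.of b)) :=
  commute_conjGen (fixes_conjGen hik _) (fixes_conjGen hkb _) (free_of hib) fun _ hl =>
    free_conjGen_apply hik (free_of hib) (free_of hkb) hl

/-- The case in which all the partial conjugations by `x_b` are anchors. -/
theorem good_letters_of_forall_conjGen (hn : 8 ≤ n) (hab : a ≠ b)
    (h : ∀ l, l ≠ b → M ≤ 2 * |(χ (conjGen l (FreeGroup.of b))).toAdd|) {x : IA n}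
    (hx : x ∈ letters n) :
    Good (letters n) χ M 2 (conjGen a (FreeGroup.of b)) 576 x := by
  have linked : ∀ l, l ≠ b → Linked (letters n) χ M 2 (conjGen a (FreeGroup.of b))
      (conjGen l (FreeGroup.of b)) := by
    intro l hl
    refine Linked.single ?_ ⟨(hasLen_conjGen_of l b).mono (by omega), h l hl⟩
    by_cases hal : a = l
    · subst hal; exact Commute.refl _
    · exact commute_conjGen_conjGen hal hab.symm hl.symm
  have outside : ∀ p, p ≠ b → ∀ x ∈ targetLetters p,
      Good (letters n) χ M 2 (conjGen a (FreeGroup.of b)) 9 x := by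
    -- some `x_i ↦ x_b⁻¹ x_i x_b` with `i` not involved in the letter commutes with it
    intro p hpb x hx
    refine (Good.targetLetters (ℓ := 1) (m := 1) (fun q => ?_) (fun q r => ?_) hx).mono (by omega)
    · by_cases hqp : q = p
      · rw [hqp, conjGen_of_self]; exact Good.one _
      obtain ⟨i, -, -, ⟨hib, hip, hiq, -⟩, -⟩ := exists_two_ne hn b p q q q q
      refine .basic (linked i hib) (Commute.symm ?_) (hasLen_conjGen_of p q)
      exact commute_conjGen (fixes_conjGen hip _) (fixes_conjGen hpb.symm _) (free_of hib.symm)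
        fun k hk => free_conjGen_apply hip (free_of hiq.symm) (free_of hqp) hk
    · by_cases hqp : q = p
      · rw [hqp, commRight_of_self_left]; exact Good.one _
      by_cases hrp : r = p
      · rw [hrp, commRight_of_self_right]; exact Good.one _
      obtain ⟨i, -, -, ⟨hib, hip, hiq, hir, -⟩, -⟩ := exists_two_ne hn b p q r r r
      refine .basic (linked i hib) (Commute.symm ?_) (hasLen_commRight p q r true true)
      exact commute_conjGen (fixes_commRight hip _ _) (fixes_commRight hpb.symm _ _)
        (free_of hib.symm) fun k hk => free_commRight_apply hip (free_of hiq.symm)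
          (free_of hir.symm) (free_of hqp) (free_of hrp) hk
  have slide : ∀ q r, q ≠ b → r ≠ b →
      Good (letters n) χ M 2 (conjGen a (FreeGroup.of b)) 64 (conjGen b (FreeGroup.of q)) ∧
      Good (letters n) χ M 2 (conjGen a (FreeGroup.of b)) 64
        (commRight b (FreeGroup.of q) (FreeGroup.of r)) := by
    -- The anchor is `x_i ↦ w⁻¹ x_i w` with `w = x_j^{±1} x_b`: the sliding argument makes the
    -- generators moving `x_b` fix `w`, at the expense of letters moving `x_j`.
    intro q r hqb hrb
    obtain ⟨i, j, hij, ⟨hia, hib, hiq, hir, -⟩, ⟨hja, hjb, hjq, hjr, -⟩⟩ :=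
      exists_two_ne hn a b q r r r
    obtain ⟨γ, hγ⟩ := exists_le_chi_conjGen χ i j b
    have fi : Free i (sgen j γ * FreeGroup.of b) := (free_sgen hij.symm γ).mul (free_of hib.symm)
    have fa : Free a (sgen j γ * FreeGroup.of b) := (free_sgen hja γ).mul (free_of hab.symm)
    have hlink : Linked (letters n) χ M 2 (conjGen a (FreeGroup.of b))
        (conjGen i (sgen j γ * FreeGroup.of b)) := by
      refine Linked.single ?_ ⟨((isShortWord_mul j γ b).hasLen_conjGen i).letters,
        (h i hib).trans (by omega)⟩
      exact commute_conjGen (fixes_conjGen hia.symm _) (fixes_conjGen hib.symm _) (free_of hab.symm)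
        fun k hk => free_conjGen_apply hia.symm fa fi hk
    obtain ⟨g1, g2⟩ := Good.slide hlink hjb (fixes_conjGen hij.symm _) (fixes_conjGen hib.symm _)
      (fun g hg hgw k hkj hkb => by
        by_cases hki : k = i
        · subst hki
          rw [apply_conjGen_self fi]
          exact (hgw.inv.mul (hg k hkj hkb)).mul hgw
        · rw [fixes_conjGen hki]; exact hg k hkj hkb)
      (outside j hjb) (isShortWord_of q) (free_of hqb) (free_of hjq.symm) (fixes_conjGen hiq.symm _)
    exact ⟨g1, g2 r hrb hjr.symm (fixes_conjGen hir.symm _)⟩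
  obtain ⟨p, hp⟩ := exists_mem_targetLetters hx
  by_cases hpb : p = b
  · subst hpb
    refine Good.targetLetters (ℓ := 64) (m := 64) (fun q => ?_) (fun q r => ?_) hp
    · by_cases hqp : q = p
      · rw [hqp, conjGen_of_self]; exact Good.one _
      · exact (slide q a hqp hab).1
    · by_cases hqp : q = p
      · rw [hqp, commRight_of_self_left]; exact Good.one _
      by_cases hrp : r = p
      · rw [hrp, commRight_of_self_right]; exact Good.one _
      · exact (slide q r hqp hrp).2
  · exact (outside p hpb x hp).mono (by omega)

/-- The values of `χ` at the conjugates of `x_a ↦ x_a [x_l, x_b]` by the transvection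
`x_l ↦ x_l x_a` and by its composite with the inversion of `x_l`: the difference of the values at
two partial conjugations, plus or minus the same term. -/
theorem chi_conj_triple {l : Fin n} (χ : IA n →* Multiplicative ℤ) (hal : a ≠ l) (hab : a ≠ b)
    (hlb : l ≠ b) :
    (χ (conjIA (transv a l) (commRight a (FreeGroup.of l) (FreeGroup.of b)))).toAdd =
      (χ (conjGen a (FreeGroup.of b))).toAdd - (χ (conjGen l (FreeGroup.of b))).toAdd +
      ((χ (commRight a (FreeGroup.of l) (FreeGroup.of b))).toAdd +
        (χ (commRight l (FreeGroup.of b)⁻¹ (FreeGroup.of a)⁻¹)).toAdd) ∧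
    (χ (conjIA (inversion l * transv a l) (commRight a (FreeGroup.of l) (FreeGroup.of b)))).toAdd =
      (χ (conjGen a (FreeGroup.of b))).toAdd - (χ (conjGen l (FreeGroup.of b))).toAdd -
      ((χ (commRight a (FreeGroup.of l) (FreeGroup.of b))).toAdd +
        (χ (commRight l (FreeGroup.of b)⁻¹ (FreeGroup.of a)⁻¹)).toAdd) := by
  have h := conjIA_transv_commRight_source_target hal (t := FreeGroup.of b) (free_of hlb.symm)
    (free_of hab.symm)
  constructor
  · rw [h]
    simp only [map_mul, toAdd_mul, chi_commLeft, map_inv, toAdd_inv]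
    ring
  · have d1 : ∀ k w, conjIA (inversion l) (conjGen k w) = conjGen k (inversion l w) := fun k w =>
      conjIA_signedPerm_conjGen _ _ _ _
    have d2 : ∀ u w, conjIA (inversion l) (commLeft a u w) =
        commLeft a (inversion l u) (inversion l w) := fun u w => by
      rw [inversion, conjIA_signedPerm_commLeft, if_pos (by simpa using hal)]; rfl
    have d3 : ∀ u w, conjIA (inversion l) (commRight l u w) =
        commLeft l (inversion l w) (inversion l u) := fun u w => by
      rw [inversion, conjIA_signedPerm_commRight, if_neg (by simp)]; rfl
    rw [conjIA_mul, h]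
    simp only [map_mul (conjIA _), d1, d2, d3]
    simp only [map_inv, inversion_ne hlb.symm, inversion_ne hal, inversion_self]
    simp only [map_mul, toAdd_mul, chi_commLeft, map_inv, toAdd_inv, chi_commRight_inv_left,
      commRight_swap l (FreeGroup.of b)⁻¹]
    ring

theorem fixed_by_conjIA {θ : MulAut (FreeGroup (Fin n))} {g : IA n}
    (h : ∀ k, θ (g.1 (FreeGroup.of k)) = g.1 (θ (FreeGroup.of k))) : conjIA θ g = g := by
  ext1
  rw [coe_conjIA, mul_inv_eq_iff_eq_mul]
  exact mulAut_ext_of h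

/-- The case in which some partial conjugation `x_l ↦ x_b⁻¹ x_l x_b` is not an anchor. Then a
conjugate of a Magnus generator of the other kind is an anchor, linked to the given one through the
simultaneous conjugation of `x_a` and `x_l` by `x_b`. -/
theorem good_letters_of_exists_conjGen (hn : 8 ≤ n) {l : Fin n} (hab : a ≠ b) (hal : a ≠ l)
    (hlb : l ≠ b) (hM : M ≤ |(χ (conjGen a (FreeGroup.of b))).toAdd|)
    (hl : 2 * |(χ (conjGen l (FreeGroup.of b))).toAdd| < M) {x : IA n}
    (hx : x ∈ letters n) :
    Good (letters n) χ M 144 (conjGen a (FreeGroup.of b)) 2170800 x := by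
  set mid := conjGen a (FreeGroup.of b) * conjGen l (FreeGroup.of b) with hmid
  set R := commRight a (FreeGroup.of l) (FreeGroup.of b) with hR
  have fab : Free a (FreeGroup.of b) := free_of hab.symm
  have fal : Free a (FreeGroup.of l) := free_of hal.symm
  have flb : Free l (FreeGroup.of b) := free_of hlb.symm
  have midne : ∀ k, k ≠ a → k ≠ l → mid.1 (FreeGroup.of k) = FreeGroup.of k := fun k h1 h2 =>
    (fixes_conjGen h1 _).comp (fixes_conjGen h2 _)
  have mida : mid.1 (FreeGroup.of a) = (FreeGroup.of b)⁻¹ * FreeGroup.of a * FreeGroup.of b := by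
    change (conjGen a _).1 ((conjGen l _).1 _) = _
    rw [fixes_conjGen hal, apply_conjGen_self fab]
  have midl : mid.1 (FreeGroup.of l) = (FreeGroup.of b)⁻¹ * FreeGroup.of l * FreeGroup.of b := by
    change (conjGen a _).1 ((conjGen l _).1 _) = _
    rw [apply_conjGen_self flb]
    exact fixes_conjGen_of_free ((fab.inv.mul fal).mul fab) _
  have midb := midne b hab.symm hlb.symm
  -- `mid` conjugates both `x_a` and `x_l` by `x_b`
  have hcR : Commute mid R := by
    have Rne : ∀ k ≠ a, R.1 (FreeGroup.of k) = FreeGroup.of k := fun k hk => fixes_commRight hk _ _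
    have Ra : R.1 (FreeGroup.of a) =
        FreeGroup.of a * rcomm (FreeGroup.of l) (FreeGroup.of b) := apply_commRight_self fal fab
    refine Subtype.ext (mulAut_ext_of fun k => ?_)
    change mid.1 (R.1 _) = R.1 (mid.1 _)
    by_cases hka : k = a
    · rw [hka, mida, Ra]
      simp only [rcomm, map_mul, map_inv, mida, midl, midb, Rne b hab.symm, Ra]
      group
    by_cases hkl : k = l
    · rw [hkl, Rne l hal.symm, midl]
      simp only [map_mul, map_inv, Rne l hal.symm, Rne b hab.symm]
    · rw [Rne k hka, midne k hka hkl, Rne k hka]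
  have hT : conjIA (transv a l) mid = mid := by
    refine fixed_by_conjIA fun k => ?_
    by_cases hkl : k = l
    · rw [hkl, midl, transv_self hal]
      simp only [map_mul, map_inv, midl, mida, transv_self hal, transv_ne hlb.symm]
      group
    by_cases hka : k = a
    · rw [hka, mida, transv_ne hal, mida]
      simp only [map_mul, map_inv, transv_ne hal, transv_ne hlb.symm]
    · rw [midne k hka hkl, transv_ne hkl, midne k hka hkl]
  have hD : conjIA (inversion l) mid = mid := by
    refine fixed_by_conjIA fun k => ?_
    by_cases hkl : k = l
    · rw [hkl, midl, inversion_self]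
      simp only [map_mul, map_inv, midl, inversion_self, inversion_ne hlb.symm]
      group
    by_cases hka : k = a
    · rw [hka, mida, inversion_ne hal, mida]
      simp only [map_mul, map_inv, inversion_ne hal, inversion_ne hlb.symm]
    · rw [midne k hka hkl, inversion_ne hkl, midne k hka hkl]
  -- of the two conjugates in `chi_conj_triple`, one is an anchor
  obtain ⟨φ, hφ1, hφ2, hφ, hχ⟩ : ∃ φ : MulAut (FreeGroup (Fin n)),
      (∀ x ∈ letters n, HasLen (letters n) 18 (conjIA φ x)) ∧
      (∀ x ∈ letters n, HasLen (letters n) 18 (conjIA φ⁻¹ x)) ∧ conjIA φ mid = mid ∧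
      M ≤ 2 * |(χ (conjIA φ R)).toAdd| := by
    have hc := chi_conj_triple χ hal hab hlb
    set X := (χ (conjGen a (FreeGroup.of b))).toAdd
    set X' := (χ (conjGen l (FreeGroup.of b))).toAdd
    set Y := (χ (commRight a (FreeGroup.of l) (FreeGroup.of b))).toAdd +
        (χ (commRight l (FreeGroup.of b)⁻¹ (FreeGroup.of a)⁻¹)).toAdd
    have hX : M ≤ 2 * |X - X'| := by
      have := abs_sub_abs_le_abs_sub X X'
      omega
    rcases abs_le_abs_sub_or (X - X') Y with h | h
    · refine ⟨inversion l * transv a l, fun x hx => ?_, fun x hx => ?_, ?_, ?_⟩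
      · rw [conjIA_mul]
        exact ((HasLen.of_mem hx).conjIA_transv hal).conjIA_inversion l
      · rw [mul_inv_rev, inversion_inv, conjIA_mul]
        exact ((HasLen.of_mem hx).conjIA_inversion l).conjIA_transv_inv hal
      · rw [conjIA_mul, hT, hD]
      · rw [hc.2]; omega
    · refine ⟨transv a l, fun x hx => (HasLen.of_mem hx).conjIA_transv hal,
        fun x hx => (HasLen.of_mem hx).conjIA_transv_inv hal, hT, ?_⟩
      rw [hc.1]; omega
  have htriple : TripleAnchor (χ.comp (conjIA φ).toMonoidHom) M a l b := ⟨hal, hab, hlb, hχ⟩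
  have hlink : Linked (letters n) χ M 144 (conjGen a (FreeGroup.of b)) (conjIA φ R) := by
    refine (Linked.single (y' := mid) ?_ ⟨?_, ?_⟩).trans (Linked.single ?_ ⟨?_, hχ⟩)
    · exact (Commute.refl _).mul_right (commute_conjGen_conjGen hal hab.symm hlb.symm)
    · exact ((hasLen_conjGen_of a b).mul (hasLen_conjGen_of l b)).mono (by omega)
    · rw [hmid, map_mul, toAdd_mul]
      set X := (χ (conjGen a (FreeGroup.of b))).toAdd
      set X' := (χ (conjGen l (FreeGroup.of b))).toAdd
      have := abs_sub_abs_le_abs_add X X'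
      omega
    · have := hcR.map (conjIA φ).toMonoidHom
      change Commute (conjIA φ mid) (conjIA φ R) at this
      rwa [hφ] at this
    · exact (hφ1 R (commRight_mem_letters a l b true true)).mono (by omega)
  -- transport the case of a triple anchor along `φ`
  have g1 := Good.of_hasLen (fun x hx => htriple.good_letters hn hx) (hφ2 x hx)
  have g2 := g1.map (S' := letters n) (conjIA φ).toMonoidHom (c := 18) hφ1
  have e : (conjIA φ).toMonoidHom (conjIA φ⁻¹ x) = x := conjIA_apply_inv φ x
  rw [e] at g2
  exact g2.of_linked hlink

/-- If the character `χ` takes a value of absolute value at least `M` at a Magnus generator, then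
all letters are good relative to that generator. The constants are `144 = 18 * 8` and
`2170800 = 18 * 18 * 6700`, where `8` and `6700` come from `TripleAnchor.good_letters` and `18`
bounds the growth of lengths under the changes of basis used and their inverses. -/
theorem good_letters_of_mem_magnusSet (hn : 8 ≤ n) {g : IA n} (hg : g ∈ magnusSet n) (hM0 : 0 ≤ M)
    (hM : M ≤ |(χ g).toAdd|) {x : IA n} (hx : x ∈ letters n) :
    Good (letters n) χ M 144 g 2170800 x := by
  rcases hg with ⟨a, b, hab, rfl⟩ | ⟨a, b, c, hab, hac, hbc, rfl⟩
  · rw [magnusPair_eq] at hM ⊢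
    by_cases h : ∀ l, l ≠ b → M ≤ 2 * |(χ (conjGen l (FreeGroup.of b))).toAdd|
    · exact ((good_letters_of_forall_conjGen hn hab h hx).mono_left (by omega)).mono (by omega)
    · push Not at h
      obtain ⟨l, hlb, hl⟩ := h
      have hal : a ≠ l := by rintro rfl; omega
      exact good_letters_of_exists_conjGen hn hab hal hlb hM hl hx
  · rw [magnusTriple_eq] at hM ⊢
    have h : TripleAnchor χ M a b c := ⟨hab, hac, hbc.ne, by omega⟩
    exact ((h.good_letters hn hx).mono_left (by omega)).mono (by omega)

end PairAnchor

/-! ### Norms on `ℤ^ι` -/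

section Lattice

open scoped Matrix

variable {ι : Type*} [Fintype ι]

/-- The squared Euclidean norm on `ℤ^ι`, as a natural number. -/
def sqNorm (a : ι → ℤ) : ℕ := (a ⬝ᵥ a).toNat

theorem coe_sqNorm (a : ι → ℤ) : (sqNorm a : ℤ) = a ⬝ᵥ a :=
  Int.toNat_of_nonneg (Finset.sum_nonneg fun m _ => mul_self_nonneg (a m))

/-- The `ℓ¹`-norm on `ℤ^ι`. -/
def oneNorm (a : ι → ℤ) : ℤ := ∑ m, |a m|

theorem oneNorm_nonneg (a : ι → ℤ) : 0 ≤ oneNorm a := Finset.sum_nonneg fun m _ => abs_nonneg (a m)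

theorem oneNorm_add (a b : ι → ℤ) : oneNorm (a + b) ≤ oneNorm a + oneNorm b := by
  rw [oneNorm, oneNorm, oneNorm, ← Finset.sum_add_distrib]
  exact Finset.sum_le_sum fun m _ => abs_add_le _ _

theorem oneNorm_zero : oneNorm (0 : ι → ℤ) = 0 := by simp [oneNorm]

theorem abs_le_oneNorm (a : ι → ℤ) (m : ι) : |a m| ≤ oneNorm a :=
  Finset.single_le_sum (f := fun m => |a m|) (fun m _ => abs_nonneg (a m)) (Finset.mem_univ m)

theorem dotProduct_le_mul_oneNorm {a : ι → ℤ} {M : ℤ} (h : ∀ m, |a m| ≤ M) (b : ι → ℤ) :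
    a ⬝ᵥ b ≤ M * oneNorm b := by
  rw [oneNorm, Finset.mul_sum]
  refine Finset.sum_le_sum fun m _ => (le_abs_self _).trans ?_
  rw [abs_mul]
  exact mul_le_mul_of_nonneg_right (h m) (abs_nonneg _)

theorem coe_sqNorm_add (a b : ι → ℤ) :
    (sqNorm (a + b) : ℤ) = sqNorm a + 2 * (a ⬝ᵥ b) + b ⬝ᵥ b := by
  rw [coe_sqNorm, coe_sqNorm, add_dotProduct, dotProduct_add, dotProduct_add, dotProduct_comm b a]
  ring

/-- Adding to `a` a vector with a long component in a direction of steep descent, and a short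
remainder, decreases the norm. -/
theorem sqNorm_add_lt {a c d : ι → ℤ} {M X R : ℤ} (hX : 0 < X) (ha : ∀ m, |a m| ≤ M)
    (hM : X * R ^ 2 < 2 * M) (hc : oneNorm c ≤ X) (hcd : oneNorm (c + d) ≤ X * R)
    (hd : 2 * (a ⬝ᵥ d) ≤ -(4 * X * M)) : sqNorm (a + (c + d)) < sqNorm a := by
  have h1 := coe_sqNorm_add a (c + d)
  have h2 : a ⬝ᵥ c ≤ M * X := by
    refine (dotProduct_le_mul_oneNorm ha c).trans (mul_le_mul_of_nonneg_left hc ?_)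
    nlinarith [sq_nonneg R]
  have h3 : (c + d) ⬝ᵥ (c + d) ≤ (X * R) ^ 2 := by
    refine (dotProduct_le_mul_oneNorm (abs_le_oneNorm (c + d)) _).trans ?_
    rw [← sq]
    exact pow_le_pow_left₀ (oneNorm_nonneg _) hcd 2
  rw [dotProduct_add] at h1
  have h4 : X * (X * R ^ 2) < X * (2 * M) := mul_lt_mul_of_pos_left hM hX
  zify
  rw [h1]
  nlinarith

theorem coe_sqNorm_add_single [DecidableEq ι] (a : ι → ℤ) (m : ι) (k : ℤ) :
    (sqNorm (a + Pi.single m k) : ℤ) = sqNorm a + 2 * k * a m + k ^ 2 := by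
  rw [coe_sqNorm_add, dotProduct_single, single_dotProduct, Pi.single_eq_same]
  ring

end Lattice

/-! ### Discrete Morse theory on Cayley graphs -/

section Connected

variable {G : Type*} [Group G]

/-- The vertices `u` and `v` are joined by a path in the part of the Cayley graph of `G` (for left
multiplication by elements of `T`) spanned by `P`. -/
def Conn (T P : Set G) : G → G → Prop :=
  Relation.ReflTransGen fun u v => u ∈ P ∧ v ∈ P ∧ ∃ x ∈ T, v = x * u

variable {T P : Set G}

theorem Conn.single {x u : G} (hx : x ∈ T) (hu : u ∈ P) (hxu : x * u ∈ P) :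
    Conn T P u (x * u) := Relation.ReflTransGen.single ⟨hu, hxu, x, hx, rfl⟩

theorem Conn.mono {Q : Set G} (h : P ⊆ Q) {u v : G} (huv : Conn T P u v) : Conn T Q u v :=
  Relation.ReflTransGen.mono (fun _ _ h' => ⟨h h'.1, h h'.2.1, h'.2.2⟩) _ _ huv

theorem Conn.symm (hT : ∀ x ∈ T, x⁻¹ ∈ T) {u v : G} (huv : Conn T P u v) : Conn T P v u := by
  induction huv with
  | refl => exact Relation.ReflTransGen.refl
  | tail _ hvw ih =>
    obtain ⟨hv, hw, x, hx, rfl⟩ := hvw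
    exact Relation.ReflTransGen.head ⟨hw, hv, x⁻¹, hT x hx, by group⟩ ih

theorem conn_univ (hT : ∀ x ∈ T, x⁻¹ ∈ T) (h : Subgroup.closure T = ⊤) (u v : G) :
    Conn T Set.univ u v := by
  suffices H : ∀ g : G, ∀ u, Conn T Set.univ u (g * u) by simpa using H (v * u⁻¹) u
  intro g
  induction (h ▸ Subgroup.mem_top g : g ∈ Subgroup.closure T) using Subgroup.closure_induction with
  | mem x hx => exact fun u => Conn.single hx trivial trivial
  | one => intro u; rw [one_mul]; exact Relation.ReflTransGen.refl
  | mul x y _ _ hx hy =>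
    intro u
    rw [mul_assoc]
    exact (hy u).trans (hx _)
  | inv x _ hx =>
    intro u
    have := (hx (x⁻¹ * u)).symm hT
    rwa [mul_inv_cancel_left] at this

theorem Conn.of_pow {y u : G} (hy : y ∈ T) {k : ℕ} (h : ∀ j ≤ k, y ^ j * u ∈ P) :
    Conn T P u (y ^ k * u) := by
  induction k with
  | zero => rw [pow_zero, one_mul]; exact Relation.ReflTransGen.refl
  | succ k ih =>
    refine (ih fun j hj => h j (by omega)).trans ?_
    have h1 := h (k + 1) le_rfl
    rw [pow_succ', mul_assoc] at h1 ⊢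
    exact Conn.single hy (h k (by omega)) h1

/-- Discrete Morse theory for the height function `f`: if the set `D` is closed under descent and
the descending neighbours of each vertex outside `D` are connected below that vertex, then paths
can be pushed down into `D`. -/
theorem conn_of_descending {D : Set G} {f : G → ℕ} (hT : ∀ x ∈ T, x⁻¹ ∈ T)
    (hne : ∀ x ∈ T, ∀ g, f (x * g) ≠ f g) (hD : ∀ x ∈ T, ∀ g ∈ D, f (x * g) < f g → x * g ∈ D)
    (hlocal : ∀ z, z ∉ D → ∀ x ∈ T, ∀ y ∈ T, f (x * z) < f z → f (y * z) < f z →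
      Conn T {g | f g < f z} (x * z) (y * z)) {u v : G} (hu : u ∈ D) (hv : v ∈ D)
    (huv : Conn T Set.univ u v) : Conn T D u v := by
  set Q : ℕ → Set G := fun h => {g | g ∈ D ∨ f g < h} with hQ
  have step : ∀ h, Conn T (Q (h + 1)) u v → Conn T (Q h) u v := by
    intro h hc
    -- walking along the path, a visit to a vertex of height exactly `h` outside `D` is replaced by
    -- the choice of a descending neighbour, since two such vertices are never adjacent
    have key : ∀ w, Conn T (Q (h + 1)) u w → (w ∈ Q h ∧ Conn T (Q h) u w) ∨
        (w ∉ D ∧ f w = h ∧ ∃ x ∈ T, f (x * w) < f w ∧ Conn T (Q h) u (x * w)) := by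
      intro w hw
      induction hw with
      | refl => exact .inl ⟨.inl hu, Relation.ReflTransGen.refl⟩
      | @tail v w _ hvw ih =>
        obtain ⟨hv, hw, y, hy, rfl⟩ := hvw
        have hyv : y⁻¹ * (y * v) = v := inv_mul_cancel_left y v
        rcases ih with ⟨hvQ, hc⟩ | ⟨hvD, hvh, x, hx, hlt, hc⟩
        · by_cases hwQ : y * v ∈ Q h
          · exact .inl ⟨hwQ, hc.trans (Conn.single hy hvQ hwQ)⟩
          · have hwD : y * v ∉ D := fun h' => hwQ (.inl h')
            have hwh : ¬ f (y * v) < h := fun h' => hwQ (.inr h')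
            have hwh' : f (y * v) < h + 1 := hw.resolve_left hwD
            have hlt : f v < h := by
              rcases hvQ with hvD | hlt
              · by_contra hge
                exact hwD (hD y hy v hvD (by have := hne y hy v; omega))
              · exact hlt
            refine .inr ⟨hwD, by omega, y⁻¹, hT y hy, ?_, ?_⟩
            · rw [hyv]; omega
            · rwa [hyv]
        · have hlt' : f (y * v) < f v := by
            by_contra hge
            have h1 := hne y hy v
            rcases hw with hwD | hlt'
            · refine hvD ?_
              have := hD y⁻¹ (hT y hy) (y * v) hwD (by rw [hyv]; omega)
              rwa [hyv] at this
            · omega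
          have h1 := hlocal v hvD x hx y hy hlt hlt'
          refine .inl ⟨.inr (by omega), hc.trans (h1.mono ?_)⟩
          intro g hg
          exact .inr (hvh ▸ hg)
    exact (key v hc).elim (fun h' => h'.2) fun h' => absurd hv h'.1
  have bounded : ∃ h, Conn T (Q h) u v := by
    clear hv step
    induction huv with
    | refl => exact ⟨0, Relation.ReflTransGen.refl⟩
    | @tail v w _ hvw ih =>
      obtain ⟨h, hc⟩ := ih
      obtain ⟨-, -, x, hx, rfl⟩ := hvw
      refine ⟨h + f v + f (x * v) + 1, (hc.mono ?_).trans (Conn.single hx (.inr ?_) (.inr ?_))⟩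
      · exact fun g hg => hg.imp_right fun hg => by omega
      · omega
      · omega
  obtain ⟨h, hc⟩ := bounded
  refine Conn.mono (P := Q 0) (fun g hg => hg.resolve_right (by omega)) ?_
  induction h with
  | zero => exact hc
  | succ h ih => exact ih (step h hc)

theorem conn_of_hasLen_steps {u z : G} {l : ℕ} (hu : HasLen T l u)
    (h : ∀ v, HasLen T l v → v * z ∈ P) : Conn T P z (u * z) := by
  obtain ⟨w, hw, hl, rfl⟩ := hu
  induction w with
  | nil => rw [List.prod_nil, one_mul]; exact Relation.ReflTransGen.refl
  | cons x w ih =>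
    rw [List.length_cons] at hl
    have hw' : ∀ y ∈ w, y ∈ T := fun y hy => hw y (by simp [hy])
    refine (ih hw' (by omega)).trans ?_
    have h1 := h _ ⟨x :: w, hw, hl, rfl⟩
    rw [List.prod_cons, mul_assoc] at h1 ⊢
    exact Conn.single (hw x (by simp)) (h _ ⟨w, hw', by omega, rfl⟩) h1

/-- If the elements of `Λ` are words of length at most `c` in `T`, a word in `Λ` spells a path for
the generators `T`, which stays close to the prefixes of the word. -/
theorem conn_of_hasLen {Λ : Set G} {c : ℕ} (hΛ : ∀ x ∈ Λ, HasLen T c x) {u z : G} {l : ℕ}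
    (hu : HasLen Λ l u) (h : ∀ v w, HasLen T c v → HasLen Λ l w → v * w * z ∈ P) :
    Conn T P z (u * z) := by
  obtain ⟨w, hw, hl, rfl⟩ := hu
  induction w with
  | nil => rw [List.prod_nil, one_mul]; exact Relation.ReflTransGen.refl
  | cons x w ih =>
    rw [List.length_cons] at hl
    have hw' : ∀ y ∈ w, y ∈ Λ := fun y hy => hw y (by simp [hy])
    refine (ih hw' (by omega)).trans ?_
    rw [List.prod_cons, mul_assoc]
    refine conn_of_hasLen_steps (hΛ x (hw x (by simp))) fun v hv => ?_
    rw [← mul_assoc]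
    exact h v _ hv ⟨w, hw', by omega, rfl⟩

end Connected

/-! ### Paths below a vertex with a large coordinate -/

section Descent

open scoped Matrix

variable {G ι : Type*} [Group G]

/-- The coordinate vector of an element of `G`, for a homomorphism from `G` to `ℤ^ι`. -/
def crd (p : G →* Multiplicative (ι → ℤ)) (g : G) : ι → ℤ := (p g).toAdd

variable {p : G →* Multiplicative (ι → ℤ)}

theorem crd_mul (g h : G) : crd p (g * h) = crd p g + crd p h := by simp [crd]

theorem crd_one : crd p 1 = 0 := by simp [crd]

theorem crd_inv (g : G) : crd p g⁻¹ = -crd p g := by simp [crd]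

theorem crd_pow (g : G) (k : ℕ) : crd p (g ^ k) = k • crd p g := by simp [crd]

variable [Fintype ι]

theorem HasLen.oneNorm_crd_le {S : Set G} (hS : ∀ x ∈ S, oneNorm (crd p x) ≤ 1) {l : ℕ} {g : G}
    (hg : HasLen S l g) : oneNorm (crd p g) ≤ l := by
  obtain ⟨w, hw, hl, rfl⟩ := hg
  suffices H : oneNorm (crd p w.prod) ≤ w.length from H.trans (by exact_mod_cast hl)
  clear hl
  induction w with
  | nil => simp [crd_one, oneNorm_zero]
  | cons x w ih =>
    rw [List.prod_cons, crd_mul, List.length_cons]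
    have h1 := hS x (hw x (by simp))
    have h2 := ih fun y hy => hw y (by simp [hy])
    have h3 := oneNorm_add (crd p x) (crd p w.prod)
    push_cast
    omega

/-- The character `g ↦ ⟨a, p g⟩`. -/
def pairing (p : G →* Multiplicative (ι → ℤ)) (a : ι → ℤ) : G →* Multiplicative ℤ where
  toFun g := Multiplicative.ofAdd (a ⬝ᵥ crd p g)
  map_one' := by rw [crd_one, dotProduct_zero]; rfl
  map_mul' g h := by rw [crd_mul, dotProduct_add]; rfl

theorem toAdd_pairing (a : ι → ℤ) (g : G) : (pairing p a g).toAdd = a ⬝ᵥ crd p g := rfl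

/-- The elements that are lower than `z`. -/
def lower (p : G →* Multiplicative (ι → ℤ)) (z : G) : Set G :=
  {g | sqNorm (crd p g) < sqNorm (crd p z)}

variable {T Λ : Set G} {c L W : ℕ} {M : ℤ} {z : G}

theorem oneNorm_nsmul (k : ℕ) (a : ι → ℤ) : oneNorm (k • a) = k * oneNorm a := by
  simp [oneNorm, Finset.mul_sum, abs_mul]

/-- Two alphabets for words in `G`, closed under inversion: elements of `T` and of `Λ` have
coordinate vectors of norm at most `1`, and elements of `Λ` are words of length at most `c`
in `T`. -/
structure IsAlphabet (p : G →* Multiplicative (ι → ℤ)) (T Λ : Set G) (c : ℕ) : Prop where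
  inv_mem : ∀ x ∈ T, x⁻¹ ∈ T
  inv_mem' : ∀ x ∈ Λ, x⁻¹ ∈ Λ
  oneNorm_le : ∀ x ∈ T, oneNorm (crd p x) ≤ 1
  oneNorm_le' : ∀ x ∈ Λ, oneNorm (crd p x) ≤ 1
  hasLen : ∀ x ∈ Λ, HasLen T c x

/-- The coordinates of `z` are bounded by `M`, which is large in comparison with the lengths `L` and
`W`. -/
structure IsDeep (p : G →* Multiplicative (ι → ℤ)) (z : G) (M : ℤ) (L W : ℕ) : Prop where
  abs_le : ∀ m, |crd p z m| ≤ M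
  lt_two_mul : ((L + W : ℕ) : ℤ) * (8 * L + 1) ^ 2 < 2 * M
  pos : 0 < L

/-- Far down in the direction of the anchors `y` and `y'`, short detours stay below `z`. -/
theorem mem_lower_of_anchor (hz : IsDeep p z M L W) {y y' : G}
    (hyl : oneNorm (crd p y) ≤ L) (hyl' : oneNorm (crd p y') ≤ L)
    (hy : 2 * (crd p z ⬝ᵥ crd p y) ≤ -M)
    (hy' : 2 * (crd p z ⬝ᵥ crd p y') ≤ -M) {i : ℕ} (hi : i ≤ 4 * (L + W)) {v : G}
    (hv : oneNorm (crd p v) ≤ (L + W : ℕ)) {g : G}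
    (hg : crd p g = crd p (v * (y' ^ i * y ^ (4 * (L + W))) * z)) : g ∈ lower p z := by
  obtain ⟨ha, hM, hL⟩ := hz
  change sqNorm _ < sqNorm _
  set X : ℕ := L + W with hX
  have hM0 : 0 ≤ M := by nlinarith [sq_nonneg (8 * (L : ℤ) + 1)]
  rw [hg, crd_mul, crd_mul, crd_mul, add_comm]
  have h1 : oneNorm (crd p (y' ^ i)) ≤ 4 * X * L := by
    rw [crd_pow, oneNorm_nsmul]
    have : (i : ℤ) ≤ 4 * X := by exact_mod_cast hi
    exact mul_le_mul this hyl' (oneNorm_nonneg _) (by positivity)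
  have h2 : oneNorm (crd p (y ^ (4 * X))) ≤ 4 * X * L := by
    rw [crd_pow, oneNorm_nsmul]
    push_cast
    exact mul_le_mul_of_nonneg_left hyl (by positivity)
  refine sqNorm_add_lt (M := M) (X := X) (R := 8 * L + 1) (by exact_mod_cast (by omega)) ha
    (by linarith) hv ?_ ?_
  · have h3 := oneNorm_add (crd p v) (crd p (y' ^ i) + crd p (y ^ (4 * X)))
    have h4 := oneNorm_add (crd p (y' ^ i)) (crd p (y ^ (4 * X)))
    linarith
  · rw [dotProduct_add, crd_pow, crd_pow, dotProduct_smul, dotProduct_smul]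
    simp only [nsmul_eq_mul]
    have h3 : (i : ℤ) * (2 * (crd p z ⬝ᵥ crd p y')) ≤ 0 :=
      mul_nonpos_of_nonneg_of_nonpos (by positivity) (by linarith)
    have h4 : ((4 * X : ℕ) : ℤ) * (2 * (crd p z ⬝ᵥ crd p y)) ≤ ((4 * X : ℕ) : ℤ) * -M :=
      mul_le_mul_of_nonneg_left hy (by positivity)
    push_cast at h4 ⊢
    linarith

/-- Far down in the direction of an anchor, an element commuting with the anchor can be inserted
letter by letter. -/
theorem conn_lower_of_commute (hΛ : IsAlphabet p T Λ c) (hz : IsDeep p z M L (W + c))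
    {y u w : G} (hy : HasLen Λ L y)
    (hχ : 2 * (crd p z ⬝ᵥ crd p y) ≤ -M) {l : ℕ} (hu : HasLen Λ l u)
    (huy : Commute u y) (hw : oneNorm (crd p w) + l ≤ W) :
    Conn T (lower p z) (y ^ (4 * (L + (W + c))) * w * z)
      (y ^ (4 * (L + (W + c))) * (u * w) * z) := by
  have e : y ^ (4 * (L + (W + c))) * (u * w) * z = u * (y ^ (4 * (L + (W + c))) * w * z) := by
    simp only [← mul_assoc, (huy.pow_right _).eq]
  rw [e]
  refine conn_of_hasLen hΛ.hasLen hu fun v v' hv hv' => ?_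
  refine mem_lower_of_anchor (W := W + c) (v := v * v' * w) (y := y) (y' := y) (i := 0) hz
    (hy.oneNorm_crd_le hΛ.oneNorm_le') (hy.oneNorm_crd_le hΛ.oneNorm_le') hχ hχ (by omega) ?_ ?_
  · rw [crd_mul, crd_mul]
    have h1 := oneNorm_add (crd p v + crd p v') (crd p w)
    have h2 := oneNorm_add (crd p v) (crd p v')
    have h3 := hv.oneNorm_crd_le hΛ.oneNorm_le
    have h4 := hv'.oneNorm_crd_le hΛ.oneNorm_le'
    push_cast
    omega
  · simp only [crd_mul, pow_zero, crd_one]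
    abel

theorem conn_lower_mul_anchor (hΛ : IsAlphabet p T Λ c) (hz : IsDeep p z M L (W + c))
    {y y' w : G} (hy : HasLen Λ L y)
    (hχ : 2 * (crd p z ⬝ᵥ crd p y) ≤ -M) (hy' : HasLen Λ L y')
    (hχ' : 2 * (crd p z ⬝ᵥ crd p y') ≤ -M) (hw : oneNorm (crd p w) ≤ W) {k : ℕ}
    (hk : k ≤ 4 * (L + (W + c))) :
    Conn T (lower p z) (y ^ (4 * (L + (W + c))) * w * z)
      (y' ^ k * (y ^ (4 * (L + (W + c))) * w * z)) := by
  induction k with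
  | zero => rw [pow_zero, one_mul]; exact Relation.ReflTransGen.refl
  | succ k ih =>
    refine (ih (by omega)).trans ?_
    rw [pow_succ', mul_assoc y']
    refine conn_of_hasLen hΛ.hasLen hy' fun v v' hv hv' => ?_
    refine mem_lower_of_anchor (W := W + c) (v := v * v' * w) (y := y) (y' := y') (i := k) hz
      (hy.oneNorm_crd_le hΛ.oneNorm_le') (hy'.oneNorm_crd_le hΛ.oneNorm_le') hχ hχ' (by omega) ?_ ?_
    · rw [crd_mul, crd_mul]
      have h1 := oneNorm_add (crd p v + crd p v') (crd p w)
      have h2 := oneNorm_add (crd p v) (crd p v')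
      have h3 := hv.oneNorm_crd_le hΛ.oneNorm_le
      have h4 := hv'.oneNorm_crd_le hΛ.oneNorm_le'
      push_cast
      omega
    · simp only [crd_mul]
      abel

/-- High powers of commuting anchors are connected through their products. -/
theorem conn_lower_of_commute_anchor (hΛ : IsAlphabet p T Λ c) (hz : IsDeep p z M L (W + c))
    {y y' w : G} (hy : HasLen Λ L y)
    (hχ : 2 * (crd p z ⬝ᵥ crd p y) ≤ -M) (hy' : HasLen Λ L y')
    (hχ' : 2 * (crd p z ⬝ᵥ crd p y') ≤ -M) (hyy' : Commute y y')
    (hw : oneNorm (crd p w) ≤ W) :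
    Conn T (lower p z) (y ^ (4 * (L + (W + c))) * w * z)
      (y' ^ (4 * (L + (W + c))) * w * z) := by
  have h1 := conn_lower_mul_anchor hΛ hz hy hχ hy' hχ' hw le_rfl
  have h2 := conn_lower_mul_anchor hΛ hz hy' hχ' hy hχ hw le_rfl
  refine h1.trans (Conn.symm hΛ.inv_mem ?_)
  have e := (hyy'.pow_pow (4 * (L + (W + c))) (4 * (L + (W + c)))).eq
  rw [← mul_assoc, ← mul_assoc, ← e, mul_assoc _ _ w, mul_assoc _ _ z]
  rw [← mul_assoc] at h2 ⊢
  rwa [← mul_assoc] at h2 ⊢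

/-- Along a chain of anchors, each of them or its inverse points downwards; high powers of the ends
are connected. -/
theorem conn_lower_of_linked (hΛ : IsAlphabet p T Λ c) (hz : IsDeep p z M L (W + c))
    {y₀ y : G} (h : Linked Λ (pairing p (crd p z)) M L y₀ y)
    (hy₀ : HasLen Λ L y₀) (hχ : 2 * (crd p z ⬝ᵥ crd p y₀) ≤ -M) :
    ∃ y', (y' = y ∨ y' = y⁻¹) ∧ HasLen Λ L y' ∧ 2 * (crd p z ⬝ᵥ crd p y') ≤ -M ∧
      ∀ w, oneNorm (crd p w) ≤ W → Conn T (lower p z) (y₀ ^ (4 * (L + (W + c))) * w * z)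
        (y' ^ (4 * (L + (W + c))) * w * z) := by
  induction h with
  | refl => exact ⟨y₀, .inl rfl, hy₀, hχ, fun w _ => Relation.ReflTransGen.refl⟩
  | @tail u v _ huv ih =>
    obtain ⟨u', hu', hul, huχ, hc⟩ := ih
    obtain ⟨hcomm, hvl, hvχ⟩ := huv
    rw [toAdd_pairing] at hvχ
    have hcomm' : Commute u' v := by
      rcases hu' with rfl | rfl
      · exact hcomm
      · exact hcomm.inv_left
    rcases abs_choice (crd p z ⬝ᵥ crd p v) with h | h <;> rw [h] at hvχ
    · have h1 : 2 * (crd p z ⬝ᵥ crd p v⁻¹) ≤ -M := by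
        rw [crd_inv, dotProduct_neg]; linarith
      exact ⟨v⁻¹, .inr rfl, hvl.inv hΛ.inv_mem', h1, fun w hw => (hc w hw).trans
        (conn_lower_of_commute_anchor hΛ hz hul huχ (hvl.inv hΛ.inv_mem') h1
          hcomm'.inv_right hw)⟩
    · exact ⟨v, .inl rfl, hvl, by linarith, fun w hw => (hc w hw).trans
        (conn_lower_of_commute_anchor hΛ hz hul huχ hvl (by linarith)
          hcomm' hw)⟩

/-- Below `z`, a good element `u` can be inserted after a high power of the anchor `y₀`: high
powers of consecutive anchors in a chain are connected below `z`, and a factor of `u` can be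
inserted one letter at a time after a power of an anchor commuting with it. -/
theorem conn_lower_of_good (hΛ : IsAlphabet p T Λ c) (hz : IsDeep p z M L (W + c))
    {y₀ y₁ : G} {l : ℕ} {u : G}
    (hu : Good Λ (pairing p (crd p z)) M L y₁ l u) (hy₁ : y₁ = y₀ ∨ y₁ = y₀⁻¹)
    (hy₀ : HasLen Λ L y₀) (hχ : 2 * (crd p z ⬝ᵥ crd p y₀) ≤ -M) {w : G}
    (hw : oneNorm (crd p w) + l ≤ W) :
    Conn T (lower p z) (y₀ ^ (4 * (L + (W + c))) * w * z)
      (y₀ ^ (4 * (L + (W + c))) * (u * w) * z) := by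
  have hnorm : ∀ {l u}, Good Λ (pairing p (crd p z)) M L y₁ l u → oneNorm (crd p u) ≤ l := by
    intro l u hu
    induction hu with
    | basic _ _ hu => exact hu.oneNorm_crd_le hΛ.oneNorm_le'
    | @mul _ _ u v _ _ ih1 ih2 =>
      rw [crd_mul]
      have := oneNorm_add (crd p u) (crd p v)
      push_cast
      omega
  induction hu generalizing w with
  | @basic l u y hy hc hu =>
    have hlink : Linked Λ (pairing p (crd p z)) M L y₀ y := by
      refine Relation.ReflTransGen.head ⟨?_, ?_⟩ hy
      · rcases hy₁ with rfl | rfl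
        · exact Commute.refl _
        · exact (Commute.refl _).inv_right
      · have : HasLen Λ L y₁ := by
          rcases hy₁ with rfl | rfl
          · exact hy₀
          · exact hy₀.inv hΛ.inv_mem'
        refine ⟨this, ?_⟩
        rw [toAdd_pairing]
        have h1 : |crd p z ⬝ᵥ crd p y₁| = |crd p z ⬝ᵥ crd p y₀| := by
          rcases hy₁ with rfl | rfl
          · rfl
          · rw [crd_inv, dotProduct_neg, abs_neg]
        rw [h1]
        have := neg_le_abs (crd p z ⬝ᵥ crd p y₀)
        linarith
    obtain ⟨y', hy', hyl, hyχ, hconn⟩ :=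
      conn_lower_of_linked hΛ hz hlink hy₀ hχ
    have hc' : Commute u y' := by
      rcases hy' with rfl | rfl
      · exact hc
      · exact hc.inv_right
    refine ((hconn w (by omega)).trans (conn_lower_of_commute hΛ hz hyl hyχ hu hc'
      hw)).trans (Conn.symm hΛ.inv_mem (hconn (u * w) ?_))
    have h1 := hu.oneNorm_crd_le hΛ.oneNorm_le'
    have h2 := oneNorm_add (crd p u) (crd p w)
    rw [crd_mul]
    omega
  | @mul l m u v hu hv ih1 ih2 =>
    push_cast at hw
    have h1 := hnorm hv
    have h2 := oneNorm_add (crd p v) (crd p w)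
    have h3 := hnorm hu
    have h4 := oneNorm_nonneg (crd p u)
    rw [mul_assoc u v w]
    refine (ih2 (w := w) (by omega)).trans (ih1 (w := v * w) ?_)
    rw [crd_mul]
    omega

end Descent

/-! ### Connectedness of the core -/

section Core

open scoped Matrix

variable {G ι : Type*} [Group G] {p : G →* Multiplicative (ι → ℤ)}
  {s : ι → G} {Λ : Set G} {c L W : ℕ} {z : G}

/-- The exponent vectors that are bounded by `B` and supported on generators each of which
fails to commute with one of two fixed generators. -/
def coreVectors (s : ι → G) (B : ℤ) : Set (ι → ℤ) :=
  {a | (∀ m, |a m| < B) ∧ ∃ i j, ∀ m, a m ≠ 0 → ¬ Commute (s m) (s i) ∨ ¬ Commute (s m) (s j)}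

theorem update_mem_coreVectors [DecidableEq ι] {B : ℤ} {a : ι → ℤ} (ha : a ∈ coreVectors s B)
    {i : ι} {k : ℤ} (hk : |k| ≤ |a i|) : Function.update a i k ∈ coreVectors s B := by
  obtain ⟨hb, u, v, huv⟩ := ha
  refine ⟨fun m => ?_, u, v, fun m hm => huv m ?_⟩
  · by_cases h : m = i
    · subst h; rw [Function.update_self]; exact hk.trans_lt (hb m)
    · rw [Function.update_of_ne h]; exact hb m
  · by_cases h : m = i
    · subst h
      rw [Function.update_self] at hm
      intro h0
      rw [h0, abs_zero] at hk
      exact hm (abs_nonpos_iff.1 hk)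
    · rwa [Function.update_of_ne h] at hm

/-- The elements lying over the core vectors. -/
def core (p : G →* Multiplicative (ι → ℤ)) (s : ι → G) (B : ℤ) : Set G :=
  {g | crd p g ∈ coreVectors s B}

/-- The generators and their inverses. -/
def signed (s : ι → G) : Set G := Set.range s ∪ (Set.range s)⁻¹

theorem exists_zpow_of_mem_signed {x : G} (hx : x ∈ signed s) :
    ∃ m, ∃ ε : ℤ, (ε = 1 ∨ ε = -1) ∧ x = s m ^ ε := by
  rcases hx with ⟨m, rfl⟩ | ⟨m, hm⟩
  · exact ⟨m, 1, .inl rfl, (zpow_one _).symm⟩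
  · exact ⟨m, -1, .inr rfl, by rw [zpow_neg, zpow_one, hm, inv_inv]⟩

theorem zpow_mem_signed (m : ι) {ε : ℤ} (hε : ε = 1 ∨ ε = -1) : s m ^ ε ∈ signed s := by
  rcases hε with rfl | rfl
  · rw [zpow_one]; exact .inl ⟨m, rfl⟩
  · rw [zpow_neg, zpow_one]; exact .inr ⟨m, by simp⟩

variable [DecidableEq ι]

theorem crd_zpow (hs : ∀ m, crd p (s m) = Pi.single m 1) (m : ι) (k : ℤ) :
    crd p (s m ^ k) = Pi.single m k := by
  have : crd p (s m ^ k) = k • crd p (s m) := by simp [crd]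
  rw [this, hs, ← Pi.single_smul, smul_eq_mul, mul_one]

variable [Fintype ι]

theorem sqNorm_crd_zpow_mul (hs : ∀ m, crd p (s m) = Pi.single m 1)
    (m : ι) (k : ℤ) (g : G) :
    (sqNorm (crd p (s m ^ k * g)) : ℤ) = sqNorm (crd p g) + 2 * k * crd p g m + k ^ 2 := by
  rw [crd_mul, crd_zpow hs, add_comm, coe_sqNorm_add_single]

theorem two_mul_add_one_neg (hs : ∀ m, crd p (s m) = Pi.single m 1)
    {m : ι} {ε : ℤ} (hε : ε = 1 ∨ ε = -1)
    (h : sqNorm (crd p (s m ^ ε * z)) < sqNorm (crd p z)) : 2 * ε * crd p z m + 1 < 0 := by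
  have h1 := sqNorm_crd_zpow_mul hs m ε z
  have h2 : ε ^ 2 = 1 := by rcases hε with rfl | rfl <;> norm_num
  rw [h2] at h1
  omega

/-- Two descending commuting edges at `z` span a square, the opposite corner of which is lower. -/
theorem conn_lower_of_commute_gen (hs : ∀ m, crd p (s m) = Pi.single m 1)
    {i m : ι} {ε δ : ℤ} (hε : ε = 1 ∨ ε = -1)
    (hδ : δ = 1 ∨ δ = -1) (hi : 2 * ε * crd p z i + 1 < 0) (hm : 2 * δ * crd p z m + 1 < 0)
    (hc : Commute (s i) (s m)) : Conn (signed s) (lower p z) (s i ^ ε * z) (s m ^ δ * z) := by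
  by_cases him : i = m
  · subst him
    have : ε = δ := by rcases hε with rfl | rfl <;> rcases hδ with rfl | rfl <;> omega
    rw [this]
    exact Relation.ReflTransGen.refl
  have hε2 : ε ^ 2 = 1 := by rcases hε with rfl | rfl <;> norm_num
  have hδ2 : δ ^ 2 = 1 := by rcases hδ with rfl | rfl <;> norm_num
  have h1 := sqNorm_crd_zpow_mul hs i ε z
  have h2 := sqNorm_crd_zpow_mul hs m δ z
  have h3 := sqNorm_crd_zpow_mul hs i ε (s m ^ δ * z)
  have h4 : crd p (s m ^ δ * z) i = crd p z i := by
    rw [crd_mul, crd_zpow hs, Pi.add_apply, Pi.single_eq_of_ne him, zero_add]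
  rw [h4] at h3
  have e : s m ^ δ * (s i ^ ε * z) = s i ^ ε * (s m ^ δ * z) := by
    rw [← mul_assoc, ← mul_assoc, (hc.zpow_zpow ε δ).eq]
  have m1 : s i ^ ε * z ∈ lower p z := by change sqNorm _ < sqNorm _; omega
  have m2 : s m ^ δ * z ∈ lower p z := by change sqNorm _ < sqNorm _; omega
  have m3 : s i ^ ε * (s m ^ δ * z) ∈ lower p z := by
    change sqNorm _ < sqNorm _
    omega
  have c1 := Conn.single (zpow_mem_signed m hδ) m1 (e ▸ m3)
  rw [e] at c1
  refine c1.trans (Relation.ReflTransGen.single ⟨m3, m2, s i ^ (-ε), zpow_mem_signed i ?_, ?_⟩)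
  · omega
  · group

/-- At a vertex `z` with a large coordinate, any descending edge is connected below `z` to the
descending edge in the direction of the largest coordinate. -/
theorem conn_lower_of_isDeep (hs : ∀ m, crd p (s m) = Pi.single m 1)
    {M : ℤ} (hΛ : IsAlphabet p (signed s) Λ c)
    (hsΛ : signed s ⊆ Λ) (hz : IsDeep p z M L (W + c)) {i m : ι} {ε δ : ℤ}
    (hε : ε = 1 ∨ ε = -1) (hδ : δ = 1 ∨ δ = -1) (hi : 2 * ε * crd p z i + 1 < 0)
    (hm : δ * crd p z m = -M)
    (hgood : Good Λ (pairing p (crd p z)) M L (s m) W (s i ^ ε)) :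
    Conn (signed s) (lower p z) (s i ^ ε * z) (s m ^ δ * z) := by
  have hX := hz.lt_two_mul
  have hL := hz.pos
  set X : ℕ := L + (W + c) with hXdef
  have hX0 : (0 : ℤ) < X := by exact_mod_cast (by omega)
  have hXM : 4 * (X : ℤ) < 2 * M := by
    have : (4 : ℤ) ≤ (8 * L + 1) ^ 2 := by
      have : (1 : ℤ) ≤ L := by exact_mod_cast hL
      nlinarith
    nlinarith
  have hε2 : ε ^ 2 = 1 := by rcases hε with rfl | rfl <;> norm_num
  have hδ2 : δ ^ 2 = 1 := by rcases hδ with rfl | rfl <;> norm_num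
  by_cases him : i = m
  · subst him
    have : ε = δ := by
      rcases hε with rfl | rfl <;> rcases hδ with rfl | rfl <;> first | rfl | omega
    rw [this]
    exact Relation.ReflTransGen.refl
  have hpow : ∀ j : ℕ, (s m ^ δ) ^ j = s m ^ (δ * j) := fun j => by
    rw [zpow_mul, zpow_natCast]
  have low : ∀ g : G, crd p g m = crd p z m → ∀ j : ℕ, j ≤ 4 * X →
      (sqNorm (crd p ((s m ^ δ) ^ j * g)) : ℤ) ≤ sqNorm (crd p g) - j := by
    intro g hg j hj
    rw [hpow, sqNorm_crd_zpow_mul hs, hg]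
    have h1 : (j : ℤ) ≤ 4 * X := by exact_mod_cast hj
    have h2 : 2 * (δ * (j : ℤ)) * crd p z m = -2 * j * M := by linear_combination 2 * j * hm
    have h3 : (δ * (j : ℤ)) ^ 2 = j * j := by rw [mul_pow, hδ2]; ring
    rw [h2, h3]
    have h4 : (0 : ℤ) ≤ j := by positivity
    nlinarith
  -- descend from both neighbours in the direction of the largest coordinate; there the two
  -- descents are connected, as the edge `s i ^ ε` is good
  have c1 : Conn (signed s) (lower p z) (s i ^ ε * z) ((s m ^ δ) ^ (4 * X) * (s i ^ ε * z)) := by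
    refine Conn.of_pow (zpow_mem_signed m hδ) fun j hj => ?_
    have h1 := low (s i ^ ε * z) (by
      rw [crd_mul, crd_zpow hs, Pi.add_apply, Pi.single_eq_of_ne (Ne.symm him), zero_add]) j hj
    have h2 := sqNorm_crd_zpow_mul hs i ε z
    change sqNorm _ < sqNorm _
    omega
  have c2 : Conn (signed s) (lower p z) (s m ^ δ * z) ((s m ^ δ) ^ (4 * X) * z) := by
    have hsucc : ∀ j : ℕ, (s m ^ δ) ^ j * (s m ^ δ * z) = (s m ^ δ) ^ (j + 1) * z := fun j => by
      rw [pow_succ, mul_assoc]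
    have h1 : Conn (signed s) (lower p z) (s m ^ δ * z)
        ((s m ^ δ) ^ (4 * X - 1) * (s m ^ δ * z)) := by
      refine Conn.of_pow (zpow_mem_signed m hδ) fun j hj => ?_
      have h1 := low z rfl (j + 1) (by omega)
      rw [hsucc]
      change sqNorm _ < sqNorm _
      push_cast at h1
      omega
    rwa [hsucc, Nat.sub_add_cancel (by omega)] at h1
  have c3 := conn_lower_of_good hΛ hz hgood (y₀ := s m ^ δ) (w := 1) ?_ ?_ ?_ ?_
  · rw [mul_one, mul_one, mul_assoc] at c3
    exact (c1.trans (Conn.symm hΛ.inv_mem c3)).trans (Conn.symm hΛ.inv_mem c2)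
  · rcases hδ with rfl | rfl
    · exact .inl (zpow_one _).symm
    · exact .inr (by rw [zpow_neg, zpow_one, inv_inv])
  · exact (HasLen.of_mem (hsΛ (zpow_mem_signed m hδ))).mono hL
  · rw [crd_zpow hs, dotProduct_single, mul_comm, mul_comm _ δ, hm]
    linarith
  · rw [crd_one, oneNorm_zero, zero_add]

/-- The part of the Cayley graph spanned by the core is connected. -/
theorem conn_core (hs : ∀ m, crd p (s m) = Pi.single m 1)
    {B : ℤ} (hΛ : IsAlphabet p (signed s) Λ c) (hsΛ : signed s ⊆ Λ)
    (hgen : Subgroup.closure (Set.range s) = ⊤) (hL : 0 < L)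
    (hB : ((L + (W + c) : ℕ) : ℤ) * (8 * L + 1) ^ 2 < 2 * B)
    (hgood : ∀ (χ : G →* Multiplicative ℤ) (M : ℤ) (m : ι), 0 ≤ M → M ≤ |(χ (s m)).toAdd| →
      ∀ x ∈ Λ, Good Λ χ M L (s m) W x) {u v : G} (hu : u ∈ core p s B) (hv : v ∈ core p s B) :
    Conn (signed s) (core p s B) u v := by
  have hgen' : Subgroup.closure (signed s) = ⊤ := by
    rw [signed, Subgroup.closure_union, Subgroup.closure_inv, sup_idem, hgen]
  refine conn_of_descending (f := fun g => sqNorm (crd p g)) hΛ.inv_mem ?_ ?_ ?_ hu hv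
    (conn_univ hΛ.inv_mem hgen' u v)
  · intro x hx g
    obtain ⟨m, ε, hε, rfl⟩ := exists_zpow_of_mem_signed hx
    have h1 := sqNorm_crd_zpow_mul hs m ε g
    rcases hε with rfl | rfl <;> norm_num at h1 ⊢ <;> omega
  · intro x hx g hg hlt
    obtain ⟨m, ε, hε, rfl⟩ := exists_zpow_of_mem_signed hx
    have h1 := two_mul_add_one_neg hs hε hlt
    obtain ⟨hb, i, j, hij⟩ := hg
    have key : ∀ k, |crd p (s m ^ ε * g) k| ≤ |crd p g k| := by
      intro k
      rw [crd_mul, crd_zpow hs, Pi.add_apply]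
      by_cases hk : k = m
      · subst hk
        rw [Pi.single_eq_same]
        rcases hε with rfl | rfl
        · rw [abs_of_nonpos (a := 1 + _) (by omega), abs_of_nonpos (by omega)]; omega
        · rw [abs_of_nonneg (a := -1 + _) (by omega), abs_of_nonneg (by omega)]; omega
      · rw [Pi.single_eq_of_ne hk, zero_add]
    refine ⟨fun k => (key k).trans_lt (hb k), i, j, fun k hk => hij k ?_⟩
    intro h0
    have := key k
    rw [h0, abs_zero] at this
    exact hk (abs_nonpos_iff.1 this)
  · intro z hz x hx y hy hxz hyz
    obtain ⟨i, ε, hε, rfl⟩ := exists_zpow_of_mem_signed hx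
    obtain ⟨j, δ, hδ, rfl⟩ := exists_zpow_of_mem_signed hy
    have hi := two_mul_add_one_neg hs hε hxz
    have hj := two_mul_add_one_neg hs hδ hyz
    have hsymm := fun {u v} (h : Conn (signed s) (lower p z) u v) => Conn.symm hΛ.inv_mem h
    -- Either some generator in the support of `z` commutes with both edges, and descending along
    -- it connects them, or `z` is outside the core only because of a large coordinate.
    by_cases hcase : ∃ m, crd p z m ≠ 0 ∧ Commute (s i) (s m) ∧ Commute (s j) (s m)
    · obtain ⟨m, hm0, him, hjm⟩ := hcase
      obtain ⟨η, hη, hm⟩ : ∃ η : ℤ, (η = 1 ∨ η = -1) ∧ 2 * η * crd p z m + 1 < 0 := by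
        rcases lt_or_gt_of_ne hm0 with h | h
        · exact ⟨1, .inl rfl, by omega⟩
        · exact ⟨-1, .inr rfl, by omega⟩
      exact (conn_lower_of_commute_gen hs hε hη hi hm him).trans
        (hsymm (conn_lower_of_commute_gen hs hδ hη hj hm hjm))
    · push Not at hcase
      have hbig : ∃ m, B ≤ |crd p z m| := by
        by_contra! h
        refine hz ⟨h, i, j, fun m hm => ?_⟩
        by_contra! hc
        exact hcase m hm hc.1.symm hc.2.symm
      obtain ⟨m₀, hm₀⟩ := hbig
      obtain ⟨m, -, hmax⟩ := Finset.exists_max_image Finset.univ (fun m => |crd p z m|)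
        ⟨m₀, Finset.mem_univ _⟩
      have hdeep : IsDeep p z |crd p z m| L (W + c) :=
        ⟨fun k => hmax k (Finset.mem_univ _), by
          have := hmax m₀ (Finset.mem_univ _)
          linarith, hL⟩
      obtain ⟨η, hη, hm⟩ : ∃ η : ℤ, (η = 1 ∨ η = -1) ∧ η * crd p z m = -|crd p z m| := by
        rcases abs_choice (crd p z m) with h | h
        · exact ⟨-1, .inr rfl, by rw [h]; ring⟩
        · exact ⟨1, .inl rfl, by rw [h]; ring⟩
      have hg : ∀ x ∈ signed s, Good Λ (pairing p (crd p z)) |crd p z m| L (s m) W x := by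
        intro x hx
        refine hgood _ _ m (abs_nonneg _) ?_ x (hsΛ hx)
        rw [toAdd_pairing, hs, dotProduct_single, mul_one]
      exact (conn_lower_of_isDeep hs hΛ hsΛ hdeep hε hη hi hm (hg _ hx)).trans
        (hsymm (conn_lower_of_isDeep hs hΛ hsΛ hdeep hδ hη hj hm (hg _ hy)))

end Core

/-! ### From paths to commutators -/

section Transversal

variable {G : Type*} [Group G] {N : ℕ} (s : Fin N → G)

/-- The elements `[s_i, s_j]` with `i < j`, conjugated by the products
`s_i ^ a_i * ⋯ * s_N ^ a_N` with `a` in `Q`. -/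
def tailCommutators (Q : Set (Fin N → ℤ)) : Set G :=
  {g | ∃ (i j : Fin N) (a : Fin N → ℤ), i < j ∧ a ∈ Q ∧
    g = rconj (rcomm (s i) (s j)) (tailProd s i a)}

theorem rconj_rcomm_mem_commutator (x y z : G) : rconj (rcomm x y) z ∈ commutator G := by
  have h2 : rcomm x y ∈ commutator G := by
    have h1 := Subgroup.commutator_mem_commutator (Subgroup.mem_top x⁻¹) (Subgroup.mem_top y⁻¹)
    rw [commutatorElement_def, inv_inv, inv_inv] at h1
    exact h1
  have := (inferInstance : (commutator G).Normal).conj_mem _ h2 z⁻¹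
  rwa [inv_inv] at this

/-- The product `∏ s_m ^ a_m` over the list `l`. -/
def listProd (l : List (Fin N)) (a : Fin N → ℤ) : G := (l.map fun m => s m ^ a m).prod

theorem listProd_cons (i : Fin N) (l : List (Fin N)) (a : Fin N → ℤ) :
    listProd s (i :: l) a = s i ^ a i * listProd s l a := by simp [listProd]

theorem listProd_congr {l : List (Fin N)} {a b : Fin N → ℤ} (h : ∀ m ∈ l, a m = b m) :
    listProd s l a = listProd s l b := by
  rw [listProd, listProd, List.map_congr_left fun m hm => by rw [h m hm]]

theorem lt_of_cons_suffix {i : Fin N} {l : List (Fin N)} (h : i :: l <:+ List.finRange N)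
    {m : Fin N} (hm : m ∈ l) : i < m := by
  have h1 : (i :: l).Pairwise (· < ·) := (List.pairwise_lt_finRange N).sublist h.sublist
  exact List.rel_of_pairwise_cons h1 hm

theorem tailProd_eq_listProd {i : Fin N} {l : List (Fin N)} (h : i :: l <:+ List.finRange N)
    (a : Fin N → ℤ) : tailProd s i a = listProd s (i :: l) a := by
  have hlt := fun m (hm : m ∈ l) => lt_of_cons_suffix h hm
  obtain ⟨t, ht⟩ := h
  have h1 := List.pairwise_lt_finRange N
  rw [← ht, List.pairwise_append] at h1
  have e : (List.finRange N).filter (fun m => i ≤ m) = i :: l := by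
    rw [← ht, List.filter_append, List.filter_eq_nil_iff.2, List.nil_append,
      List.filter_eq_self.2]
    · intro m hm
      rcases List.mem_cons.1 hm with rfl | hm
      · simp
      · simpa using (hlt m hm).le
    · intro m hm
      simpa using h1.2.2 m hm i (by simp)
  rw [tailProd, e, listProd]

variable {s} {Q : Set (Fin N → ℤ)}

/-- Expansion of `[s_j, s_i ^ k]` into conjugates of `[s_j, s_i]` by powers of `s_i`. -/
theorem rconj_rcomm_zpow_mem (hQ : ∀ a ∈ Q, ∀ i k, |k| ≤ |a i| → Function.update a i k ∈ Q)
    {i j : Fin N} {l : List (Fin N)} (hl : i :: l <:+ List.finRange N) (hij : i < j)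
    {a : Fin N → ℤ} (ha : a ∈ Q) {k : ℤ} (hk : |k| ≤ |a i|) :
    rconj (rcomm (s j) (s i ^ k)) (listProd s l a) ∈
      Subgroup.closure (tailCommutators s Q) := by
  have factor : ∀ k : ℤ, |k| ≤ |a i| →
      rconj (rcomm (s j) (s i)) (s i ^ k * listProd s l a) ∈
        Subgroup.closure (tailCommutators s Q) := by
    intro k hk
    have h1 : rconj (rcomm (s i) (s j)) (tailProd s i (Function.update a i k)) ∈
        Subgroup.closure (tailCommutators s Q) :=
      Subgroup.subset_closure ⟨i, j, _, hij, hQ a ha i k hk, rfl⟩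
    rw [tailProd_eq_listProd s hl, listProd_cons, Function.update_self,
      listProd_congr s (b := a) fun m hm => by
        rw [Function.update_of_ne (lt_of_cons_suffix hl hm).ne']] at h1
    have h2 := Subgroup.inv_mem _ h1
    convert h2 using 1
    simp only [rconj, rcomm]
    group
  have step : ∀ k : ℤ, rconj (rcomm (s j) (s i ^ (k + 1))) (listProd s l a) =
      rconj (rcomm (s j) (s i ^ k)) (listProd s l a) *
        rconj (rcomm (s j) (s i)) (s i ^ k * listProd s l a) := by
    intro k
    rw [zpow_add_one]
    simp only [rconj, rcomm]
    group
  induction k using Int.induction_on with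
  | zero => simp [rconj, rcomm]
  | succ k ih =>
    have h : |(k : ℤ)| ≤ |a i| := by rw [abs_of_nonneg (by omega)] at hk ⊢; omega
    rw [step]
    exact Subgroup.mul_mem _ (ih h) (factor k h)
  | pred k ih =>
    have h : |-(k : ℤ)| ≤ |a i| := by rw [abs_of_nonpos (by omega)] at hk ⊢; omega
    have h1 := ih h
    rw [← sub_add_cancel (-(k : ℤ)) 1, step] at h1
    exact (Subgroup.mul_mem_cancel_right _ (factor _ hk)).1 h1

/-- The discrepancy between `s_j * ∏ s_m ^ a_m` and the product with exponent vector `a + e_j`: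
moving `s_j` to its place past the powers of `s_i`, `i < j`, produces conjugates of the commutators
`[s_i, s_j]`. -/
theorem listProd_inv_mul_mem (hQ : ∀ a ∈ Q, ∀ i k, |k| ≤ |a i| → Function.update a i k ∈ Q)
    {l : List (Fin N)} (hl : l <:+ List.finRange N) {j : Fin N} (hj : j ∈ l)
    {a : Fin N → ℤ} (ha : a ∈ Q) :
    (listProd s l (a + Pi.single j 1))⁻¹ * s j * listProd s l a ∈
      Subgroup.closure (tailCommutators s Q) := by
  induction l with
  | nil => simp at hj
  | cons i l ih =>
    rw [listProd_cons, listProd_cons]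
    by_cases hij : i = j
    · subst hij
      rw [Pi.add_apply, Pi.single_eq_same, listProd_congr s (a := a + _) (b := a) fun m hm => by
        rw [Pi.add_apply, Pi.single_eq_of_ne (lt_of_cons_suffix hl hm).ne', add_zero]]
      convert Subgroup.one_mem _ using 1
      group
    · have hjl : j ∈ l := (List.mem_cons.1 hj).resolve_left (Ne.symm hij)
      have h1 := ih ((List.suffix_cons i l).trans hl) hjl
      have h2 := rconj_rcomm_zpow_mem hQ hl (lt_of_cons_suffix hl hjl) ha le_rfl (s := s)
      convert Subgroup.mul_mem _ h1 h2 using 1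
      rw [Pi.add_apply, Pi.single_eq_of_ne hij, add_zero]
      simp only [rconj, rcomm]
      group

/-- If the part of the Cayley graph lying over `Q` is connected, then the commutator subgroup is
generated by the tail commutators with exponents in `Q`: along a path in this part, the quotient of
the current vertex and the ordered product with the same coordinates changes by such elements. -/
theorem closure_tailCommutators {p : G →* Multiplicative (Fin N → ℤ)}
    (hs : ∀ m, crd p (s m) = Pi.single m 1)
    (hQ : ∀ a ∈ Q, ∀ i k, |k| ≤ |a i| → Function.update a i k ∈ Q) (h0 : 0 ∈ Q)
    (hconn : ∀ u v, crd p u ∈ Q → crd p v ∈ Q → Conn (signed s) {g | crd p g ∈ Q} u v) :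
    Subgroup.closure (tailCommutators s Q) = commutator G := by
  refine le_antisymm ?_ fun g hg => ?_
  · rw [Subgroup.closure_le]
    rintro _ ⟨i, j, a, -, -, rfl⟩
    exact rconj_rcomm_mem_commutator _ _ _
  have hg0 : crd p g = 0 := by
    have : g ∈ p.ker := Abelianization.commutator_subset_ker p hg
    rw [MonoidHom.mem_ker] at this
    rw [crd, this, toAdd_one]
  set H := Subgroup.closure (tailCommutators s Q)
  have key : ∀ j u, crd p u ∈ Q →
      ((listProd s (List.finRange N) (crd p (s j * u)))⁻¹ * (s j * u) ∈ H ↔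
      (listProd s (List.finRange N) (crd p u))⁻¹ * u ∈ H) := by
    intro j u hu
    have h1 := listProd_inv_mul_mem hQ List.suffix_rfl (List.mem_finRange j) hu (s := s)
    rw [crd_mul, hs, add_comm, ← Subgroup.mul_mem_cancel_left H h1 
      (y := (listProd s _ (crd p u))⁻¹ * u)]
    refine iff_of_eq (congrArg (· ∈ H) ?_)
    group
  have path : ∀ v, Conn (signed s) {g | crd p g ∈ Q} 1 v →
      (listProd s (List.finRange N) (crd p v))⁻¹ * v ∈ H := by
    intro v hv
    induction hv with
    | refl =>
      rw [crd_one]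
      convert Subgroup.one_mem _ using 1
      simp [listProd]
    | @tail u v _ huv ih =>
      obtain ⟨hu, hv, x, ⟨j, rfl⟩ | ⟨j, hj⟩, rfl⟩ := huv
      · exact (key j u hu).2 ih
      · refine (key j _ hv).1 ?_
        rwa [hj, inv_mul_cancel_left]
  have h1 := path g (hconn 1 g (by rwa [crd_one]) (by rwa [hg0]))
  rw [hg0] at h1
  convert h1 using 1
  simp [listProd]

end Transversal

/-! ### Counting core vectors -/

section Counting

variable {n : ℕ}

theorem commute_of_fixes {g h : IA n} {p i : Fin n} (hpi : p ≠ i)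
    (hg : ∀ l ≠ p, Fixes g (FreeGroup.of l)) (hh : ∀ l ≠ i, Fixes h (FreeGroup.of l))
    (hgp : Fixes h (g.1 (FreeGroup.of p))) (hhi : Fixes g (h.1 (FreeGroup.of i))) :
    Commute g h := by
  refine Subtype.ext (mulAut_ext_of fun l => ?_)
  change g.1 (h.1 _) = h.1 (g.1 _)
  by_cases hl : l = i
  · subst hl; rw [hhi, hg l hpi.symm]
  · rw [hh l hl]
    by_cases hl' : l = p
    · subst hl'; exact hgp.symm
    · rw [hg l hl', hh l hl]

theorem fixes_magnusGen {i j k l : Fin n} (h : l ≠ i) :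
    Fixes (magnusGen i j k) (FreeGroup.of l) := by
  rw [magnusGen]
  split_ifs
  · rfl
  · exact magnusPair_ne _ _ _ _ h
  · exact magnusPair_ne _ _ _ _ h
  · exact magnusTriple_ne _ _ _ _ _ _ h

theorem Fixes.magnusGen_apply {g : IA n} {i j k : Fin n} (hi : Fixes g (FreeGroup.of i))
    (hj : Fixes g (FreeGroup.of j)) (hk : Fixes g (FreeGroup.of k)) :
    Fixes g ((magnusGen i j k).1 (FreeGroup.of i)) := by
  rw [magnusGen]
  split_ifs
  · exact hi
  · rw [magnusPair_self]; exact (hk.inv.mul hi).mul hk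
  · rw [magnusPair_self]; exact (hj.inv.mul hi).mul hj
  · rw [magnusTriple_self]; exact hi.mul (((hj.inv.mul hk.inv).mul hj).mul hk)

theorem commute_magnusGen {i j k p q r : Fin n} (hi : p ≠ i) (hj : p ≠ j) (hk : p ≠ k)
    (hq : q ≠ i) (hr : r ≠ i) : Commute (magnusGen p q r) (magnusGen i j k) :=
  commute_of_fixes hi (fun _ => fixes_magnusGen) (fun _ => fixes_magnusGen)
    ((fixes_magnusGen hi).magnusGen_apply (fixes_magnusGen hq) (fixes_magnusGen hr))
    ((fixes_magnusGen hi.symm).magnusGen_apply (fixes_magnusGen hj.symm) (fixes_magnusGen hk.symm))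

open Classical in
/-- A generator moving `x_p` by a word in `x_q`, `x_r` commutes with one moving `x_i` by a word in
`x_j`, `x_k` unless `p ∈ {i, j, k}` or `i ∈ {q, r}`. -/
theorem card_not_commute_magnusGen_le (i j k : Fin n) :
    (Finset.univ.filter fun x : Fin n × {p : Fin n × Fin n // p.1 < p.2} =>
      ¬ Commute (magnusGen x.1 x.2.1.1 x.2.1.2) (magnusGen i j k)).card ≤ 4 * n ^ 2 := by
  set U : Finset (Fin n × {p : Fin n × Fin n // p.1 < p.2}) := ({i, j, k} : Finset _) ×ˢ Finset.univ
  set V := Finset.univ.filter fun x : Fin n × {p : Fin n × Fin n // p.1 < p.2} =>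
    x.2.1.1 = i ∨ x.2.1.2 = i
  have hU : U.card ≤ 3 * n.choose 2 := by
    rw [Finset.card_product, Finset.card_univ, card_lt_pairs]
    exact Nat.mul_le_mul_right _ Finset.card_le_three
  have hV : V.card ≤ n ^ 2 + n ^ 2 := by
    have h1 : V.card ≤ (((Finset.univ : Finset (Fin n × Fin n)).image fun y => (y.1, i, y.2)) ∪
        ((Finset.univ : Finset (Fin n × Fin n)).image fun y => (y.1, y.2, i))).card := by
      refine Finset.card_le_card_of_injOn (fun x => (x.1, x.2.1)) ?_ ?_
      · rintro ⟨p, ⟨⟨q, r⟩, hqr⟩⟩ hx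
        simpa [V, eq_comm] using hx
      · rintro ⟨p, ⟨q, hq⟩⟩ _ ⟨p', ⟨q', hq'⟩⟩ _ h
        simpa using h
    refine h1.trans ((Finset.card_union_le _ _).trans (add_le_add ?_ ?_)) <;>
    · refine Finset.card_image_le.trans ?_
      simp [sq]
  have hsub : (Finset.univ.filter fun x : Fin n × {p : Fin n × Fin n // p.1 < p.2} =>
      ¬ Commute (magnusGen x.1 x.2.1.1 x.2.1.2) (magnusGen i j k)) ⊆ U ∪ V := by
    rintro ⟨p, ⟨⟨q, r⟩, hqr⟩⟩ hx
    rw [Finset.mem_filter] at hx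
    by_contra hx'
    simp only [U, V, Finset.mem_union, Finset.mem_product, Finset.mem_insert,
      Finset.mem_singleton, Finset.mem_univ, Finset.mem_filter, and_true, true_and, not_or] at hx'
    exact hx.2 (commute_magnusGen hx'.1.1 hx'.1.2.1 hx'.1.2.2 hx'.2.1 hx'.2.2)
  have h2 : 2 * n.choose 2 ≤ n ^ 2 := by
    rw [Nat.choose_two_right, sq]
    exact (Nat.mul_div_le _ _).trans (Nat.mul_le_mul_left _ (by omega))
  have h3 := (Finset.card_le_card hsub).trans (Finset.card_union_le _ _)
  omega

open Classical in
theorem card_not_commute_le {ι : Type*} [Fintype ι] {s : ι → IA n} (hs : Function.Injective s)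
    (hr : Set.range s = magnusSet n) (i : ι) :
    (Finset.univ.filter fun m => ¬ Commute (s m) (s i)).card ≤ 4 * n ^ 2 := by
  have h : ∀ m, ∃ x : Fin n × {p : Fin n × Fin n // p.1 < p.2},
      magnusGen x.1 x.2.1.1 x.2.1.2 = s m := fun m => by
    have h1 : s m ∈ Set.range s := ⟨m, rfl⟩
    rwa [hr, magnusSet_eq_range] at h1
  choose e he using h
  refine le_trans ?_ (card_not_commute_magnusGen_le (e i).1 (e i).2.1.1 (e i).2.1.2)
  refine Finset.card_le_card_of_injOn e ?_ ?_
  · intro m hm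
    simpa [he] using hm
  · intro m _ m' _ h
    exact hs (by rw [← he, ← he, h])

open Classical in
/-- The generators that fail to commute with one of two given ones. -/
noncomputable def linkSupport {ι : Type*} [Fintype ι] (s : ι → IA n) (i j : ι) : Finset ι :=
  Finset.univ.filter fun m => ¬ Commute (s m) (s i) ∨ ¬ Commute (s m) (s j)

theorem card_linkSupport_le {ι : Type*} [Fintype ι] {s : ι → IA n} (hs : Function.Injective s)
    (hr : Set.range s = magnusSet n) (i j : ι) : (linkSupport s i j).card ≤ 8 * n ^ 2 := by
  classical
  have h1 := card_not_commute_le hs hr i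
  have h2 := card_not_commute_le hs hr j
  rw [linkSupport, Finset.filter_or]
  refine (Finset.card_union_le _ _).trans ?_
  linarith

theorem card_support_le {ι : Type*} [Fintype ι] {s : ι → IA n} (hs : Function.Injective s)
    (hr : Set.range s = magnusSet n) {B : ℤ} {a : ι → ℤ} (ha : a ∈ coreVectors s B) :
    (Finset.univ.filter fun m => a m ≠ 0).card ≤ 8 * n ^ 2 := by
  classical
  obtain ⟨-, i, j, hij⟩ := ha
  refine (Finset.card_le_card fun m hm => ?_).trans (card_linkSupport_le hs hr i j)
  rw [Finset.mem_filter] at hm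
  rw [linkSupport, Finset.mem_filter]
  exact ⟨hm.1, hij m hm.2⟩

open Classical in
/-- A finite set containing the core vectors. -/
noncomputable def coreFinset {ι : Type*} [Fintype ι] (s : ι → IA n) (B : ℕ) : Finset (ι → ℤ) :=
  (Finset.univ : Finset (ι × ι)).biUnion fun x =>
    Fintype.piFinset fun m => if m ∈ linkSupport s x.1 x.2 then Finset.Ioo (-B : ℤ) B else {0}

theorem coreVectors_subset_coreFinset {ι : Type*} [Fintype ι] (s : ι → IA n) (B : ℕ) :
    coreVectors s (B : ℤ) ⊆ coreFinset s B := by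
  classical
  rintro a ⟨hb, i, j, hij⟩
  rw [Finset.mem_coe, coreFinset, Finset.mem_biUnion]
  refine ⟨(i, j), Finset.mem_univ _, Fintype.mem_piFinset.2 fun m => ?_⟩
  split_ifs with h
  · rw [Finset.mem_Ioo]
    exact abs_lt.1 (hb m)
  · rw [Finset.mem_singleton]
    by_contra h0
    exact h (by rw [linkSupport, Finset.mem_filter]; exact ⟨Finset.mem_univ _, hij m h0⟩)

theorem card_coreFinset_le {ι : Type*} [Fintype ι] {s : ι → IA n} (hs : Function.Injective s)
    (hr : Set.range s = magnusSet n) {B : ℕ} (hB : 0 < B) :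
    (coreFinset s B).card ≤ Fintype.card ι ^ 2 * (2 * B) ^ (8 * n ^ 2) := by
  classical
  have h : ∀ x : ι × ι, (Fintype.piFinset fun m =>
      if m ∈ linkSupport s x.1 x.2 then Finset.Ioo (-B : ℤ) B else {0}).card ≤
      (2 * B) ^ (8 * n ^ 2) := by
    intro x
    rw [Fintype.card_piFinset]
    have h1 : ∀ m, (if m ∈ linkSupport s x.1 x.2 then Finset.Ioo (-B : ℤ) B else {0}).card ≤
        if m ∈ linkSupport s x.1 x.2 then 2 * B else 1 := by
      intro m
      split_ifs
      · rw [Int.card_Ioo]; omega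
      · simp
    refine (Finset.prod_le_prod' fun m _ => h1 m).trans ?_
    rw [Finset.prod_ite_mem, Finset.univ_inter, Finset.prod_const]
    exact Nat.pow_le_pow_right (by omega) (card_linkSupport_le hs hr _ _)
  refine (Finset.card_biUnion_le_card_mul _ _ _ fun x _ => h x).trans ?_
  rw [Finset.card_univ, Fintype.card_prod, sq (Fintype.card ι)]

theorem finite_tailCommutators {G : Type*} [Group G] {N : ℕ} (s : Fin N → G)
    {Q : Set (Fin N → ℤ)} {F : Finset (Fin N → ℤ)} (hQ : Q ⊆ F) :
    ∃ E : Finset G, tailCommutators s Q = E ∧ E.card ≤ N ^ 2 * F.card := by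
  classical
  set f : (Fin N × Fin N) × (Fin N → ℤ) → G := fun x =>
    rconj (rcomm (s x.1.1) (s x.1.2)) (tailProd s x.1.1 x.2)
  have h : tailCommutators s Q ⊆ ((Finset.univ ×ˢ F).image f : Finset G) := by
    rintro g ⟨i, j, a, -, ha, rfl⟩
    rw [Finset.mem_coe, Finset.mem_image]
    exact ⟨((i, j), a), Finset.mem_product.2 ⟨Finset.mem_univ _, hQ ha⟩, rfl⟩
  have hfin := (Finset.finite_toSet _).subset h
  refine ⟨hfin.toFinset, by simp, ?_⟩
  refine (Finset.card_le_card (hfin.toFinset_subset.2 h)).trans (Finset.card_image_le.trans ?_)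
  rw [Finset.card_product, Finset.card_univ, Fintype.card_prod, Fintype.card_fin, sq]

end Counting

/-! ### Generation of the commutator subgroup -/

section Generation

variable {n : ℕ} {ι : Type*}

/-- The Magnus generators are a basis of the image of `IA_n` in a free abelian group. -/
theorem exists_coordinates {s : ι → IA n} (hs : Function.Injective s)
    (hr : Set.range s = magnusSet n) [DecidableEq ι] :
    ∃ p : IA n →* Multiplicative (ι → ℤ), ∀ m, crd p (s m) = Pi.single m 1 := by
  have hmem : ∀ m, s m ∈ magnusSet n := fun m => hr ▸ ⟨m, rfl⟩
  choose d hd hd' using fun m => exists_dual (hmem m)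
  refine ⟨⟨⟨fun g => Multiplicative.ofAdd fun m => (d m g).toAdd, ?_⟩, ?_⟩, fun m => ?_⟩
  · simp only [map_one]; rfl
  · intro g h
    simp only [map_mul]; rfl
  · funext k
    change (d k (s m)).toAdd = _
    by_cases hk : k = m
    · subst hk; rw [hd, Pi.single_eq_same]; rfl
    · rw [hd' k _ (hmem m) fun h => hk (hs h).symm, Pi.single_eq_of_ne hk]; rfl

theorem signed_eq {s : ι → IA n} (hr : Set.range s = magnusSet n) :
    signed s = signedMagnusSet n := by rw [signed, hr, signedMagnusSet]

theorem signedMagnusSet_subset_letters : signedMagnusSet n ⊆ letters n := by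
  have h : magnusSet n ⊆ letters n := by
    rintro _ (⟨i, j, hij, rfl⟩ | ⟨i, j, k, hij, hik, -, rfl⟩)
    · rw [magnusPair_eq]; exact conjGen_mem_letters i j true
    · rw [magnusTriple_eq]; exact commRight_mem_letters i j k true true
  rintro g (hg | hg)
  · exact h hg
  · have := inv_mem_letters (h hg)
    rwa [inv_inv] at this

/-- Letters have the same image in the abelianization as a Magnus generator, the inverse of one, or
the identity. -/
theorem isAlphabet_letters [Fintype ι] [DecidableEq ι] {s : ι → IA n}
    (hr : Set.range s = magnusSet n) {p : IA n →* Multiplicative (ι → ℤ)}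
    (hp : ∀ m, crd p (s m) = Pi.single m 1) : IsAlphabet p (signed s) (letters n) 9 := by
  have h1 : ∀ x ∈ signed s, oneNorm (crd p x) ≤ 1 := by
    intro x hx
    obtain ⟨m, ε, hε, rfl⟩ := exists_zpow_of_mem_signed hx
    rw [crd_zpow hp, oneNorm, Finset.sum_eq_single m]
    · rw [Pi.single_eq_same]; rcases hε with rfl | rfl <;> norm_num
    · intro k _ hk; rw [Pi.single_eq_of_ne hk, abs_zero]
    · intro h; exact absurd (Finset.mem_univ m) h
  refine ⟨?_, fun _ => inv_mem_letters, h1, ?_, ?_⟩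
  · rw [signed_eq hr]; exact fun _ => inv_mem_signedMagnusSet
  · intro x hx
    obtain ⟨-, h, hh, e⟩ := isShort_of_mem_letters hx
    have : p x = p h := by
      rw [← Abelianization.lift_apply_of p x, ← Abelianization.lift_apply_of p h, e]
    rw [crd, this]
    rcases hh with rfl | hh
    · rw [map_one, toAdd_one, oneNorm_zero]; norm_num
    · exact h1 h (by rwa [signed_eq hr])
  · rw [signed_eq hr]; exact fun x hx => (isShort_of_mem_letters hx).1

theorem closure_tailCommutators_coreVectors (hn : 8 ≤ n) {N : ℕ} {s : Fin N → IA n}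
    (hs : Function.Injective s) (hr : Set.range s = magnusSet n) :
    Subgroup.closure (tailCommutators s (coreVectors s (5 * 10 ^ 12))) = commutator (IA n) := by
  obtain ⟨p, hp⟩ := exists_coordinates hs hr
  have hN : Nonempty (Fin N) := by
    have h1 : (magnusSet n).Nonempty := by
      refine ⟨_, .inl ⟨⟨0, by omega⟩, ⟨1, by omega⟩, ?_, rfl⟩⟩
      simp
    rw [← hr] at h1
    exact Set.range_nonempty_iff_nonempty.1 h1
  obtain ⟨m₀⟩ := hN
  have hΛ := isAlphabet_letters hr hp
  refine closure_tailCommutators hp (fun a ha i k hk => update_mem_coreVectors ha hk) ?_ ?_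
  · refine ⟨fun m => by norm_num, m₀, m₀, fun m hm => absurd rfl hm⟩
  · intro u v hu hv
    -- This is where the bound on the exponents comes from:
    -- `(144 + (2170800 + 9)) * (8 * 144 + 1) ^ 2 < 2 * (5 * 10 ^ 12)`.
    refine conn_core (L := 144) (W := 2170800) hp hΛ ?_ ?_ (by norm_num) (by norm_num) ?_ hu hv
    · rw [signed_eq hr]; exact signedMagnusSet_subset_letters
    · rw [hr, closure_magnusSet]
    · intro χ M m hM0 hM x hx
      exact good_letters_of_mem_magnusSet hn (hr ▸ ⟨m, rfl⟩) hM0 hM hx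

theorem rank_le_of_closure_eq {G : Type*} [Group G] {K : Subgroup G} {E : Finset G}
    (h : Subgroup.closure (E : Set G) = K) {k : ℕ} (hk : E.card ≤ k) :
    ∃ _ : Group.FG K, Group.rank K ≤ k := by
  subst h
  exact ⟨inferInstance, (Subgroup.rank_closure_finset_le_card E).trans hk⟩

theorem count_le (n : ℕ) :
    (n * n.choose 2) ^ 2 * ((n * n.choose 2) ^ 2 * (2 * (5 * 10 ^ 12)) ^ (8 * n ^ 2)) ≤
      (2 ^ 12 * (2 * (5 * 10 ^ 12)) ^ 8) ^ n ^ 2 := by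
  have h1 : n.choose 2 ≤ n ^ 2 := Nat.choose_le_pow n 2
  have h2 : n * n.choose 2 ≤ n ^ 3 := by
    rw [pow_succ' n 2]; exact Nat.mul_le_mul_left _ h1
  have h3 : n ≤ 2 ^ n ^ 2 := (Nat.le_self_pow two_ne_zero n).trans (Nat.lt_two_pow_self).le
  have h4 : (n * n.choose 2) ^ 2 * (n * n.choose 2) ^ 2 ≤ (2 ^ 12) ^ n ^ 2 :=
    calc (n * n.choose 2) ^ 2 * (n * n.choose 2) ^ 2 = (n * n.choose 2) ^ 4 := by ring
      _ ≤ (n ^ 3) ^ 4 := Nat.pow_le_pow_left h2 4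
      _ = n ^ 12 := by ring
      _ ≤ (2 ^ n ^ 2) ^ 12 := Nat.pow_le_pow_left h3 12
      _ = (2 ^ 12) ^ n ^ 2 := by rw [← pow_mul, ← pow_mul, mul_comm]
  rw [← mul_assoc, mul_pow (2 ^ 12), ← pow_mul (2 * (5 * 10 ^ 12))]
  exact Nat.mul_le_mul_right _ h4

end Generation

theorem mainTheorem2 :
    (∀ n : ℕ, 8 ≤ n →
      (magnusSet n).ncard = n * n.choose 2 ∧
      ∀ s : Fin (n * n.choose 2) → IA n, Function.Injective s → Set.range s = magnusSet n →
        Subgroup.closure {g : IA n | ∃ (i j : Fin (n * n.choose 2))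
            (a : Fin (n * n.choose 2) → ℤ), i < j ∧ (∀ m, |a m| < 5 * 10 ^ 12) ∧
            g = rconj (rcomm (s i) (s j)) (tailProd s i a)} = commutator (IA n) ∧
        Subgroup.closure {g : IA n | ∃ (i j : Fin (n * n.choose 2))
            (a : Fin (n * n.choose 2) → ℤ), i < j ∧ (∀ m, |a m| < 5 * 10 ^ 12) ∧
            (Finset.univ.filter (fun m => a m ≠ 0)).card ≤ 8 * n ^ 2 ∧
            g = rconj (rcomm (s i) (s j)) (tailProd s i a)} = commutator (IA n)) ∧
    (∃ C : ℕ, ∀ n : ℕ, 8 ≤ n →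
      ∃ _ : Group.FG (commutator (IA n)), Group.rank (commutator (IA n)) ≤ C ^ (n ^ 2)) := by
  refine ⟨fun n hn => ⟨ncard_magnusSet n, fun s hs hr => ?_⟩, ?_⟩
  · have h := closure_tailCommutators_coreVectors hn hs hr
    constructor <;> refine le_antisymm ?_ (h.symm.le.trans (Subgroup.closure_mono ?_))
    · rw [Subgroup.closure_le]
      rintro _ ⟨i, j, a, -, -, rfl⟩
      exact rconj_rcomm_mem_commutator _ _ _
    · rintro _ ⟨i, j, a, hij, ha, rfl⟩
      exact ⟨i, j, a, hij, ha.1, rfl⟩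
    · rw [Subgroup.closure_le]
      rintro _ ⟨i, j, a, -, -, -, rfl⟩
      exact rconj_rcomm_mem_commutator _ _ _
    · rintro _ ⟨i, j, a, hij, ha, rfl⟩
      exact ⟨i, j, a, hij, ha.1, card_support_le hs hr ha, rfl⟩
  · refine ⟨2 ^ 12 * (2 * (5 * 10 ^ 12)) ^ 8, fun n hn => ?_⟩
    obtain ⟨s, hs, hr⟩ : ∃ s : Fin (n * n.choose 2) → IA n, Function.Injective s ∧
        Set.range s = magnusSet n := by
      have hfin : (magnusSet n).Finite := by
        rw [magnusSet_eq_range]; exact Set.finite_range _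
      have := hfin.to_subtype
      let e := Finite.equivFinOfCardEq (ncard_magnusSet n)
      refine ⟨fun m => (e.symm m).1, Subtype.val_injective.comp e.symm.injective, ?_⟩
      change Set.range (Subtype.val ∘ e.symm) = _
      rw [Set.range_comp, e.symm.surjective.range_eq, Set.image_univ, Subtype.range_coe]
    have h := closure_tailCommutators_coreVectors hn hs hr
    have hsub : coreVectors s (5 * 10 ^ 12) ⊆ coreFinset s (5 * 10 ^ 12) := by
      have e : ((5 * 10 ^ 12 : ℕ) : ℤ) = 5 * 10 ^ 12 := by norm_num
      exact e ▸ coreVectors_subset_coreFinset s (5 * 10 ^ 12)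
    have hcard := card_coreFinset_le hs hr (B := 5 * 10 ^ 12) (by norm_num)
    rw [Fintype.card_fin] at hcard
    obtain ⟨E, hE, hEc⟩ := finite_tailCommutators s hsub
    rw [hE] at h
    exact rank_le_of_closure_eq h (hEc.trans ((Nat.mul_le_mul_left _ hcard).trans (count_le n)))
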